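/- Conventions. Both theories below are dependent type theories with the judgements "$\Gamma$ is a context", "$A$ is a type (of a given kind)", "$A=B$", "$a\in A$", "$a=b\in A$", over fully annotated pre-expressions (each term carries the information needed to infer its type), with the usual structural rules (variables, weakening and substitution, replacement of equals, equality is an equivalence relation, conversion). *The theory $\mathbf{mTT}_{\mathsf{imp}}$.* The intensional level $\mathbf{mTT}$ of the Minimalist Foundation has four kinds of types, $prop_s$ (small propositions), $prop$, $set$ and $col$ (collections), with $prop_s\subseteq prop\subseteq col$ and $prop_s\subseteq set\subseteq col$. The sets are closed under $\mathsf N_0$, $\mathsf N_1$, $+$, $\mathsf{List}$, $\Sigma$, $\Pi$; the collections are closed under $\Sigma$ and contain the universe $\mathsf{Prop_s}$ of small propositions (à la Tarski, with decoding $\mathsf T(c)$ and codes $\widehat\varphi$ such that $\mathsf T(\widehat\varphi)=\varphi$ and $\widehat{\mathsf T(c)}=c$) and $A\to\mathsf{Prop_s}$ for each set $A$; the eliminators of $\mathsf N_0,\mathsf N_1,+,\mathsf{List},\Sigma$ act towards all collections. The propositions are built from $\bot,\vee,\wedge,\Rightarrow,\forall,\exists,\mathsf{Id}$ (over arbitrary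 collections; small when the components are small and the domains are sets), with proof-terms, eliminators acting towards propositions only ($\mathsf{Id}$ being eliminated towards binary relations $C(x,y)\ prop$ from $c(x)\in C(x,x)$), and $\beta$-rules. The theory $\mathbf{mTT}_{\mathsf{imp}}$ adds to $\mathbf{mTT}$ the congruence rules for types and terms and the resizing rules (for types and for their equality) $$\frac{A\ col}{A\ set}\qquad\frac{\varphi\ prop}{\varphi\ prop_s}.$$ *The theory $\mathbf{CC}_{\mathsf{ML}}$* is the Calculus of Constructions of Coquand and Huet: its only universe is the impredicative type $\mathsf{Prop}$, whose terms are themselves types; $(\Pi x\in A)B$ is a type for all types $A$ and $B(x)$, and a term of $\mathsf{Prop}$ whenever $B(x)\in\mathsf{Prop}$; conversion is generated by $\beta$. It is extended with the rules of Martin-Löf's type theory for $\mathsf N_0$, $\mathsf N_1$, $+$, $\mathsf{List}$ and $\Sigma$, eliminated towards all types. *Translations.* Let $(-)^{e}$ be the translation from the pre-expressions of $\mathbf{mTT}_{\mathsf{imp}}$ to those of $\mathbf{CC}_{\mathsf{ML}}$ which sends $\mathsf{Prop_s}$ to $\mathsf{Prop}$, erases $\mathsf T$ and $\widehat{\phantom{x}}$,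 sends both $\forall$ and $\Pi$ (with their abstractions and applications) to $\Pi$, keeps $\mathsf N_0,\mathsf N_1,+,\mathsf{List},\Sigma$ and their terms, and sends the other propositional constructors to their impredicative encodings $$\bot:\ (\Pi p\in\mathsf{Prop})\,p,\qquad \varphi\Rightarrow\psi:\ \varphi\to\psi,\qquad \varphi\wedge\psi:\ (\Pi p\in\mathsf{Prop})((\varphi\to(\psi\to p))\to p),$$ $$\varphi\vee\psi:\ (\Pi p\in\mathsf{Prop})((\varphi\to p)\to((\psi\to p)\to p)),\qquad (\exists x\in A)\varphi(x):\ (\Pi p\in\mathsf{Prop})\big((\Pi x\in A)(\varphi(x)\to p)\to p\big),$$ $$\mathsf{Id}(A,a,b):\ (\Pi P\in A\to\mathsf{Prop})(P(a)\to P(b)),$$ and their proof-terms to the usual ones for these encodings. On judgements, sets and collections become types, "$\varphi\ prop$" and "$\varphi\ prop_s$" become $\varphi^e\in\mathsf{Prop}$, and equalities are treated likewise. Conversely, let $(-)^{m}$ be the translation from $\mathbf{CC}_{\mathsf{ML}}$ to $\mathbf{mTT}_{\mathsf{imp}}$ which sends $\mathsf{Prop}$ to $\mathsf{Prop_s}$,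 inserts $\mathsf T$ and $\widehat{\phantom{x}}$ where a proposition is used as a type or as a term, and sends $(\Pi x\in A)B$ (with its abstraction and application) to $\forall$ if $B$ is a proposition and to $\Pi$ otherwise. **Proposition.** $\mathbf{mTT}_{\mathsf{imp}}$ coincides with $\mathbf{CC}_{\mathsf{ML}}$, in the following sense. 1. The judgements derivable in $\mathbf{CC}_{\mathsf{ML}}$ are exactly the judgements $J^{e}$ with $J$ derivable in $\mathbf{mTT}_{\mathsf{imp}}$. (In particular the encodings satisfy in $\mathbf{CC}_{\mathsf{ML}}$ all the rules, computation rules included, of the propositional constructors.) 2. $(E^{m})^{e}$ is $E$ for every pre-expression $E$ of $\mathbf{CC}_{\mathsf{ML}}$; a judgement $J$ is derivable in $\mathbf{CC}_{\mathsf{ML}}$ if and only if $J^{m}$ is derivable in $\mathbf{mTT}_{\mathsf{imp}}$; and $\varphi\in\mathsf{Prop}\ [\Gamma]$ is derivable in $\mathbf{CC}_{\mathsf{ML}}$ if and only if $\varphi^{m}\ prop\ [\Gamma^{m}]$ is derivable in $\mathbf{mTT}_{\mathsf{imp}}$ (where $\varphi$ is translated as a type). 3. The propositional constructors match their impredicative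 encodings: in $\mathbf{mTT}_{\mathsf{imp}}$, in every context and for all $\varphi,\psi\ prop$ (respectively, $A\ col$ and $\varphi(x)\ prop\ [x\in A]$; $A\ col$ and $a,b\in A$), each of $\bot$, $\varphi\vee\psi$, $\varphi\wedge\psi$, $\varphi\Rightarrow\psi$, $(\exists x\in A)\varphi(x)$, $\mathsf{Id}(A,a,b)$ is provably logically equivalent to its encoding made from $\forall$ alone (read with $\forall$ for $\Pi$ and $\to$, with $\mathsf{Prop_s}$ for $\mathsf{Prop}$, and with $\mathsf T$ inserted, but with $A\to\mathsf{Prop_s}$ kept as a function space). 4. $\forall$ and $\Pi$ are interchangeable: if $A\ col$ and $\varphi(x)\ prop\ [x\in A]$, there are in $\mathbf{mTT}_{\mathsf{imp}}$ functional terms from $(\Pi x\in A)\varphi(x)$ to $(\forall x\in A)\varphi(x)$ and back that preserve application up to judgemental equality. -/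

import Mathlib

/-! Two dependent type theories over fully annotated pre-expressions with de Bruijn indices:
`MTT` (the intensional level of the Minimalist Foundation, made impredicative by resizing) and
`CC` (the Calculus of Constructions with the first-order inductive types of Martin-Löf). -/

/-- Lifting of a renaming under one binder. -/
def upr (f : ℕ → ℕ) : ℕ → ℕ
  | 0 => 0
  | n + 1 => f n + 1

/-- The substitution sending the index `0` to `a` and `n + 1` to `σ n`. -/
def scons {α : Type} (a : α) (σ : ℕ → α) : ℕ → α
  | 0 => a
  | n + 1 => σ n

/-! ## The theory `MTT` -/

namespace MTT

/-- Pre-types, pre-propositions and pre-terms, in one grammar. In the comments, `[k]` marks an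
argument in which `k` further variables are bound. -/
inductive Exp : Type
  | var (n : ℕ)
  -- collections and sets: N₀, N₁, A + B, List(A), (Σ x ∈ A) B[1], (Π x ∈ A) B[1], Propₛ
  | empty
  | unit
  | sum (A B : Exp)
  | list (A : Exp)
  | sig (A B : Exp)
  | pi (A B : Exp)
  | univ
  -- propositions: T(c), ⊥, φ ∨ ψ, φ ∧ ψ, φ ⇒ ψ, (∀ x ∈ A) φ[1], (∃ x ∈ A) φ[1], Id(A, a, b)
  | dec (c : Exp)
  | bot
  | or (φ ψ : Exp)
  | and (φ ψ : Exp)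
  | imp (φ ψ : Exp)
  | all (A φ : Exp)
  | ex (A φ : Exp)
  | ident (A a b : Exp)
  -- terms of collections; `code φ` is the name of `φ` in Propₛ
  | code (φ : Exp)
  -- motive C[1]
  | elEmpty (C a : Exp)
  | star
  -- motive C[1]
  | elUnit (C t c : Exp)
  -- family B[1]
  | pair (A B a b : Exp)
  -- family B[1], motive C[1], branch m[2]
  | elSig (A B C d m : Exp)
  | nil (A : Exp)
  -- the list `s` followed by the element `c` of type `A`
  | cons (A s c : Exp)
  -- motive C[1], branch l[3] (list, element, value at the list)
  | elList (A C s a l : Exp)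
  | inl (A B a : Exp)
  | inr (A B b : Exp)
  -- motive C[1], branches l[1], r[1]
  | elSum (A B C w l r : Exp)
  -- family B[1], body b[1]
  | lam (A B b : Exp)
  -- family B[1]
  | app (A B f a : Exp)
  -- proof-terms
  | elBot (ξ a : Exp)
  | orInl (φ ψ a : Exp)
  | orInr (φ ψ b : Exp)
  -- branches l[1], r[1]
  | elOr (φ ψ ξ w l r : Exp)
  | andI (φ ψ a b : Exp)
  | andL (φ ψ p : Exp)
  | andR (φ ψ p : Exp)
  -- body b[1]
  | impI (φ ψ b : Exp)
  | impE (φ ψ f a : Exp)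
  -- predicate φ[1], body b[1]
  | allI (A φ b : Exp)
  -- predicate φ[1]
  | allE (A φ f a : Exp)
  -- predicate φ[1]
  | exI (A φ a b : Exp)
  -- predicate φ[1], branch m[2]
  | elEx (A φ ξ d m : Exp)
  | refl (A a : Exp)
  -- relation ξ[2], branch c[1]
  | elIdent (A ξ a b p c : Exp)

namespace Exp

/-- Renaming of the free variables. -/
def ren (f : ℕ → ℕ) : Exp → Exp
  | var n => var (f n)
  | empty => empty
  | unit => unit
  | sum A B => sum (A.ren f) (B.ren f)
  | list A => list (A.ren f)
  | sig A B => sig (A.ren f) (B.ren (upr f))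
  | pi A B => pi (A.ren f) (B.ren (upr f))
  | univ => univ
  | dec c => dec (c.ren f)
  | bot => bot
  | or φ ψ => or (φ.ren f) (ψ.ren f)
  | and φ ψ => and (φ.ren f) (ψ.ren f)
  | imp φ ψ => imp (φ.ren f) (ψ.ren f)
  | all A φ => all (A.ren f) (φ.ren (upr f))
  | ex A φ => ex (A.ren f) (φ.ren (upr f))
  | ident A a b => ident (A.ren f) (a.ren f) (b.ren f)
  | code φ => code (φ.ren f)
  | elEmpty C a => elEmpty (C.ren (upr f)) (a.ren f)
  | star => star
  | elUnit C t c => elUnit (C.ren (upr f)) (t.ren f) (c.ren f)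
  | pair A B a b => pair (A.ren f) (B.ren (upr f)) (a.ren f) (b.ren f)
  | elSig A B C d m =>
      elSig (A.ren f) (B.ren (upr f)) (C.ren (upr f)) (d.ren f) (m.ren (upr (upr f)))
  | nil A => nil (A.ren f)
  | cons A s c => cons (A.ren f) (s.ren f) (c.ren f)
  | elList A C s a l =>
      elList (A.ren f) (C.ren (upr f)) (s.ren f) (a.ren f) (l.ren (upr (upr (upr f))))
  | inl A B a => inl (A.ren f) (B.ren f) (a.ren f)
  | inr A B b => inr (A.ren f) (B.ren f) (b.ren f)
  | elSum A B C w l r =>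
      elSum (A.ren f) (B.ren f) (C.ren (upr f)) (w.ren f) (l.ren (upr f)) (r.ren (upr f))
  | lam A B b => lam (A.ren f) (B.ren (upr f)) (b.ren (upr f))
  | app A B g a => app (A.ren f) (B.ren (upr f)) (g.ren f) (a.ren f)
  | elBot ξ a => elBot (ξ.ren f) (a.ren f)
  | orInl φ ψ a => orInl (φ.ren f) (ψ.ren f) (a.ren f)
  | orInr φ ψ b => orInr (φ.ren f) (ψ.ren f) (b.ren f)
  | elOr φ ψ ξ w l r =>
      elOr (φ.ren f) (ψ.ren f) (ξ.ren f) (w.ren f) (l.ren (upr f)) (r.ren (upr f))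
  | andI φ ψ a b => andI (φ.ren f) (ψ.ren f) (a.ren f) (b.ren f)
  | andL φ ψ p => andL (φ.ren f) (ψ.ren f) (p.ren f)
  | andR φ ψ p => andR (φ.ren f) (ψ.ren f) (p.ren f)
  | impI φ ψ b => impI (φ.ren f) (ψ.ren f) (b.ren (upr f))
  | impE φ ψ g a => impE (φ.ren f) (ψ.ren f) (g.ren f) (a.ren f)
  | allI A φ b => allI (A.ren f) (φ.ren (upr f)) (b.ren (upr f))
  | allE A φ g a => allE (A.ren f) (φ.ren (upr f)) (g.ren f) (a.ren f)
  | exI A φ a b => exI (A.ren f) (φ.ren (upr f)) (a.ren f) (b.ren f)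
  | elEx A φ ξ d m =>
      elEx (A.ren f) (φ.ren (upr f)) (ξ.ren f) (d.ren f) (m.ren (upr (upr f)))
  | refl A a => refl (A.ren f) (a.ren f)
  | elIdent A ξ a b p c =>
      elIdent (A.ren f) (ξ.ren (upr (upr f))) (a.ren f) (b.ren f) (p.ren f) (c.ren (upr f))

/-- Weakening by `k` variables. -/
def wk (k : ℕ) (e : Exp) : Exp := e.ren (· + k)

/-- Weakening by `k` variables that are inserted below one bound variable. -/
def wkUnder (k : ℕ) (e : Exp) : Exp := e.ren (upr (· + k))

/-- The weakening substitution by `k` variables. -/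
def shift (k : ℕ) (n : ℕ) : Exp := var (n + k)

/-- Lifting of a substitution under one binder. -/
def up (σ : ℕ → Exp) : ℕ → Exp := scons (var 0) (fun n => (σ n).wk 1)

/-- Simultaneous capture-avoiding substitution. -/
def subst (σ : ℕ → Exp) : Exp → Exp
  | var n => σ n
  | empty => empty
  | unit => unit
  | sum A B => sum (A.subst σ) (B.subst σ)
  | list A => list (A.subst σ)
  | sig A B => sig (A.subst σ) (B.subst (up σ))
  | pi A B => pi (A.subst σ) (B.subst (up σ))
  | univ => univ
  | dec c => dec (c.subst σ)
  | bot => bot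
  | or φ ψ => or (φ.subst σ) (ψ.subst σ)
  | and φ ψ => and (φ.subst σ) (ψ.subst σ)
  | imp φ ψ => imp (φ.subst σ) (ψ.subst σ)
  | all A φ => all (A.subst σ) (φ.subst (up σ))
  | ex A φ => ex (A.subst σ) (φ.subst (up σ))
  | ident A a b => ident (A.subst σ) (a.subst σ) (b.subst σ)
  | code φ => code (φ.subst σ)
  | elEmpty C a => elEmpty (C.subst (up σ)) (a.subst σ)
  | star => star
  | elUnit C t c => elUnit (C.subst (up σ)) (t.subst σ) (c.subst σ)
  | pair A B a b => pair (A.subst σ) (B.subst (up σ)) (a.subst σ) (b.subst σ)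
  | elSig A B C d m =>
      elSig (A.subst σ) (B.subst (up σ)) (C.subst (up σ)) (d.subst σ) (m.subst (up (up σ)))
  | nil A => nil (A.subst σ)
  | cons A s c => cons (A.subst σ) (s.subst σ) (c.subst σ)
  | elList A C s a l =>
      elList (A.subst σ) (C.subst (up σ)) (s.subst σ) (a.subst σ) (l.subst (up (up (up σ))))
  | inl A B a => inl (A.subst σ) (B.subst σ) (a.subst σ)
  | inr A B b => inr (A.subst σ) (B.subst σ) (b.subst σ)
  | elSum A B C w l r =>
      elSum (A.subst σ) (B.subst σ) (C.subst (up σ)) (w.subst σ) (l.subst (up σ))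
        (r.subst (up σ))
  | lam A B b => lam (A.subst σ) (B.subst (up σ)) (b.subst (up σ))
  | app A B g a => app (A.subst σ) (B.subst (up σ)) (g.subst σ) (a.subst σ)
  | elBot ξ a => elBot (ξ.subst σ) (a.subst σ)
  | orInl φ ψ a => orInl (φ.subst σ) (ψ.subst σ) (a.subst σ)
  | orInr φ ψ b => orInr (φ.subst σ) (ψ.subst σ) (b.subst σ)
  | elOr φ ψ ξ w l r =>
      elOr (φ.subst σ) (ψ.subst σ) (ξ.subst σ) (w.subst σ) (l.subst (up σ)) (r.subst (up σ))
  | andI φ ψ a b => andI (φ.subst σ) (ψ.subst σ) (a.subst σ) (b.subst σ)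
  | andL φ ψ p => andL (φ.subst σ) (ψ.subst σ) (p.subst σ)
  | andR φ ψ p => andR (φ.subst σ) (ψ.subst σ) (p.subst σ)
  | impI φ ψ b => impI (φ.subst σ) (ψ.subst σ) (b.subst (up σ))
  | impE φ ψ g a => impE (φ.subst σ) (ψ.subst σ) (g.subst σ) (a.subst σ)
  | allI A φ b => allI (A.subst σ) (φ.subst (up σ)) (b.subst (up σ))
  | allE A φ g a => allE (A.subst σ) (φ.subst (up σ)) (g.subst σ) (a.subst σ)
  | exI A φ a b => exI (A.subst σ) (φ.subst (up σ)) (a.subst σ) (b.subst σ)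
  | elEx A φ ξ d m =>
      elEx (A.subst σ) (φ.subst (up σ)) (ξ.subst σ) (d.subst σ) (m.subst (up (up σ)))
  | refl A a => refl (A.subst σ) (a.subst σ)
  | elIdent A ξ a b p c =>
      elIdent (A.subst σ) (ξ.subst (up (up σ))) (a.subst σ) (b.subst σ) (p.subst σ)
        (c.subst (up σ))

/-- Substitution of `a` for the last variable. -/
def inst (e a : Exp) : Exp := e.subst (scons a var)

/-- Substitution of `a` for the last but one variable and of `b` for the last one. -/
def inst₂ (e a b : Exp) : Exp := e.subst (scons b (scons a var))

/-- `C(t)` where `C` depends on one variable over `Γ` and `t` lives in an extension of `Γ` by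
`k` variables. -/
def instWk (k : ℕ) (C t : Exp) : Exp := C.subst (scons t (shift k))

end Exp

/-- Pre-contexts; the head of the list is the type of the last declared variable. -/
abbrev Ctx : Type := List Exp

inductive Size : Type
  | small
  | large

/-- The four kinds of types: (small) propositions, and sets and collections. -/
inductive Kind : Type
  | logic (s : Size)
  | data (s : Size)

namespace Kind

abbrev props : Kind := logic Size.small
abbrev prop : Kind := logic Size.large
abbrev set : Kind := data Size.small
abbrev col : Kind := data Size.large

end Kind

/-- The forms of judgement, without their context. -/
inductive Jdg : Type
  -- the context is well formed
  | ctx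
  -- `A kind`
  | ty (k : Kind) (A : Exp)
  -- `A = B kind`
  | tyEq (k : Kind) (A B : Exp)
  -- `a ∈ A`
  | tm (a A : Exp)
  -- `a = b ∈ A`
  | tmEq (a b A : Exp)

/-- Substitution in a judgement. -/
def Jdg.subst (σ : ℕ → Exp) : Jdg → Jdg
  | ctx => ctx
  | ty k A => ty k (A.subst σ)
  | tyEq k A B => tyEq k (A.subst σ) (B.subst σ)
  | tm a A => tm (a.subst σ) (A.subst σ)
  | tmEq a b A => tmEq (a.subst σ) (b.subst σ) (A.subst σ)

open Exp in
/-- `Der Γ J`: the impredicative theory derives the judgement `J [Γ]`. The rules are those of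
the predicative theory, followed by the congruence rules and by the resizing rules. -/
inductive Der : Ctx → Jdg → Prop
  -- contexts and variables
  | ctxNil : Der [] .ctx
  | ctxCons {Γ A} : Der Γ (.ty .col A) → Der (A :: Γ) .ctx
  | var {Γ A} {n : ℕ} : Der Γ .ctx → Γ[n]? = some A → Der Γ (.tm (var n) (A.wk (n + 1)))
  -- substitution along a telescopic substitution `σ ∈ Γ [Δ]`, which includes weakening; the
  -- values of `σ` at indices that are not declared in `Γ` are immaterial
  | sub {Γ Δ J} {σ : ℕ → Exp} : Der Γ J → Der Δ .ctx →
      (∀ n A, Γ[n]? = some A → Der Δ (.tm (σ n) ((A.wk (n + 1)).subst σ))) →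
      (∀ n, Γ.length ≤ n → ∃ m, σ n = Exp.var m) →
      Der Δ (J.subst σ)
  -- replacement along two equal telescopic substitutions `σ = τ ∈ Γ [Δ]`
  | subTy {Γ Δ k A} {σ τ : ℕ → Exp} : Der Γ (.ty k A) → Der Δ .ctx →
      (∀ n B, Γ[n]? = some B → Der Δ (.tm (σ n) ((B.wk (n + 1)).subst σ))) →
      (∀ n B, Γ[n]? = some B → Der Δ (.tm (τ n) ((B.wk (n + 1)).subst τ))) →
      (∀ n B, Γ[n]? = some B → Der Δ (.tmEq (σ n) (τ n) ((B.wk (n + 1)).subst σ))) →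
      (∀ n, Γ.length ≤ n → ∃ m, σ n = Exp.var m ∧ τ n = Exp.var m) →
      Der Δ (.tyEq k (A.subst σ) (A.subst τ))
  | subTm {Γ Δ a A} {σ τ : ℕ → Exp} : Der Γ (.tm a A) → Der Δ .ctx →
      (∀ n B, Γ[n]? = some B → Der Δ (.tm (σ n) ((B.wk (n + 1)).subst σ))) →
      (∀ n B, Γ[n]? = some B → Der Δ (.tm (τ n) ((B.wk (n + 1)).subst τ))) →
      (∀ n B, Γ[n]? = some B → Der Δ (.tmEq (σ n) (τ n) ((B.wk (n + 1)).subst σ))) →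
      (∀ n, Γ.length ≤ n → ∃ m, σ n = Exp.var m ∧ τ n = Exp.var m) →
      Der Δ (.tmEq (a.subst σ) (a.subst τ) (A.subst σ))
  -- equality
  | tyRefl {Γ k A} : Der Γ (.ty k A) → Der Γ (.tyEq k A A)
  | tySymm {Γ k A B} : Der Γ (.tyEq k A B) → Der Γ (.tyEq k B A)
  | tyTrans {Γ k A B C} : Der Γ (.tyEq k A B) → Der Γ (.tyEq k B C) → Der Γ (.tyEq k A C)
  | tmRefl {Γ a A} : Der Γ (.tm a A) → Der Γ (.tmEq a a A)
  | tmSymm {Γ a b A} : Der Γ (.tmEq a b A) → Der Γ (.tmEq b a A)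
  | tmTrans {Γ a b c A} : Der Γ (.tmEq a b A) → Der Γ (.tmEq b c A) → Der Γ (.tmEq a c A)
  | conv {Γ a A B} : Der Γ (.tm a A) → Der Γ (.tyEq .col A B) → Der Γ (.tm a B)
  | convEq {Γ a b A B} : Der Γ (.tmEq a b A) → Der Γ (.tyEq .col A B) → Der Γ (.tmEq a b B)
  -- inclusions between the kinds
  | smallTy {Γ φ} : Der Γ (.ty .props φ) → Der Γ (.ty .set φ)
  | smallTyEq {Γ φ ψ} : Der Γ (.tyEq .props φ ψ) → Der Γ (.tyEq .set φ ψ)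
  | largeTy {Γ φ} : Der Γ (.ty .prop φ) → Der Γ (.ty .col φ)
  | largeTyEq {Γ φ ψ} : Der Γ (.tyEq .prop φ ψ) → Der Γ (.tyEq .col φ ψ)
  | propsProp {Γ φ} : Der Γ (.ty .props φ) → Der Γ (.ty .prop φ)
  | propsPropEq {Γ φ ψ} : Der Γ (.tyEq .props φ ψ) → Der Γ (.tyEq .prop φ ψ)
  | setCol {Γ A} : Der Γ (.ty .set A) → Der Γ (.ty .col A)
  | setColEq {Γ A B} : Der Γ (.tyEq .set A B) → Der Γ (.tyEq .col A B)
  -- the empty set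
  | emptyF {Γ} : Der Γ .ctx → Der Γ (.ty .set empty)
  | emptyE {Γ C a} : Der (empty :: Γ) (.ty .col C) → Der Γ (.tm a empty) →
      Der Γ (.tm (elEmpty C a) (C.inst a))
  -- the singleton set
  | unitF {Γ} : Der Γ .ctx → Der Γ (.ty .set unit)
  | unitI {Γ} : Der Γ .ctx → Der Γ (.tm star unit)
  | unitE {Γ C t c} : Der (unit :: Γ) (.ty .col C) → Der Γ (.tm t unit) →
      Der Γ (.tm c (C.inst star)) → Der Γ (.tm (elUnit C t c) (C.inst t))
  | unitC {Γ C c} : Der (unit :: Γ) (.ty .col C) → Der Γ (.tm c (C.inst star)) →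
      Der Γ (.tmEq (elUnit C star c) c (C.inst star))
  -- dependent sums of sets and of collections
  | sigF {Γ A B} (s : Size) : Der Γ (.ty (.data s) A) → Der (A :: Γ) (.ty (.data s) B) →
      Der Γ (.ty (.data s) (sig A B))
  | sigI {Γ A B a b} : Der Γ (.ty .col A) → Der (A :: Γ) (.ty .col B) → Der Γ (.tm a A) →
      Der Γ (.tm b (B.inst a)) → Der Γ (.tm (pair A B a b) (sig A B))
  | sigE {Γ A B C d m} : Der Γ (.ty .col A) → Der (A :: Γ) (.ty .col B) →
      Der (sig A B :: Γ) (.ty .col C) → Der Γ (.tm d (sig A B)) →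
      Der (B :: A :: Γ)
        (.tm m (C.instWk 2 (pair (A.wk 2) (B.wkUnder 2) (Exp.var 1) (Exp.var 0)))) →
      Der Γ (.tm (elSig A B C d m) (C.inst d))
  | sigC {Γ A B C a b m} : Der Γ (.ty .col A) → Der (A :: Γ) (.ty .col B) →
      Der (sig A B :: Γ) (.ty .col C) → Der Γ (.tm a A) → Der Γ (.tm b (B.inst a)) →
      Der (B :: A :: Γ)
        (.tm m (C.instWk 2 (pair (A.wk 2) (B.wkUnder 2) (Exp.var 1) (Exp.var 0)))) →
      Der Γ (.tmEq (elSig A B C (pair A B a b) m) (m.inst₂ a b) (C.inst (pair A B a b)))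
  -- lists
  | listF {Γ A} : Der Γ (.ty .set A) → Der Γ (.ty .set (list A))
  | listNil {Γ A} : Der Γ (.ty .set A) → Der Γ (.tm (nil A) (list A))
  | listCons {Γ A s c} : Der Γ (.ty .set A) → Der Γ (.tm s (list A)) → Der Γ (.tm c A) →
      Der Γ (.tm (cons A s c) (list A))
  | listE {Γ A C s a l} : Der Γ (.ty .set A) → Der (list A :: Γ) (.ty .col C) →
      Der Γ (.tm s (list A)) → Der Γ (.tm a (C.inst (nil A))) →
      Der (C.instWk 2 (Exp.var 1) :: A.wk 1 :: list A :: Γ)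
        (.tm l (C.instWk 3 (cons (A.wk 3) (Exp.var 2) (Exp.var 1)))) →
      Der Γ (.tm (elList A C s a l) (C.inst s))
  | listCNil {Γ A C a l} : Der Γ (.ty .set A) → Der (list A :: Γ) (.ty .col C) →
      Der Γ (.tm a (C.inst (nil A))) →
      Der (C.instWk 2 (Exp.var 1) :: A.wk 1 :: list A :: Γ)
        (.tm l (C.instWk 3 (cons (A.wk 3) (Exp.var 2) (Exp.var 1)))) →
      Der Γ (.tmEq (elList A C (nil A) a l) a (C.inst (nil A)))
  | listCCons {Γ A C s c a l} : Der Γ (.ty .set A) → Der (list A :: Γ) (.ty .col C) →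
      Der Γ (.tm s (list A)) → Der Γ (.tm c A) → Der Γ (.tm a (C.inst (nil A))) →
      Der (C.instWk 2 (Exp.var 1) :: A.wk 1 :: list A :: Γ)
        (.tm l (C.instWk 3 (cons (A.wk 3) (Exp.var 2) (Exp.var 1)))) →
      Der Γ (.tmEq (elList A C (cons A s c) a l)
        (l.subst (scons (elList A C s a l) (scons c (scons s Exp.var))))
        (C.inst (cons A s c)))
  -- disjoint sums
  | sumF {Γ A B} : Der Γ (.ty .set A) → Der Γ (.ty .set B) → Der Γ (.ty .set (sum A B))
  | sumInl {Γ A B a} : Der Γ (.ty .set A) → Der Γ (.ty .set B) → Der Γ (.tm a A) →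
      Der Γ (.tm (inl A B a) (sum A B))
  | sumInr {Γ A B b} : Der Γ (.ty .set A) → Der Γ (.ty .set B) → Der Γ (.tm b B) →
      Der Γ (.tm (inr A B b) (sum A B))
  | sumE {Γ A B C w l r} : Der Γ (.ty .set A) → Der Γ (.ty .set B) →
      Der (sum A B :: Γ) (.ty .col C) → Der Γ (.tm w (sum A B)) →
      Der (A :: Γ) (.tm l (C.instWk 1 (inl (A.wk 1) (B.wk 1) (Exp.var 0)))) →
      Der (B :: Γ) (.tm r (C.instWk 1 (inr (A.wk 1) (B.wk 1) (Exp.var 0)))) →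
      Der Γ (.tm (elSum A B C w l r) (C.inst w))
  | sumCInl {Γ A B C a l r} : Der Γ (.ty .set A) → Der Γ (.ty .set B) →
      Der (sum A B :: Γ) (.ty .col C) → Der Γ (.tm a A) →
      Der (A :: Γ) (.tm l (C.instWk 1 (inl (A.wk 1) (B.wk 1) (Exp.var 0)))) →
      Der (B :: Γ) (.tm r (C.instWk 1 (inr (A.wk 1) (B.wk 1) (Exp.var 0)))) →
      Der Γ (.tmEq (elSum A B C (inl A B a) l r) (l.inst a) (C.inst (inl A B a)))
  | sumCInr {Γ A B C b l r} : Der Γ (.ty .set A) → Der Γ (.ty .set B) →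
      Der (sum A B :: Γ) (.ty .col C) → Der Γ (.tm b B) →
      Der (A :: Γ) (.tm l (C.instWk 1 (inl (A.wk 1) (B.wk 1) (Exp.var 0)))) →
      Der (B :: Γ) (.tm r (C.instWk 1 (inr (A.wk 1) (B.wk 1) (Exp.var 0)))) →
      Der Γ (.tmEq (elSum A B C (inr A B b) l r) (r.inst b) (C.inst (inr A B b)))
  -- the universe of small propositions
  | univF {Γ} : Der Γ .ctx → Der Γ (.ty .col univ)
  | univI {Γ φ} : Der Γ (.ty .props φ) → Der Γ (.tm (code φ) univ)
  | univE {Γ c} : Der Γ (.tm c univ) → Der Γ (.ty .props (dec c))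
  | univC {Γ φ} : Der Γ (.ty .props φ) → Der Γ (.tyEq .props (dec (code φ)) φ)
  | univEta {Γ c} : Der Γ (.tm c univ) → Der Γ (.tmEq (code (dec c)) c univ)
  | univIEq {Γ φ ψ} : Der Γ (.tyEq .props φ ψ) → Der Γ (.tmEq (code φ) (code ψ) univ)
  | univEEq {Γ c d} : Der Γ (.tmEq c d univ) → Der Γ (.tyEq .props (dec c) (dec d))
  -- dependent products of sets, and function spaces from a set to the universe
  | piF {Γ A B} : Der Γ (.ty .set A) → Der (A :: Γ) (.ty .set B) → Der Γ (.ty .set (pi A B))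
  | piFUniv {Γ A} : Der Γ (.ty .set A) → Der Γ (.ty .col (pi A univ))
  | piI {Γ A B b} : Der Γ (.ty .col A) → Der (A :: Γ) (.ty .col B) →
      Der Γ (.ty .col (pi A B)) → Der (A :: Γ) (.tm b B) → Der Γ (.tm (lam A B b) (pi A B))
  | piE {Γ A B f a} : Der Γ (.ty .col A) → Der (A :: Γ) (.ty .col B) →
      Der Γ (.tm f (pi A B)) → Der Γ (.tm a A) → Der Γ (.tm (app A B f a) (B.inst a))
  | piC {Γ A B b a} : Der Γ (.ty .col A) → Der (A :: Γ) (.ty .col B) →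
      Der Γ (.ty .col (pi A B)) → Der (A :: Γ) (.tm b B) → Der Γ (.tm a A) →
      Der Γ (.tmEq (app A B (lam A B b) a) (b.inst a) (B.inst a))
  -- falsum
  | botF {Γ} : Der Γ .ctx → Der Γ (.ty .props bot)
  | botE {Γ ξ a} : Der Γ (.ty .prop ξ) → Der Γ (.tm a bot) → Der Γ (.tm (elBot ξ a) ξ)
  -- disjunction
  | orF {Γ φ ψ} (s : Size) : Der Γ (.ty (.logic s) φ) → Der Γ (.ty (.logic s) ψ) →
      Der Γ (.ty (.logic s) (or φ ψ))
  | orIL {Γ φ ψ a} : Der Γ (.ty .prop φ) → Der Γ (.ty .prop ψ) → Der Γ (.tm a φ) →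
      Der Γ (.tm (orInl φ ψ a) (or φ ψ))
  | orIR {Γ φ ψ b} : Der Γ (.ty .prop φ) → Der Γ (.ty .prop ψ) → Der Γ (.tm b ψ) →
      Der Γ (.tm (orInr φ ψ b) (or φ ψ))
  | orE {Γ φ ψ ξ w l r} : Der Γ (.ty .prop φ) → Der Γ (.ty .prop ψ) → Der Γ (.ty .prop ξ) →
      Der Γ (.tm w (or φ ψ)) → Der (φ :: Γ) (.tm l (ξ.wk 1)) →
      Der (ψ :: Γ) (.tm r (ξ.wk 1)) → Der Γ (.tm (elOr φ ψ ξ w l r) ξ)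
  | orCL {Γ φ ψ ξ a l r} : Der Γ (.ty .prop φ) → Der Γ (.ty .prop ψ) → Der Γ (.ty .prop ξ) →
      Der Γ (.tm a φ) → Der (φ :: Γ) (.tm l (ξ.wk 1)) → Der (ψ :: Γ) (.tm r (ξ.wk 1)) →
      Der Γ (.tmEq (elOr φ ψ ξ (orInl φ ψ a) l r) (l.inst a) ξ)
  | orCR {Γ φ ψ ξ b l r} : Der Γ (.ty .prop φ) → Der Γ (.ty .prop ψ) → Der Γ (.ty .prop ξ) →
      Der Γ (.tm b ψ) → Der (φ :: Γ) (.tm l (ξ.wk 1)) → Der (ψ :: Γ) (.tm r (ξ.wk 1)) →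
      Der Γ (.tmEq (elOr φ ψ ξ (orInr φ ψ b) l r) (r.inst b) ξ)
  -- conjunction
  | andF {Γ φ ψ} (s : Size) : Der Γ (.ty (.logic s) φ) → Der Γ (.ty (.logic s) ψ) →
      Der Γ (.ty (.logic s) (and φ ψ))
  | andIn {Γ φ ψ a b} : Der Γ (.ty .prop φ) → Der Γ (.ty .prop ψ) → Der Γ (.tm a φ) →
      Der Γ (.tm b ψ) → Der Γ (.tm (andI φ ψ a b) (and φ ψ))
  | andEL {Γ φ ψ p} : Der Γ (.ty .prop φ) → Der Γ (.ty .prop ψ) → Der Γ (.tm p (and φ ψ)) →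
      Der Γ (.tm (andL φ ψ p) φ)
  | andER {Γ φ ψ p} : Der Γ (.ty .prop φ) → Der Γ (.ty .prop ψ) → Der Γ (.tm p (and φ ψ)) →
      Der Γ (.tm (andR φ ψ p) ψ)
  | andCL {Γ φ ψ a b} : Der Γ (.ty .prop φ) → Der Γ (.ty .prop ψ) → Der Γ (.tm a φ) →
      Der Γ (.tm b ψ) → Der Γ (.tmEq (andL φ ψ (andI φ ψ a b)) a φ)
  | andCR {Γ φ ψ a b} : Der Γ (.ty .prop φ) → Der Γ (.ty .prop ψ) → Der Γ (.tm a φ) →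
      Der Γ (.tm b ψ) → Der Γ (.tmEq (andR φ ψ (andI φ ψ a b)) b ψ)
  -- implication
  | impF {Γ φ ψ} (s : Size) : Der Γ (.ty (.logic s) φ) → Der Γ (.ty (.logic s) ψ) →
      Der Γ (.ty (.logic s) (imp φ ψ))
  | impIn {Γ φ ψ b} : Der Γ (.ty .prop φ) → Der Γ (.ty .prop ψ) →
      Der (φ :: Γ) (.tm b (ψ.wk 1)) → Der Γ (.tm (impI φ ψ b) (imp φ ψ))
  | impEl {Γ φ ψ f a} : Der Γ (.ty .prop φ) → Der Γ (.ty .prop ψ) →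
      Der Γ (.tm f (imp φ ψ)) → Der Γ (.tm a φ) → Der Γ (.tm (impE φ ψ f a) ψ)
  | impC {Γ φ ψ b a} : Der Γ (.ty .prop φ) → Der Γ (.ty .prop ψ) →
      Der (φ :: Γ) (.tm b (ψ.wk 1)) → Der Γ (.tm a φ) →
      Der Γ (.tmEq (impE φ ψ (impI φ ψ b) a) (b.inst a) ψ)
  -- universal quantification; small over sets only
  | allF {Γ A φ} (s : Size) : Der Γ (.ty (.data s) A) → Der (A :: Γ) (.ty (.logic s) φ) →
      Der Γ (.ty (.logic s) (all A φ))
  | allIn {Γ A φ b} : Der Γ (.ty .col A) → Der (A :: Γ) (.ty .prop φ) →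
      Der (A :: Γ) (.tm b φ) → Der Γ (.tm (allI A φ b) (all A φ))
  | allEl {Γ A φ f a} : Der Γ (.ty .col A) → Der (A :: Γ) (.ty .prop φ) →
      Der Γ (.tm f (all A φ)) → Der Γ (.tm a A) → Der Γ (.tm (allE A φ f a) (φ.inst a))
  | allC {Γ A φ b a} : Der Γ (.ty .col A) → Der (A :: Γ) (.ty .prop φ) →
      Der (A :: Γ) (.tm b φ) → Der Γ (.tm a A) →
      Der Γ (.tmEq (allE A φ (allI A φ b) a) (b.inst a) (φ.inst a))
  -- existential quantification; small over sets only, eliminated towards propositions only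
  | exF {Γ A φ} (s : Size) : Der Γ (.ty (.data s) A) → Der (A :: Γ) (.ty (.logic s) φ) →
      Der Γ (.ty (.logic s) (ex A φ))
  | exIn {Γ A φ a b} : Der Γ (.ty .col A) → Der (A :: Γ) (.ty .prop φ) → Der Γ (.tm a A) →
      Der Γ (.tm b (φ.inst a)) → Der Γ (.tm (exI A φ a b) (ex A φ))
  | exE {Γ A φ ξ d m} : Der Γ (.ty .col A) → Der (A :: Γ) (.ty .prop φ) →
      Der Γ (.ty .prop ξ) → Der Γ (.tm d (ex A φ)) → Der (φ :: A :: Γ) (.tm m (ξ.wk 2)) →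
      Der Γ (.tm (elEx A φ ξ d m) ξ)
  | exC {Γ A φ ξ a b m} : Der Γ (.ty .col A) → Der (A :: Γ) (.ty .prop φ) →
      Der Γ (.ty .prop ξ) → Der Γ (.tm a A) → Der Γ (.tm b (φ.inst a)) →
      Der (φ :: A :: Γ) (.tm m (ξ.wk 2)) →
      Der Γ (.tmEq (elEx A φ ξ (exI A φ a b) m) (m.inst₂ a b) ξ)
  -- propositional equality; small over sets only, eliminated towards propositions only
  | identF {Γ A a b} (s : Size) : Der Γ (.ty (.data s) A) → Der Γ (.tm a A) →
      Der Γ (.tm b A) → Der Γ (.ty (.logic s) (ident A a b))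
  | identI {Γ A a} : Der Γ (.ty .col A) → Der Γ (.tm a A) →
      Der Γ (.tm (refl A a) (ident A a a))
  | identE {Γ A ξ a b p c} : Der Γ (.ty .col A) → Der (A.wk 1 :: A :: Γ) (.ty .prop ξ) →
      Der Γ (.tm a A) → Der Γ (.tm b A) → Der Γ (.tm p (ident A a b)) →
      Der (A :: Γ) (.tm c (ξ.inst (Exp.var 0))) →
      Der Γ (.tm (elIdent A ξ a b p c) (ξ.inst₂ a b))
  | identC {Γ A ξ a c} : Der Γ (.ty .col A) → Der (A.wk 1 :: A :: Γ) (.ty .prop ξ) →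
      Der Γ (.tm a A) → Der (A :: Γ) (.tm c (ξ.inst (Exp.var 0))) →
      Der Γ (.tmEq (elIdent A ξ a a (refl A a) c) (c.inst a) (ξ.inst₂ a a))
  -- congruence rules for types
  | sigCong {Γ A A₁ B B₁} (s : Size) : Der Γ (.ty (.data s) A) →
      Der Γ (.tyEq (.data s) A A₁) → Der (A :: Γ) (.tyEq (.data s) B B₁) →
      Der Γ (.tyEq (.data s) (sig A B) (sig A₁ B₁))
  | listCong {Γ A A₁} : Der Γ (.tyEq .set A A₁) → Der Γ (.tyEq .set (list A) (list A₁))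
  | sumCong {Γ A A₁ B B₁} : Der Γ (.tyEq .set A A₁) → Der Γ (.tyEq .set B B₁) →
      Der Γ (.tyEq .set (sum A B) (sum A₁ B₁))
  | piCong {Γ A A₁ B B₁} : Der Γ (.ty .set A) → Der Γ (.tyEq .set A A₁) →
      Der (A :: Γ) (.tyEq .set B B₁) → Der Γ (.tyEq .set (pi A B) (pi A₁ B₁))
  | piUnivCong {Γ A A₁} : Der Γ (.tyEq .set A A₁) →
      Der Γ (.tyEq .col (pi A univ) (pi A₁ univ))
  | orCong {Γ φ φ₁ ψ ψ₁} (s : Size) : Der Γ (.tyEq (.logic s) φ φ₁) →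
      Der Γ (.tyEq (.logic s) ψ ψ₁) → Der Γ (.tyEq (.logic s) (or φ ψ) (or φ₁ ψ₁))
  | andCong {Γ φ φ₁ ψ ψ₁} (s : Size) : Der Γ (.tyEq (.logic s) φ φ₁) →
      Der Γ (.tyEq (.logic s) ψ ψ₁) → Der Γ (.tyEq (.logic s) (and φ ψ) (and φ₁ ψ₁))
  | impCong {Γ φ φ₁ ψ ψ₁} (s : Size) : Der Γ (.tyEq (.logic s) φ φ₁) →
      Der Γ (.tyEq (.logic s) ψ ψ₁) → Der Γ (.tyEq (.logic s) (imp φ ψ) (imp φ₁ ψ₁))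
  | allCong {Γ A A₁ φ φ₁} (s : Size) : Der Γ (.ty (.data s) A) →
      Der Γ (.tyEq (.data s) A A₁) → Der (A :: Γ) (.tyEq (.logic s) φ φ₁) →
      Der Γ (.tyEq (.logic s) (all A φ) (all A₁ φ₁))
  | exCong {Γ A A₁ φ φ₁} (s : Size) : Der Γ (.ty (.data s) A) →
      Der Γ (.tyEq (.data s) A A₁) → Der (A :: Γ) (.tyEq (.logic s) φ φ₁) →
      Der Γ (.tyEq (.logic s) (ex A φ) (ex A₁ φ₁))
  | identCong {Γ A A₁ a a₁ b b₁} (s : Size) : Der Γ (.tyEq (.data s) A A₁) →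
      Der Γ (.tmEq a a₁ A) → Der Γ (.tmEq b b₁ A) →
      Der Γ (.tyEq (.logic s) (ident A a b) (ident A₁ a₁ b₁))
  -- congruence rules for terms
  | elEmptyCong {Γ C C₁ a a₁} : Der (empty :: Γ) (.tyEq .col C C₁) →
      Der Γ (.tmEq a a₁ empty) → Der Γ (.tmEq (elEmpty C a) (elEmpty C₁ a₁) (C.inst a))
  | elUnitCong {Γ C C₁ t t₁ c c₁} : Der (unit :: Γ) (.tyEq .col C C₁) →
      Der Γ (.tmEq t t₁ unit) → Der Γ (.tmEq c c₁ (C.inst star)) →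
      Der Γ (.tmEq (elUnit C t c) (elUnit C₁ t₁ c₁) (C.inst t))
  | pairCong {Γ A A₁ B B₁ a a₁ b b₁} : Der Γ (.ty .col A) → Der Γ (.tyEq .col A A₁) →
      Der (A :: Γ) (.tyEq .col B B₁) → Der Γ (.tmEq a a₁ A) → Der Γ (.tmEq b b₁ (B.inst a)) →
      Der Γ (.tmEq (pair A B a b) (pair A₁ B₁ a₁ b₁) (sig A B))
  | elSigCong {Γ A A₁ B B₁ C C₁ d d₁ m m₁} : Der Γ (.ty .col A) → Der (A :: Γ) (.ty .col B) →
      Der Γ (.tyEq .col A A₁) → Der (A :: Γ) (.tyEq .col B B₁) →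
      Der (sig A B :: Γ) (.tyEq .col C C₁) → Der Γ (.tmEq d d₁ (sig A B)) →
      Der (B :: A :: Γ)
        (.tmEq m m₁ (C.instWk 2 (pair (A.wk 2) (B.wkUnder 2) (Exp.var 1) (Exp.var 0)))) →
      Der Γ (.tmEq (elSig A B C d m) (elSig A₁ B₁ C₁ d₁ m₁) (C.inst d))
  | nilCong {Γ A A₁} : Der Γ (.tyEq .set A A₁) → Der Γ (.tmEq (nil A) (nil A₁) (list A))
  | consCong {Γ A A₁ s s₁ c c₁} : Der Γ (.tyEq .set A A₁) → Der Γ (.tmEq s s₁ (list A)) →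
      Der Γ (.tmEq c c₁ A) → Der Γ (.tmEq (cons A s c) (cons A₁ s₁ c₁) (list A))
  | elListCong {Γ A A₁ C C₁ s s₁ a a₁ l l₁} : Der Γ (.ty .set A) →
      Der (list A :: Γ) (.ty .col C) → Der Γ (.tyEq .set A A₁) →
      Der (list A :: Γ) (.tyEq .col C C₁) → Der Γ (.tmEq s s₁ (list A)) →
      Der Γ (.tmEq a a₁ (C.inst (nil A))) →
      Der (C.instWk 2 (Exp.var 1) :: A.wk 1 :: list A :: Γ)
        (.tmEq l l₁ (C.instWk 3 (cons (A.wk 3) (Exp.var 2) (Exp.var 1)))) →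
      Der Γ (.tmEq (elList A C s a l) (elList A₁ C₁ s₁ a₁ l₁) (C.inst s))
  | inlCong {Γ A A₁ B B₁ a a₁} : Der Γ (.tyEq .set A A₁) → Der Γ (.tyEq .set B B₁) →
      Der Γ (.tmEq a a₁ A) → Der Γ (.tmEq (inl A B a) (inl A₁ B₁ a₁) (sum A B))
  | inrCong {Γ A A₁ B B₁ b b₁} : Der Γ (.tyEq .set A A₁) → Der Γ (.tyEq .set B B₁) →
      Der Γ (.tmEq b b₁ B) → Der Γ (.tmEq (inr A B b) (inr A₁ B₁ b₁) (sum A B))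
  | elSumCong {Γ A A₁ B B₁ C C₁ w w₁ l l₁ r r₁} : Der Γ (.ty .set A) → Der Γ (.ty .set B) →
      Der Γ (.tyEq .set A A₁) → Der Γ (.tyEq .set B B₁) →
      Der (sum A B :: Γ) (.tyEq .col C C₁) → Der Γ (.tmEq w w₁ (sum A B)) →
      Der (A :: Γ) (.tmEq l l₁ (C.instWk 1 (inl (A.wk 1) (B.wk 1) (Exp.var 0)))) →
      Der (B :: Γ) (.tmEq r r₁ (C.instWk 1 (inr (A.wk 1) (B.wk 1) (Exp.var 0)))) →
      Der Γ (.tmEq (elSum A B C w l r) (elSum A₁ B₁ C₁ w₁ l₁ r₁) (C.inst w))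
  | lamCong {Γ A A₁ B B₁ b b₁} : Der Γ (.ty .col A) → Der Γ (.ty .col (pi A B)) →
      Der Γ (.tyEq .col A A₁) → Der (A :: Γ) (.tyEq .col B B₁) → Der (A :: Γ) (.tmEq b b₁ B) →
      Der Γ (.tmEq (lam A B b) (lam A₁ B₁ b₁) (pi A B))
  | appCong {Γ A A₁ B B₁ f f₁ a a₁} : Der Γ (.ty .col A) → Der Γ (.tyEq .col A A₁) →
      Der (A :: Γ) (.tyEq .col B B₁) → Der Γ (.tmEq f f₁ (pi A B)) → Der Γ (.tmEq a a₁ A) →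
      Der Γ (.tmEq (app A B f a) (app A₁ B₁ f₁ a₁) (B.inst a))
  | elBotCong {Γ ξ ξ₁ a a₁} : Der Γ (.tyEq .prop ξ ξ₁) → Der Γ (.tmEq a a₁ bot) →
      Der Γ (.tmEq (elBot ξ a) (elBot ξ₁ a₁) ξ)
  | orInlCong {Γ φ φ₁ ψ ψ₁ a a₁} : Der Γ (.tyEq .prop φ φ₁) → Der Γ (.tyEq .prop ψ ψ₁) →
      Der Γ (.tmEq a a₁ φ) → Der Γ (.tmEq (orInl φ ψ a) (orInl φ₁ ψ₁ a₁) (or φ ψ))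
  | orInrCong {Γ φ φ₁ ψ ψ₁ b b₁} : Der Γ (.tyEq .prop φ φ₁) → Der Γ (.tyEq .prop ψ ψ₁) →
      Der Γ (.tmEq b b₁ ψ) → Der Γ (.tmEq (orInr φ ψ b) (orInr φ₁ ψ₁ b₁) (or φ ψ))
  | elOrCong {Γ φ φ₁ ψ ψ₁ ξ ξ₁ w w₁ l l₁ r r₁} : Der Γ (.ty .prop φ) → Der Γ (.ty .prop ψ) →
      Der Γ (.tyEq .prop φ φ₁) → Der Γ (.tyEq .prop ψ ψ₁) → Der Γ (.tyEq .prop ξ ξ₁) →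
      Der Γ (.tmEq w w₁ (or φ ψ)) → Der (φ :: Γ) (.tmEq l l₁ (ξ.wk 1)) →
      Der (ψ :: Γ) (.tmEq r r₁ (ξ.wk 1)) →
      Der Γ (.tmEq (elOr φ ψ ξ w l r) (elOr φ₁ ψ₁ ξ₁ w₁ l₁ r₁) ξ)
  | andICong {Γ φ φ₁ ψ ψ₁ a a₁ b b₁} : Der Γ (.tyEq .prop φ φ₁) → Der Γ (.tyEq .prop ψ ψ₁) →
      Der Γ (.tmEq a a₁ φ) → Der Γ (.tmEq b b₁ ψ) →
      Der Γ (.tmEq (andI φ ψ a b) (andI φ₁ ψ₁ a₁ b₁) (and φ ψ))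
  | andLCong {Γ φ φ₁ ψ ψ₁ p p₁} : Der Γ (.tyEq .prop φ φ₁) → Der Γ (.tyEq .prop ψ ψ₁) →
      Der Γ (.tmEq p p₁ (and φ ψ)) → Der Γ (.tmEq (andL φ ψ p) (andL φ₁ ψ₁ p₁) φ)
  | andRCong {Γ φ φ₁ ψ ψ₁ p p₁} : Der Γ (.tyEq .prop φ φ₁) → Der Γ (.tyEq .prop ψ ψ₁) →
      Der Γ (.tmEq p p₁ (and φ ψ)) → Der Γ (.tmEq (andR φ ψ p) (andR φ₁ ψ₁ p₁) ψ)
  | impICong {Γ φ φ₁ ψ ψ₁ b b₁} : Der Γ (.ty .prop φ) → Der Γ (.tyEq .prop φ φ₁) →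
      Der Γ (.tyEq .prop ψ ψ₁) → Der (φ :: Γ) (.tmEq b b₁ (ψ.wk 1)) →
      Der Γ (.tmEq (impI φ ψ b) (impI φ₁ ψ₁ b₁) (imp φ ψ))
  | impECong {Γ φ φ₁ ψ ψ₁ f f₁ a a₁} : Der Γ (.tyEq .prop φ φ₁) → Der Γ (.tyEq .prop ψ ψ₁) →
      Der Γ (.tmEq f f₁ (imp φ ψ)) → Der Γ (.tmEq a a₁ φ) →
      Der Γ (.tmEq (impE φ ψ f a) (impE φ₁ ψ₁ f₁ a₁) ψ)
  | allICong {Γ A A₁ φ φ₁ b b₁} : Der Γ (.ty .col A) → Der Γ (.tyEq .col A A₁) →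
      Der (A :: Γ) (.tyEq .prop φ φ₁) → Der (A :: Γ) (.tmEq b b₁ φ) →
      Der Γ (.tmEq (allI A φ b) (allI A₁ φ₁ b₁) (all A φ))
  | allECong {Γ A A₁ φ φ₁ f f₁ a a₁} : Der Γ (.ty .col A) → Der Γ (.tyEq .col A A₁) →
      Der (A :: Γ) (.tyEq .prop φ φ₁) → Der Γ (.tmEq f f₁ (all A φ)) → Der Γ (.tmEq a a₁ A) →
      Der Γ (.tmEq (allE A φ f a) (allE A₁ φ₁ f₁ a₁) (φ.inst a))
  | exICong {Γ A A₁ φ φ₁ a a₁ b b₁} : Der Γ (.ty .col A) → Der Γ (.tyEq .col A A₁) →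
      Der (A :: Γ) (.tyEq .prop φ φ₁) → Der Γ (.tmEq a a₁ A) →
      Der Γ (.tmEq b b₁ (φ.inst a)) → Der Γ (.tmEq (exI A φ a b) (exI A₁ φ₁ a₁ b₁) (ex A φ))
  | elExCong {Γ A A₁ φ φ₁ ξ ξ₁ d d₁ m m₁} : Der Γ (.ty .col A) →
      Der (A :: Γ) (.ty .prop φ) → Der Γ (.tyEq .col A A₁) →
      Der (A :: Γ) (.tyEq .prop φ φ₁) → Der Γ (.tyEq .prop ξ ξ₁) →
      Der Γ (.tmEq d d₁ (ex A φ)) → Der (φ :: A :: Γ) (.tmEq m m₁ (ξ.wk 2)) →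
      Der Γ (.tmEq (elEx A φ ξ d m) (elEx A₁ φ₁ ξ₁ d₁ m₁) ξ)
  | reflCong {Γ A A₁ a a₁} : Der Γ (.tyEq .col A A₁) → Der Γ (.tmEq a a₁ A) →
      Der Γ (.tmEq (refl A a) (refl A₁ a₁) (ident A a a))
  | elIdentCong {Γ A A₁ ξ ξ₁ a a₁ b b₁ p p₁ c c₁} : Der Γ (.ty .col A) →
      Der Γ (.tyEq .col A A₁) → Der (A.wk 1 :: A :: Γ) (.tyEq .prop ξ ξ₁) →
      Der Γ (.tmEq a a₁ A) → Der Γ (.tmEq b b₁ A) → Der Γ (.tmEq p p₁ (ident A a b)) →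
      Der (A :: Γ) (.tmEq c c₁ (ξ.inst (Exp.var 0))) →
      Der Γ (.tmEq (elIdent A ξ a b p c) (elIdent A₁ ξ₁ a₁ b₁ p₁ c₁) (ξ.inst₂ a b))
  -- resizing rules, for types and for their equality
  | colSet {Γ A} : Der Γ (.ty .col A) → Der Γ (.ty .set A)
  | colSetEq {Γ A B} : Der Γ (.tyEq .col A B) → Der Γ (.tyEq .set A B)
  | propProps {Γ φ} : Der Γ (.ty .prop φ) → Der Γ (.ty .props φ)
  | propPropsEq {Γ φ ψ} : Der Γ (.tyEq .prop φ ψ) → Der Γ (.tyEq .props φ ψ)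

namespace Exp

/-- `φ ⇔ ψ :≡ (φ ⇒ ψ) ∧ (ψ ⇒ φ)`. -/
def iff (φ ψ : Exp) : Exp := and (imp φ ψ) (imp ψ φ)

/-- `φ → ψ :≡ (∀ _ ∈ φ) ψ`: implication through the universal quantifier. -/
def allImp (φ ψ : Exp) : Exp := all φ (ψ.wk 1)

/-- `(∀ p ∈ Propₛ) T(p)`. -/
def botImpred : Exp := all univ (dec (var 0))

/-- `(∀ p ∈ Propₛ) ((φ → T(p)) → ((ψ → T(p)) → T(p)))`. -/
def orImpred (φ ψ : Exp) : Exp :=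
  all univ (allImp (allImp (φ.wk 1) (dec (var 0)))
    (allImp (allImp (ψ.wk 1) (dec (var 0))) (dec (var 0))))

/-- `(∀ p ∈ Propₛ) ((φ → (ψ → T(p))) → T(p))`. -/
def andImpred (φ ψ : Exp) : Exp :=
  all univ (allImp (allImp (φ.wk 1) (allImp (ψ.wk 1) (dec (var 0)))) (dec (var 0)))

/-- `(∀ p ∈ Propₛ) ((∀ x ∈ A) (φ(x) → T(p)) → T(p))`. -/
def exImpred (A φ : Exp) : Exp :=
  all univ (allImp (all (A.wk 1) (allImp (φ.wkUnder 1) (dec (var 1)))) (dec (var 0)))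

/-- Leibniz equality `(∀ P ∈ A → Propₛ) (T(P(a)) → T(P(b)))`. -/
def identImpred (A a b : Exp) : Exp :=
  all (pi A univ) (allImp (dec (app (A.wk 1) univ (var 0) (a.wk 1)))
    (dec (app (A.wk 1) univ (var 0) (b.wk 1))))

end Exp

end MTT

/-! ## The theory `CC` -/

namespace CC

/-- Pre-expressions; propositions are themselves terms of type `prop`. -/
inductive Exp : Type
  | var (n : ℕ)
  -- types: Prop, N₀, N₁, A + B, List(A), (Σ x : A) B[1], (Π x : A) B[1]
  | prop
  | empty
  | unit
  | sum (A B : Exp)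
  | list (A : Exp)
  | sig (A B : Exp)
  | pi (A B : Exp)
  -- terms, with the same binding conventions as above
  | elEmpty (C a : Exp)
  | star
  | elUnit (C t c : Exp)
  | pair (A B a b : Exp)
  | elSig (A B C d m : Exp)
  | nil (A : Exp)
  | cons (A s c : Exp)
  | elList (A C s a l : Exp)
  | inl (A B a : Exp)
  | inr (A B b : Exp)
  | elSum (A B C w l r : Exp)
  | lam (A B b : Exp)
  | app (A B f a : Exp)

namespace Exp

/-- Renaming of the free variables. -/
def ren (f : ℕ → ℕ) : Exp → Exp
  | var n => var (f n)
  | prop => prop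
  | empty => empty
  | unit => unit
  | sum A B => sum (A.ren f) (B.ren f)
  | list A => list (A.ren f)
  | sig A B => sig (A.ren f) (B.ren (upr f))
  | pi A B => pi (A.ren f) (B.ren (upr f))
  | elEmpty C a => elEmpty (C.ren (upr f)) (a.ren f)
  | star => star
  | elUnit C t c => elUnit (C.ren (upr f)) (t.ren f) (c.ren f)
  | pair A B a b => pair (A.ren f) (B.ren (upr f)) (a.ren f) (b.ren f)
  | elSig A B C d m =>
      elSig (A.ren f) (B.ren (upr f)) (C.ren (upr f)) (d.ren f) (m.ren (upr (upr f)))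
  | nil A => nil (A.ren f)
  | cons A s c => cons (A.ren f) (s.ren f) (c.ren f)
  | elList A C s a l =>
      elList (A.ren f) (C.ren (upr f)) (s.ren f) (a.ren f) (l.ren (upr (upr (upr f))))
  | inl A B a => inl (A.ren f) (B.ren f) (a.ren f)
  | inr A B b => inr (A.ren f) (B.ren f) (b.ren f)
  | elSum A B C w l r =>
      elSum (A.ren f) (B.ren f) (C.ren (upr f)) (w.ren f) (l.ren (upr f)) (r.ren (upr f))
  | lam A B b => lam (A.ren f) (B.ren (upr f)) (b.ren (upr f))
  | app A B g a => app (A.ren f) (B.ren (upr f)) (g.ren f) (a.ren f)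

/-- Weakening by `k` variables. -/
def wk (k : ℕ) (e : Exp) : Exp := e.ren (· + k)

/-- Weakening by `k` variables that are inserted below one bound variable. -/
def wkUnder (k : ℕ) (e : Exp) : Exp := e.ren (upr (· + k))

/-- The weakening substitution by `k` variables. -/
def shift (k : ℕ) (n : ℕ) : Exp := var (n + k)

/-- Lifting of a substitution under one binder. -/
def up (σ : ℕ → Exp) : ℕ → Exp := scons (var 0) (fun n => (σ n).wk 1)

/-- Simultaneous capture-avoiding substitution. -/
def subst (σ : ℕ → Exp) : Exp → Exp
  | var n => σ n
  | prop => prop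
  | empty => empty
  | unit => unit
  | sum A B => sum (A.subst σ) (B.subst σ)
  | list A => list (A.subst σ)
  | sig A B => sig (A.subst σ) (B.subst (up σ))
  | pi A B => pi (A.subst σ) (B.subst (up σ))
  | elEmpty C a => elEmpty (C.subst (up σ)) (a.subst σ)
  | star => star
  | elUnit C t c => elUnit (C.subst (up σ)) (t.subst σ) (c.subst σ)
  | pair A B a b => pair (A.subst σ) (B.subst (up σ)) (a.subst σ) (b.subst σ)
  | elSig A B C d m =>
      elSig (A.subst σ) (B.subst (up σ)) (C.subst (up σ)) (d.subst σ) (m.subst (up (up σ)))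
  | nil A => nil (A.subst σ)
  | cons A s c => cons (A.subst σ) (s.subst σ) (c.subst σ)
  | elList A C s a l =>
      elList (A.subst σ) (C.subst (up σ)) (s.subst σ) (a.subst σ) (l.subst (up (up (up σ))))
  | inl A B a => inl (A.subst σ) (B.subst σ) (a.subst σ)
  | inr A B b => inr (A.subst σ) (B.subst σ) (b.subst σ)
  | elSum A B C w l r =>
      elSum (A.subst σ) (B.subst σ) (C.subst (up σ)) (w.subst σ) (l.subst (up σ))
        (r.subst (up σ))
  | lam A B b => lam (A.subst σ) (B.subst (up σ)) (b.subst (up σ))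
  | app A B g a => app (A.subst σ) (B.subst (up σ)) (g.subst σ) (a.subst σ)

/-- Substitution of `a` for the last variable. -/
def inst (e a : Exp) : Exp := e.subst (scons a var)

/-- Substitution of `a` for the last but one variable and of `b` for the last one. -/
def inst₂ (e a b : Exp) : Exp := e.subst (scons b (scons a var))

/-- `C(t)` where `C` depends on one variable over `Γ` and `t` lives in an extension of `Γ` by
`k` variables. -/
def instWk (k : ℕ) (C t : Exp) : Exp := C.subst (scons t (shift k))

end Exp

/-- Pre-contexts; the head of the list is the type of the last declared variable. -/
abbrev Ctx : Type := List Exp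

/-- The forms of judgement, without their context. -/
inductive Jdg : Type
  -- the context is well formed
  | ctx
  -- `A` is a type
  | ty (A : Exp)
  -- `A` and `B` are equal types
  | tyEq (A B : Exp)
  -- `a : A`
  | tm (a A : Exp)
  -- `a = b : A`
  | tmEq (a b A : Exp)

/-- Substitution in a judgement. -/
def Jdg.subst (σ : ℕ → Exp) : Jdg → Jdg
  | ctx => ctx
  | ty A => ty (A.subst σ)
  | tyEq A B => tyEq (A.subst σ) (B.subst σ)
  | tm a A => tm (a.subst σ) (A.subst σ)
  | tmEq a b A => tmEq (a.subst σ) (b.subst σ) (A.subst σ)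

open Exp in
/-- `Der Γ J`: the calculus derives the judgement `J [Γ]`. The only universe is the
impredicative universe `prop`, à la Russell, and conversion is generated by β. -/
inductive Der : Ctx → Jdg → Prop
  -- contexts and variables
  | ctxNil : Der [] .ctx
  | ctxCons {Γ A} : Der Γ (.ty A) → Der (A :: Γ) .ctx
  | var {Γ A} {n : ℕ} : Der Γ .ctx → Γ[n]? = some A → Der Γ (.tm (var n) (A.wk (n + 1)))
  -- substitution and replacement, as in the other theory
  | sub {Γ Δ J} {σ : ℕ → Exp} : Der Γ J → Der Δ .ctx →
      (∀ n A, Γ[n]? = some A → Der Δ (.tm (σ n) ((A.wk (n + 1)).subst σ))) →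
      (∀ n, Γ.length ≤ n → ∃ m, σ n = Exp.var m) →
      Der Δ (J.subst σ)
  | subTy {Γ Δ A} {σ τ : ℕ → Exp} : Der Γ (.ty A) → Der Δ .ctx →
      (∀ n B, Γ[n]? = some B → Der Δ (.tm (σ n) ((B.wk (n + 1)).subst σ))) →
      (∀ n B, Γ[n]? = some B → Der Δ (.tm (τ n) ((B.wk (n + 1)).subst τ))) →
      (∀ n B, Γ[n]? = some B → Der Δ (.tmEq (σ n) (τ n) ((B.wk (n + 1)).subst σ))) →
      (∀ n, Γ.length ≤ n → ∃ m, σ n = Exp.var m ∧ τ n = Exp.var m) →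
      Der Δ (.tyEq (A.subst σ) (A.subst τ))
  | subTm {Γ Δ a A} {σ τ : ℕ → Exp} : Der Γ (.tm a A) → Der Δ .ctx →
      (∀ n B, Γ[n]? = some B → Der Δ (.tm (σ n) ((B.wk (n + 1)).subst σ))) →
      (∀ n B, Γ[n]? = some B → Der Δ (.tm (τ n) ((B.wk (n + 1)).subst τ))) →
      (∀ n B, Γ[n]? = some B → Der Δ (.tmEq (σ n) (τ n) ((B.wk (n + 1)).subst σ))) →
      (∀ n, Γ.length ≤ n → ∃ m, σ n = Exp.var m ∧ τ n = Exp.var m) →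
      Der Δ (.tmEq (a.subst σ) (a.subst τ) (A.subst σ))
  -- equality
  | tyRefl {Γ A} : Der Γ (.ty A) → Der Γ (.tyEq A A)
  | tySymm {Γ A B} : Der Γ (.tyEq A B) → Der Γ (.tyEq B A)
  | tyTrans {Γ A B C} : Der Γ (.tyEq A B) → Der Γ (.tyEq B C) → Der Γ (.tyEq A C)
  | tmRefl {Γ a A} : Der Γ (.tm a A) → Der Γ (.tmEq a a A)
  | tmSymm {Γ a b A} : Der Γ (.tmEq a b A) → Der Γ (.tmEq b a A)
  | tmTrans {Γ a b c A} : Der Γ (.tmEq a b A) → Der Γ (.tmEq b c A) → Der Γ (.tmEq a c A)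
  | conv {Γ a A B} : Der Γ (.tm a A) → Der Γ (.tyEq A B) → Der Γ (.tm a B)
  | convEq {Γ a b A B} : Der Γ (.tmEq a b A) → Der Γ (.tyEq A B) → Der Γ (.tmEq a b B)
  -- the impredicative universe of propositions
  | propF {Γ} : Der Γ .ctx → Der Γ (.ty prop)
  | propE {Γ φ} : Der Γ (.tm φ prop) → Der Γ (.ty φ)
  | propEEq {Γ φ ψ} : Der Γ (.tmEq φ ψ prop) → Der Γ (.tyEq φ ψ)
  -- dependent products of types, which are propositions as soon as the codomain is one
  | piF {Γ A B} : Der Γ (.ty A) → Der (A :: Γ) (.ty B) → Der Γ (.ty (pi A B))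
  | piCong {Γ A A₁ B B₁} : Der Γ (.ty A) → Der Γ (.tyEq A A₁) → Der (A :: Γ) (.tyEq B B₁) →
      Der Γ (.tyEq (pi A B) (pi A₁ B₁))
  | piProp {Γ A φ} : Der Γ (.ty A) → Der (A :: Γ) (.tm φ prop) → Der Γ (.tm (pi A φ) prop)
  | piPropCong {Γ A A₁ φ φ₁} : Der Γ (.ty A) → Der Γ (.tyEq A A₁) →
      Der (A :: Γ) (.tmEq φ φ₁ prop) → Der Γ (.tmEq (pi A φ) (pi A₁ φ₁) prop)
  | piI {Γ A B b} : Der Γ (.ty A) → Der (A :: Γ) (.ty B) → Der (A :: Γ) (.tm b B) →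
      Der Γ (.tm (lam A B b) (pi A B))
  | lamCong {Γ A A₁ B B₁ b b₁} : Der Γ (.ty A) → Der (A :: Γ) (.ty B) →
      Der Γ (.tyEq A A₁) → Der (A :: Γ) (.tyEq B B₁) → Der (A :: Γ) (.tmEq b b₁ B) →
      Der Γ (.tmEq (lam A B b) (lam A₁ B₁ b₁) (pi A B))
  | piE {Γ A B f a} : Der Γ (.ty A) → Der (A :: Γ) (.ty B) → Der Γ (.tm f (pi A B)) →
      Der Γ (.tm a A) → Der Γ (.tm (app A B f a) (B.inst a))
  | appCong {Γ A A₁ B B₁ f f₁ a a₁} : Der Γ (.ty A) → Der Γ (.tyEq A A₁) →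
      Der (A :: Γ) (.tyEq B B₁) → Der Γ (.tmEq f f₁ (pi A B)) → Der Γ (.tmEq a a₁ A) →
      Der Γ (.tmEq (app A B f a) (app A₁ B₁ f₁ a₁) (B.inst a))
  | piC {Γ A B b a} : Der Γ (.ty A) → Der (A :: Γ) (.ty B) → Der (A :: Γ) (.tm b B) →
      Der Γ (.tm a A) → Der Γ (.tmEq (app A B (lam A B b) a) (b.inst a) (B.inst a))
  -- the empty type
  | emptyF {Γ} : Der Γ .ctx → Der Γ (.ty empty)
  | emptyE {Γ C a} : Der (empty :: Γ) (.ty C) → Der Γ (.tm a empty) →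
      Der Γ (.tm (elEmpty C a) (C.inst a))
  | elEmptyCong {Γ C C₁ a a₁} : Der (empty :: Γ) (.tyEq C C₁) →
      Der Γ (.tmEq a a₁ empty) → Der Γ (.tmEq (elEmpty C a) (elEmpty C₁ a₁) (C.inst a))
  -- the singleton type
  | unitF {Γ} : Der Γ .ctx → Der Γ (.ty unit)
  | unitI {Γ} : Der Γ .ctx → Der Γ (.tm star unit)
  | unitE {Γ C t c} : Der (unit :: Γ) (.ty C) → Der Γ (.tm t unit) →
      Der Γ (.tm c (C.inst star)) → Der Γ (.tm (elUnit C t c) (C.inst t))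
  | unitC {Γ C c} : Der (unit :: Γ) (.ty C) → Der Γ (.tm c (C.inst star)) →
      Der Γ (.tmEq (elUnit C star c) c (C.inst star))
  | elUnitCong {Γ C C₁ t t₁ c c₁} : Der (unit :: Γ) (.tyEq C C₁) →
      Der Γ (.tmEq t t₁ unit) → Der Γ (.tmEq c c₁ (C.inst star)) →
      Der Γ (.tmEq (elUnit C t c) (elUnit C₁ t₁ c₁) (C.inst t))
  -- dependent sums
  | sigF {Γ A B} : Der Γ (.ty A) → Der (A :: Γ) (.ty B) → Der Γ (.ty (sig A B))
  | sigCong {Γ A A₁ B B₁} : Der Γ (.ty A) → Der Γ (.tyEq A A₁) → Der (A :: Γ) (.tyEq B B₁) →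
      Der Γ (.tyEq (sig A B) (sig A₁ B₁))
  | sigI {Γ A B a b} : Der Γ (.ty A) → Der (A :: Γ) (.ty B) → Der Γ (.tm a A) →
      Der Γ (.tm b (B.inst a)) → Der Γ (.tm (pair A B a b) (sig A B))
  | pairCong {Γ A A₁ B B₁ a a₁ b b₁} : Der Γ (.ty A) → Der Γ (.tyEq A A₁) →
      Der (A :: Γ) (.tyEq B B₁) → Der Γ (.tmEq a a₁ A) → Der Γ (.tmEq b b₁ (B.inst a)) →
      Der Γ (.tmEq (pair A B a b) (pair A₁ B₁ a₁ b₁) (sig A B))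
  | sigE {Γ A B C d m} : Der Γ (.ty A) → Der (A :: Γ) (.ty B) →
      Der (sig A B :: Γ) (.ty C) → Der Γ (.tm d (sig A B)) →
      Der (B :: A :: Γ)
        (.tm m (C.instWk 2 (pair (A.wk 2) (B.wkUnder 2) (Exp.var 1) (Exp.var 0)))) →
      Der Γ (.tm (elSig A B C d m) (C.inst d))
  | elSigCong {Γ A A₁ B B₁ C C₁ d d₁ m m₁} : Der Γ (.ty A) → Der (A :: Γ) (.ty B) →
      Der Γ (.tyEq A A₁) → Der (A :: Γ) (.tyEq B B₁) →
      Der (sig A B :: Γ) (.tyEq C C₁) → Der Γ (.tmEq d d₁ (sig A B)) →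
      Der (B :: A :: Γ)
        (.tmEq m m₁ (C.instWk 2 (pair (A.wk 2) (B.wkUnder 2) (Exp.var 1) (Exp.var 0)))) →
      Der Γ (.tmEq (elSig A B C d m) (elSig A₁ B₁ C₁ d₁ m₁) (C.inst d))
  | sigC {Γ A B C a b m} : Der Γ (.ty A) → Der (A :: Γ) (.ty B) →
      Der (sig A B :: Γ) (.ty C) → Der Γ (.tm a A) → Der Γ (.tm b (B.inst a)) →
      Der (B :: A :: Γ)
        (.tm m (C.instWk 2 (pair (A.wk 2) (B.wkUnder 2) (Exp.var 1) (Exp.var 0)))) →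
      Der Γ (.tmEq (elSig A B C (pair A B a b) m) (m.inst₂ a b) (C.inst (pair A B a b)))
  -- lists
  | listF {Γ A} : Der Γ (.ty A) → Der Γ (.ty (list A))
  | listCong {Γ A A₁} : Der Γ (.tyEq A A₁) → Der Γ (.tyEq (list A) (list A₁))
  | listNil {Γ A} : Der Γ (.ty A) → Der Γ (.tm (nil A) (list A))
  | nilCong {Γ A A₁} : Der Γ (.tyEq A A₁) → Der Γ (.tmEq (nil A) (nil A₁) (list A))
  | listCons {Γ A s c} : Der Γ (.ty A) → Der Γ (.tm s (list A)) → Der Γ (.tm c A) →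
      Der Γ (.tm (cons A s c) (list A))
  | consCong {Γ A A₁ s s₁ c c₁} : Der Γ (.tyEq A A₁) → Der Γ (.tmEq s s₁ (list A)) →
      Der Γ (.tmEq c c₁ A) → Der Γ (.tmEq (cons A s c) (cons A₁ s₁ c₁) (list A))
  | listE {Γ A C s a l} : Der Γ (.ty A) → Der (list A :: Γ) (.ty C) →
      Der Γ (.tm s (list A)) → Der Γ (.tm a (C.inst (nil A))) →
      Der (C.instWk 2 (Exp.var 1) :: A.wk 1 :: list A :: Γ)
        (.tm l (C.instWk 3 (cons (A.wk 3) (Exp.var 2) (Exp.var 1)))) →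
      Der Γ (.tm (elList A C s a l) (C.inst s))
  | elListCong {Γ A A₁ C C₁ s s₁ a a₁ l l₁} : Der Γ (.ty A) →
      Der (list A :: Γ) (.ty C) → Der Γ (.tyEq A A₁) →
      Der (list A :: Γ) (.tyEq C C₁) → Der Γ (.tmEq s s₁ (list A)) →
      Der Γ (.tmEq a a₁ (C.inst (nil A))) →
      Der (C.instWk 2 (Exp.var 1) :: A.wk 1 :: list A :: Γ)
        (.tmEq l l₁ (C.instWk 3 (cons (A.wk 3) (Exp.var 2) (Exp.var 1)))) →
      Der Γ (.tmEq (elList A C s a l) (elList A₁ C₁ s₁ a₁ l₁) (C.inst s))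
  | listCNil {Γ A C a l} : Der Γ (.ty A) → Der (list A :: Γ) (.ty C) →
      Der Γ (.tm a (C.inst (nil A))) →
      Der (C.instWk 2 (Exp.var 1) :: A.wk 1 :: list A :: Γ)
        (.tm l (C.instWk 3 (cons (A.wk 3) (Exp.var 2) (Exp.var 1)))) →
      Der Γ (.tmEq (elList A C (nil A) a l) a (C.inst (nil A)))
  | listCCons {Γ A C s c a l} : Der Γ (.ty A) → Der (list A :: Γ) (.ty C) →
      Der Γ (.tm s (list A)) → Der Γ (.tm c A) → Der Γ (.tm a (C.inst (nil A))) →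
      Der (C.instWk 2 (Exp.var 1) :: A.wk 1 :: list A :: Γ)
        (.tm l (C.instWk 3 (cons (A.wk 3) (Exp.var 2) (Exp.var 1)))) →
      Der Γ (.tmEq (elList A C (cons A s c) a l)
        (l.subst (scons (elList A C s a l) (scons c (scons s Exp.var))))
        (C.inst (cons A s c)))
  -- disjoint sums
  | sumF {Γ A B} : Der Γ (.ty A) → Der Γ (.ty B) → Der Γ (.ty (sum A B))
  | sumCong {Γ A A₁ B B₁} : Der Γ (.tyEq A A₁) → Der Γ (.tyEq B B₁) →
      Der Γ (.tyEq (sum A B) (sum A₁ B₁))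
  | sumInl {Γ A B a} : Der Γ (.ty A) → Der Γ (.ty B) → Der Γ (.tm a A) →
      Der Γ (.tm (inl A B a) (sum A B))
  | inlCong {Γ A A₁ B B₁ a a₁} : Der Γ (.tyEq A A₁) → Der Γ (.tyEq B B₁) →
      Der Γ (.tmEq a a₁ A) → Der Γ (.tmEq (inl A B a) (inl A₁ B₁ a₁) (sum A B))
  | sumInr {Γ A B b} : Der Γ (.ty A) → Der Γ (.ty B) → Der Γ (.tm b B) →
      Der Γ (.tm (inr A B b) (sum A B))
  | inrCong {Γ A A₁ B B₁ b b₁} : Der Γ (.tyEq A A₁) → Der Γ (.tyEq B B₁) →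
      Der Γ (.tmEq b b₁ B) → Der Γ (.tmEq (inr A B b) (inr A₁ B₁ b₁) (sum A B))
  | sumE {Γ A B C w l r} : Der Γ (.ty A) → Der Γ (.ty B) →
      Der (sum A B :: Γ) (.ty C) → Der Γ (.tm w (sum A B)) →
      Der (A :: Γ) (.tm l (C.instWk 1 (inl (A.wk 1) (B.wk 1) (Exp.var 0)))) →
      Der (B :: Γ) (.tm r (C.instWk 1 (inr (A.wk 1) (B.wk 1) (Exp.var 0)))) →
      Der Γ (.tm (elSum A B C w l r) (C.inst w))
  | elSumCong {Γ A A₁ B B₁ C C₁ w w₁ l l₁ r r₁} : Der Γ (.ty A) → Der Γ (.ty B) →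
      Der Γ (.tyEq A A₁) → Der Γ (.tyEq B B₁) →
      Der (sum A B :: Γ) (.tyEq C C₁) → Der Γ (.tmEq w w₁ (sum A B)) →
      Der (A :: Γ) (.tmEq l l₁ (C.instWk 1 (inl (A.wk 1) (B.wk 1) (Exp.var 0)))) →
      Der (B :: Γ) (.tmEq r r₁ (C.instWk 1 (inr (A.wk 1) (B.wk 1) (Exp.var 0)))) →
      Der Γ (.tmEq (elSum A B C w l r) (elSum A₁ B₁ C₁ w₁ l₁ r₁) (C.inst w))
  | sumCInl {Γ A B C a l r} : Der Γ (.ty A) → Der Γ (.ty B) →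
      Der (sum A B :: Γ) (.ty C) → Der Γ (.tm a A) →
      Der (A :: Γ) (.tm l (C.instWk 1 (inl (A.wk 1) (B.wk 1) (Exp.var 0)))) →
      Der (B :: Γ) (.tm r (C.instWk 1 (inr (A.wk 1) (B.wk 1) (Exp.var 0)))) →
      Der Γ (.tmEq (elSum A B C (inl A B a) l r) (l.inst a) (C.inst (inl A B a)))
  | sumCInr {Γ A B C b l r} : Der Γ (.ty A) → Der Γ (.ty B) →
      Der (sum A B :: Γ) (.ty C) → Der Γ (.tm b B) →
      Der (A :: Γ) (.tm l (C.instWk 1 (inl (A.wk 1) (B.wk 1) (Exp.var 0)))) →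
      Der (B :: Γ) (.tm r (C.instWk 1 (inr (A.wk 1) (B.wk 1) (Exp.var 0)))) →
      Der Γ (.tmEq (elSum A B C (inr A B b) l r) (r.inst b) (C.inst (inr A B b)))

namespace Exp

/-! ### Impredicative encodings, made from `pi` alone -/

/-- `φ → ψ`. -/
def arr (φ ψ : Exp) : Exp := pi φ (ψ.wk 1)

/-- `λ x : φ. b`, a function from `φ` to `ψ`. -/
def arrI (φ ψ b : Exp) : Exp := lam φ (ψ.wk 1) b

/-- Application of a function from `φ` to `ψ`. -/
def arrE (φ ψ f a : Exp) : Exp := app φ (ψ.wk 1) f a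

/-- The matrix of `⊥`: `p`, where `p : Prop` is the last variable. -/
def botBody : Exp := var 0

/-- `⊥ :≡ (Π p : Prop) p`. -/
def bot : Exp := pi prop botBody

def elBot (ξ a : Exp) : Exp := app prop botBody a ξ

/-- The matrix of `φ ∨ ψ`: `(φ → p) → ((ψ → p) → p)`. -/
def orBody (φ ψ : Exp) : Exp :=
  arr (arr (φ.wk 1) (var 0)) (arr (arr (ψ.wk 1) (var 0)) (var 0))

/-- `φ ∨ ψ :≡ (Π p : Prop) ((φ → p) → ((ψ → p) → p))`. -/
def or (φ ψ : Exp) : Exp := pi prop (orBody φ ψ)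

/-- `λ p. λ f. λ g. f a`. -/
def orInl (φ ψ a : Exp) : Exp :=
  lam prop (orBody φ ψ)
    (arrI (arr (φ.wk 1) (var 0)) (arr (arr (ψ.wk 1) (var 0)) (var 0))
      (arrI (arr (ψ.wk 2) (var 1)) (var 1) (arrE (φ.wk 3) (var 2) (var 1) (a.wk 3))))

/-- `λ p. λ f. λ g. g b`. -/
def orInr (φ ψ b : Exp) : Exp :=
  lam prop (orBody φ ψ)
    (arrI (arr (φ.wk 1) (var 0)) (arr (arr (ψ.wk 1) (var 0)) (var 0))
      (arrI (arr (ψ.wk 2) (var 1)) (var 1) (arrE (ψ.wk 3) (var 2) (var 0) (b.wk 3))))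

/-- `w ξ (λ x. l) (λ y. r)`. -/
def elOr (φ ψ ξ w l r : Exp) : Exp :=
  arrE (arr ψ ξ) ξ
    (arrE (arr φ ξ) (arr (arr ψ ξ) ξ) (app prop (orBody φ ψ) w ξ) (arrI φ ξ l))
    (arrI ψ ξ r)

/-- The matrix of `φ ∧ ψ`: `(φ → (ψ → p)) → p`. -/
def andBody (φ ψ : Exp) : Exp := arr (arr (φ.wk 1) (arr (ψ.wk 1) (var 0))) (var 0)

/-- `φ ∧ ψ :≡ (Π p : Prop) ((φ → (ψ → p)) → p)`. -/
def and (φ ψ : Exp) : Exp := pi prop (andBody φ ψ)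

/-- `λ p. λ f. f a b`. -/
def andI (φ ψ a b : Exp) : Exp :=
  lam prop (andBody φ ψ)
    (arrI (arr (φ.wk 1) (arr (ψ.wk 1) (var 0))) (var 0)
      (arrE (ψ.wk 2) (var 1)
        (arrE (φ.wk 2) (arr (ψ.wk 2) (var 1)) (var 0) (a.wk 2)) (b.wk 2)))

/-- `p φ (λ x. λ y. x)`. -/
def andL (φ ψ p : Exp) : Exp :=
  arrE (arr φ (arr ψ φ)) φ (app prop (andBody φ ψ) p φ)
    (arrI φ (arr ψ φ) (arrI (ψ.wk 1) (φ.wk 1) (var 1)))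

/-- `p ψ (λ x. λ y. y)`. -/
def andR (φ ψ p : Exp) : Exp :=
  arrE (arr φ (arr ψ ψ)) ψ (app prop (andBody φ ψ) p ψ)
    (arrI φ (arr ψ ψ) (arrI (ψ.wk 1) (ψ.wk 1) (var 0)))

/-- The matrix of `(∃ x : A) φ(x)`: `((Π x : A) (φ(x) → p)) → p`. -/
def exBody (A φ : Exp) : Exp := arr (pi (A.wk 1) (arr (φ.wkUnder 1) (var 1))) (var 0)

/-- `(∃ x : A) φ(x) :≡ (Π p : Prop) (((Π x : A) (φ(x) → p)) → p)`. -/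
def ex (A φ : Exp) : Exp := pi prop (exBody A φ)

/-- `λ p. λ f. f a b`. -/
def exI (A φ a b : Exp) : Exp :=
  lam prop (exBody A φ)
    (arrI (pi (A.wk 1) (arr (φ.wkUnder 1) (var 1))) (var 0)
      (arrE ((φ.inst a).wk 2) (var 1)
        (app (A.wk 2) (arr (φ.wkUnder 2) (var 2)) (var 0) (a.wk 2)) (b.wk 2)))

/-- `d ξ (λ x. λ y. m)`. -/
def elEx (A φ ξ d m : Exp) : Exp :=
  arrE (pi A (arr φ (ξ.wk 1))) ξ (app prop (exBody A φ) d ξ)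
    (lam A (arr φ (ξ.wk 1)) (arrI φ (ξ.wk 1) m))

/-- `P(a)`, where `P : A → Prop` is the last variable. -/
def identAt (A a : Exp) : Exp := app (A.wk 1) prop (var 0) (a.wk 1)

/-- Leibniz equality `Id(A, a, b) :≡ (Π P : A → Prop) (P(a) → P(b))`. -/
def ident (A a b : Exp) : Exp := pi (pi A prop) (arr (identAt A a) (identAt A b))

/-- `λ P. λ x. x`. -/
def refl (A a : Exp) : Exp :=
  lam (pi A prop) (arr (identAt A a) (identAt A a)) (arrI (identAt A a) (identAt A a) (var 0))

/-- The predicate `λ y. ξ(a, y)`. -/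
def identPred (A ξ a : Exp) : Exp :=
  lam A prop (ξ.subst (scons (var 0) (scons (a.wk 1) (shift 1))))

/-- `p (λ y. ξ(a, y)) c(a)`. -/
def elIdent (A ξ a b p c : Exp) : Exp :=
  arrE (app A prop (identPred A ξ a) a) (app A prop (identPred A ξ a) b)
    (app (pi A prop) (arr (identAt A a) (identAt A b)) p (identPred A ξ a)) (c.inst a)

/-- Whether an expression, used as a type, is a proposition: only `prop`, the inductive types
and the products of non-propositions are not. -/
def IsProp : Exp → Bool
  | prop => false
  | empty => false
  | unit => false
  | sum _ _ => false
  | list _ => false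
  | sig _ _ => false
  | pi _ B => B.IsProp
  | _ => true

end Exp

end CC

/-! ## The two translations -/

namespace MTT

/-- The translation of `MTT` into `CC`: it erases decodings and codes, reads both `∀` and `Π` as
the product, and reads the other propositional constructors as their impredicative encodings. -/
def Exp.enc : Exp → CC.Exp
  | var n => .var n
  | empty => .empty
  | unit => .unit
  | sum A B => .sum A.enc B.enc
  | list A => .list A.enc
  | sig A B => .sig A.enc B.enc
  | pi A B => .pi A.enc B.enc
  | univ => .prop
  | dec c => c.enc
  | bot => .bot
  | or φ ψ => .or φ.enc ψ.enc
  | and φ ψ => .and φ.enc ψ.enc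
  | imp φ ψ => .arr φ.enc ψ.enc
  | all A φ => .pi A.enc φ.enc
  | ex A φ => .ex A.enc φ.enc
  | ident A a b => .ident A.enc a.enc b.enc
  | code φ => φ.enc
  | elEmpty C a => .elEmpty C.enc a.enc
  | star => .star
  | elUnit C t c => .elUnit C.enc t.enc c.enc
  | pair A B a b => .pair A.enc B.enc a.enc b.enc
  | elSig A B C d m => .elSig A.enc B.enc C.enc d.enc m.enc
  | nil A => .nil A.enc
  | cons A s c => .cons A.enc s.enc c.enc
  | elList A C s a l => .elList A.enc C.enc s.enc a.enc l.enc
  | inl A B a => .inl A.enc B.enc a.enc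
  | inr A B b => .inr A.enc B.enc b.enc
  | elSum A B C w l r => .elSum A.enc B.enc C.enc w.enc l.enc r.enc
  | lam A B b => .lam A.enc B.enc b.enc
  | app A B f a => .app A.enc B.enc f.enc a.enc
  | elBot ξ a => .elBot ξ.enc a.enc
  | orInl φ ψ a => .orInl φ.enc ψ.enc a.enc
  | orInr φ ψ b => .orInr φ.enc ψ.enc b.enc
  | elOr φ ψ ξ w l r => .elOr φ.enc ψ.enc ξ.enc w.enc l.enc r.enc
  | andI φ ψ a b => .andI φ.enc ψ.enc a.enc b.enc
  | andL φ ψ p => .andL φ.enc ψ.enc p.enc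
  | andR φ ψ p => .andR φ.enc ψ.enc p.enc
  | impI φ ψ b => .arrI φ.enc ψ.enc b.enc
  | impE φ ψ f a => .arrE φ.enc ψ.enc f.enc a.enc
  | allI A φ b => .lam A.enc φ.enc b.enc
  | allE A φ f a => .app A.enc φ.enc f.enc a.enc
  | exI A φ a b => .exI A.enc φ.enc a.enc b.enc
  | elEx A φ ξ d m => .elEx A.enc φ.enc ξ.enc d.enc m.enc
  | refl A a => .refl A.enc a.enc
  | elIdent A ξ a b p c => .elIdent A.enc ξ.enc a.enc b.enc p.enc c.enc

/-- The translation of judgements: sets and collections become types, (small) propositions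
become terms of type `prop`. -/
def Jdg.enc : Jdg → CC.Jdg
  | ctx => .ctx
  | ty (.data _) A => .ty A.enc
  | ty (.logic _) φ => .tm φ.enc .prop
  | tyEq (.data _) A B => .tyEq A.enc B.enc
  | tyEq (.logic _) φ ψ => .tmEq φ.enc ψ.enc .prop
  | tm a A => .tm a.enc A.enc
  | tmEq a b A => .tmEq a.enc b.enc A.enc

end MTT

namespace CC

/-- Expressions of `CC` are read either as types or as terms. -/
inductive Role : Type
  | asTy
  | asTm

/-- Given a term `c`, which is a name of a proposition when it is read as a type. -/
def Role.ofTm : Role → MTT.Exp → MTT.Exp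
  | asTy, c => .dec c
  | asTm, c => c

/-- Given a type `A`, which occurs as a term only in ill-formed expressions. -/
def Role.ofTy : Role → MTT.Exp → MTT.Exp
  | asTy, A => A
  | asTm, A => .code A

/-- The translation of `CC` into `MTT`: it inserts decodings and codes, and reads a product (with
its abstraction and application) as `∀` or as `Π` according to whether its codomain is a
proposition. -/
def Exp.emb (r : Role) : Exp → MTT.Exp
  | var n => r.ofTm (.var n)
  | prop => r.ofTy .univ
  | empty => r.ofTy .empty
  | unit => r.ofTy .unit
  | sum A B => r.ofTy (.sum (A.emb .asTy) (B.emb .asTy))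
  | list A => r.ofTy (.list (A.emb .asTy))
  | sig A B => r.ofTy (.sig (A.emb .asTy) (B.emb .asTy))
  | pi A B =>
      if B.IsProp then r.ofTm (.code (.all (A.emb .asTy) (B.emb .asTy)))
      else r.ofTy (.pi (A.emb .asTy) (B.emb .asTy))
  | elEmpty C a => r.ofTm (.elEmpty (C.emb .asTy) (a.emb .asTm))
  | star => r.ofTm .star
  | elUnit C t c => r.ofTm (.elUnit (C.emb .asTy) (t.emb .asTm) (c.emb .asTm))
  | pair A B a b =>
      r.ofTm (.pair (A.emb .asTy) (B.emb .asTy) (a.emb .asTm) (b.emb .asTm))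
  | elSig A B C d m =>
      r.ofTm (.elSig (A.emb .asTy) (B.emb .asTy) (C.emb .asTy) (d.emb .asTm) (m.emb .asTm))
  | nil A => r.ofTm (.nil (A.emb .asTy))
  | cons A s c => r.ofTm (.cons (A.emb .asTy) (s.emb .asTm) (c.emb .asTm))
  | elList A C s a l =>
      r.ofTm (.elList (A.emb .asTy) (C.emb .asTy) (s.emb .asTm) (a.emb .asTm) (l.emb .asTm))
  | inl A B a => r.ofTm (.inl (A.emb .asTy) (B.emb .asTy) (a.emb .asTm))
  | inr A B b => r.ofTm (.inr (A.emb .asTy) (B.emb .asTy) (b.emb .asTm))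
  | elSum A B C w l r' =>
      r.ofTm (.elSum (A.emb .asTy) (B.emb .asTy) (C.emb .asTy) (w.emb .asTm) (l.emb .asTm)
        (r'.emb .asTm))
  | lam A B b =>
      r.ofTm (if B.IsProp then .allI (A.emb .asTy) (B.emb .asTy) (b.emb .asTm)
        else .lam (A.emb .asTy) (B.emb .asTy) (b.emb .asTm))
  | app A B f a =>
      r.ofTm (if B.IsProp then .allE (A.emb .asTy) (B.emb .asTy) (f.emb .asTm) (a.emb .asTm)
        else .app (A.emb .asTy) (B.emb .asTy) (f.emb .asTm) (a.emb .asTm))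

/-- The translation of judgements. -/
def Jdg.emb : Jdg → MTT.Jdg
  | ctx => .ctx
  | ty A => .ty .set (A.emb .asTy)
  | tyEq A B => .tyEq .set (A.emb .asTy) (B.emb .asTy)
  | tm a A => .tm (a.emb .asTm) (A.emb .asTy)
  | tmEq a b A => .tmEq (a.emb .asTm) (b.emb .asTm) (A.emb .asTy)

end CC

/-! The two theories are compared by exhibiting `emb` as a section of `enc` and showing that both
maps preserve derivability. No confluence or normalisation argument is needed.

From `MTT` to `CC`, the translation `enc` only forgets: decodings and codes disappear, `∀` and `Π`
are merged, and so are sets with collections and small propositions with propositions. Resizing and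
the rules of the universe therefore become trivial. The content is that the impredicative encodings
satisfy the introduction, elimination and computation rules of the propositional constructors
judgementally, each computation rule being a short chain of β-steps. The proof (`MTT.Der.sound`)
uses presuppositions for `CC` (`CC.Deriv.presup`): a derivable equality has both sides typed. Typing
is then treated as the diagonal case of equality, and a single congruence lemma validates a rule of
`MTT` together with its congruence rule.

From `CC` to `MTT`, the translation `emb` has to decide for each product between `∀` and `Π`, and it
decides by the syntactic test `IsProp`. The decision is coherent thanks to an invariant of derivable
judgements (`CC.Deriv.propOk`): every typed term passes the test, and equal types give the same
answer. So substitution of typed terms never changes the answer, `emb` commutes with such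
substitutions (`CC.Exp.emb_subst`), and an induction on derivations goes through (`CC.Deriv.emb`),
provided that it records that types passing the test become small propositions and not merely sets.
Resizing makes the universe a set, so that every type of `CC` becomes a set and products may be
formed freely. The induction is on `Deriv`, a variant of `Der` with one more premise in the
congruence rule for application; presuppositions show that the two derive the same judgements.

Since everything that `emb` inserts or distinguishes is erased by `enc`, the composite is the
identity already on raw expressions (`CC.Exp.enc_emb`). Hence each judgement of `CC` is in the image
of `enc`, and a derivation in `MTT` of a translated judgement can be carried back to `CC`.

The equivalences inside `MTT` are the usual second-order ones: the quantified `p` is instantiated at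
a code of the very proposition to be proved, which exists by resizing; for equality the predicate is
`x ↦ Id(A, a, x)`. The passage between `∀` and `Π` is by η-expansion, and its compatibility with
application is a β-rule. -/

@[simp] theorem scons_zero {α : Type} (a : α) (σ : ℕ → α) : scons a σ 0 = a := rfl

@[simp] theorem scons_succ {α : Type} (a : α) (σ : ℕ → α) (n : ℕ) : scons a σ (n + 1) = σ n :=
  rfl

/-! ## Substitution calculus -/

namespace MTT

namespace Exp

/-- Composition of substitutions. -/
def comp (σ τ : ℕ → Exp) (n : ℕ) : Exp := (σ n).subst τ

@[simp] theorem comp_apply (σ τ : ℕ → Exp) (n : ℕ) : comp σ τ n = (σ n).subst τ := rfl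

@[simp] theorem shift_apply (k n : ℕ) : shift k n = var (n + k) := rfl

@[simp] theorem subst_var_apply (σ : ℕ → Exp) (n : ℕ) : (var n).subst σ = σ n := rfl

theorem up_var : up var = var := by
  funext n; cases n <;> rfl

theorem up_var_comp (f : ℕ → ℕ) : up (fun n => var (f n)) = fun n => var (upr f n) := by
  funext n; cases n <;> rfl

theorem ren_eq_subst (f : ℕ → ℕ) (e : Exp) : e.ren f = e.subst (fun n => var (f n)) := by
  induction e generalizing f <;> simp only [ren, subst, up_var_comp, *]

@[simp] theorem subst_var (e : Exp) : e.subst var = e := by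
  induction e <;> simp only [subst, up_var, *]

theorem up_comp_upr (σ : ℕ → Exp) (f : ℕ → ℕ) :
    (fun n => up σ (upr f n)) = up (fun n => σ (f n)) := by
  funext n; cases n <;> rfl

/-- Lifting weakens by a renaming, so the composition law for two substitutions rests on the two
mixed laws: this one and `ren_subst` are what `up_comp` uses under a binder. -/
theorem subst_ren (f : ℕ → ℕ) (σ : ℕ → Exp) (e : Exp) :
    (e.ren f).subst σ = e.subst (fun n => σ (f n)) := by
  induction e generalizing f σ <;> simp only [ren, subst, up_comp_upr, *]

theorem ren_ren (f g : ℕ → ℕ) (e : Exp) : (e.ren f).ren g = e.ren (fun n => g (f n)) := by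
  rw [ren_eq_subst g, subst_ren, ren_eq_subst]

theorem upr_comp_up (σ : ℕ → Exp) (f : ℕ → ℕ) :
    (fun n => (up σ n).ren (upr f)) = up (fun n => (σ n).ren f) := by
  funext n
  cases n with
  | zero => rfl
  | succ n => simp only [up, scons, wk, ren_ren, upr]

theorem ren_subst (σ : ℕ → Exp) (f : ℕ → ℕ) (e : Exp) :
    (e.subst σ).ren f = e.subst (fun n => (σ n).ren f) := by
  induction e generalizing f σ <;> simp only [ren, subst, upr_comp_up, *]

theorem up_comp (σ τ : ℕ → Exp) : comp (up σ) (up τ) = up (comp σ τ) := by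
  funext n
  cases n with
  | zero => rfl
  | succ n => simp only [comp, up, scons, wk, ren_subst, subst_ren]

@[simp] theorem subst_subst (σ τ : ℕ → Exp) (e : Exp) :
    (e.subst σ).subst τ = e.subst (comp σ τ) := by
  induction e generalizing σ τ <;> simp only [subst, up_comp, *]
  rfl

-- Weakening, lifting and instantiation are all rewritten into `subst` along expressions in `scons`,
-- `shift` and `comp`, which the remaining rules of this section normalise. Identities between
-- substituted types in the derivations are then left to `simp`.
@[simp] theorem wk_eq (k : ℕ) (e : Exp) : e.wk k = e.subst (shift k) := ren_eq_subst _ e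

@[simp] theorem up_eq (σ : ℕ → Exp) : up σ = scons (var 0) (comp σ (shift 1)) := by
  funext n; cases n <;> simp [up, scons]

@[simp] theorem wkUnder_eq (k : ℕ) (e : Exp) : e.wkUnder k = e.subst (up (shift k)) := by
  rw [wkUnder, ren_eq_subst, ← up_var_comp]; rfl

@[simp] theorem inst_eq (e a : Exp) : e.inst a = e.subst (scons a var) := rfl

@[simp] theorem inst₂_eq (e a b : Exp) : e.inst₂ a b = e.subst (scons b (scons a var)) := rfl

@[simp] theorem instWk_eq (k : ℕ) (e t : Exp) :
    e.instWk k t = e.subst (scons t (shift k)) := rfl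

@[simp] theorem comp_scons (a : Exp) (σ τ : ℕ → Exp) :
    comp (scons a σ) τ = scons (a.subst τ) (comp σ τ) := by
  funext n; cases n <;> rfl

@[simp] theorem comp_shift_scons (k : ℕ) (a : Exp) (σ : ℕ → Exp) :
    comp (shift (k + 1)) (scons a σ) = comp (shift k) σ := rfl

@[simp] theorem shift_zero : shift 0 = var := rfl

@[simp] theorem comp_var_left (σ : ℕ → Exp) : comp var σ = σ := rfl

@[simp] theorem comp_var_right (σ : ℕ → Exp) : comp σ var = σ := by
  funext n; simp

@[simp] theorem comp_assoc (σ τ ρ : ℕ → Exp) : comp (comp σ τ) ρ = comp σ (comp τ ρ) := by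
  funext n; simp

@[simp] theorem comp_shift_shift (j k : ℕ) : comp (shift j) (shift k) = shift (j + k) := by
  funext n; simp [Nat.add_assoc]

-- The η-law of explicit substitutions. Because of it, weakening below a bound variable and then
-- instantiating at a fresh variable cancel out.
@[simp] theorem scons_var_shift (k : ℕ) : scons (var k) (shift (k + 1)) = shift k := by
  funext n; cases n <;> simp [Nat.add_assoc, Nat.add_comm 1]

end Exp

end MTT

/-! ### The same substitution calculus for `CC` -/

namespace CC

namespace Exp

/-- Composition of substitutions. -/
def comp (σ τ : ℕ → Exp) (n : ℕ) : Exp := (σ n).subst τ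

@[simp] theorem comp_apply (σ τ : ℕ → Exp) (n : ℕ) : comp σ τ n = (σ n).subst τ := rfl

@[simp] theorem shift_apply (k n : ℕ) : shift k n = var (n + k) := rfl

@[simp] theorem subst_var_apply (σ : ℕ → Exp) (n : ℕ) : (var n).subst σ = σ n := rfl

theorem up_var : up var = var := by
  funext n; cases n <;> rfl

theorem up_var_comp (f : ℕ → ℕ) : up (fun n => var (f n)) = fun n => var (upr f n) := by
  funext n; cases n <;> rfl

theorem ren_eq_subst (f : ℕ → ℕ) (e : Exp) : e.ren f = e.subst (fun n => var (f n)) := by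
  induction e generalizing f <;> simp only [ren, subst, up_var_comp, *]

@[simp] theorem subst_var (e : Exp) : e.subst var = e := by
  induction e <;> simp only [subst, up_var, *]

theorem up_comp_upr (σ : ℕ → Exp) (f : ℕ → ℕ) :
    (fun n => up σ (upr f n)) = up (fun n => σ (f n)) := by
  funext n; cases n <;> rfl

theorem subst_ren (f : ℕ → ℕ) (σ : ℕ → Exp) (e : Exp) :
    (e.ren f).subst σ = e.subst (fun n => σ (f n)) := by
  induction e generalizing f σ <;> simp only [ren, subst, up_comp_upr, *]

theorem ren_ren (f g : ℕ → ℕ) (e : Exp) : (e.ren f).ren g = e.ren (fun n => g (f n)) := by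
  rw [ren_eq_subst g, subst_ren, ren_eq_subst]

theorem upr_comp_up (σ : ℕ → Exp) (f : ℕ → ℕ) :
    (fun n => (up σ n).ren (upr f)) = up (fun n => (σ n).ren f) := by
  funext n
  cases n with
  | zero => rfl
  | succ n => simp only [up, scons, wk, ren_ren, upr]

theorem ren_subst (σ : ℕ → Exp) (f : ℕ → ℕ) (e : Exp) :
    (e.subst σ).ren f = e.subst (fun n => (σ n).ren f) := by
  induction e generalizing f σ <;> simp only [ren, subst, upr_comp_up, *]

theorem up_comp (σ τ : ℕ → Exp) : comp (up σ) (up τ) = up (comp σ τ) := by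
  funext n
  cases n with
  | zero => rfl
  | succ n => simp only [comp, up, scons, wk, ren_subst, subst_ren]

@[simp] theorem subst_subst (σ τ : ℕ → Exp) (e : Exp) :
    (e.subst σ).subst τ = e.subst (comp σ τ) := by
  induction e generalizing σ τ <;> simp only [subst, up_comp, *]
  rfl

@[simp] theorem wk_eq (k : ℕ) (e : Exp) : e.wk k = e.subst (shift k) := ren_eq_subst _ e

@[simp] theorem up_eq (σ : ℕ → Exp) : up σ = scons (var 0) (comp σ (shift 1)) := by
  funext n; cases n <;> simp [up, scons]

@[simp] theorem wkUnder_eq (k : ℕ) (e : Exp) : e.wkUnder k = e.subst (up (shift k)) := by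
  rw [wkUnder, ren_eq_subst, ← up_var_comp]; rfl

@[simp] theorem inst_eq (e a : Exp) : e.inst a = e.subst (scons a var) := rfl

@[simp] theorem inst₂_eq (e a b : Exp) : e.inst₂ a b = e.subst (scons b (scons a var)) := rfl

@[simp] theorem instWk_eq (k : ℕ) (e t : Exp) :
    e.instWk k t = e.subst (scons t (shift k)) := rfl

@[simp] theorem comp_scons (a : Exp) (σ τ : ℕ → Exp) :
    comp (scons a σ) τ = scons (a.subst τ) (comp σ τ) := by
  funext n; cases n <;> rfl

@[simp] theorem comp_shift_scons (k : ℕ) (a : Exp) (σ : ℕ → Exp) :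
    comp (shift (k + 1)) (scons a σ) = comp (shift k) σ := rfl

@[simp] theorem shift_zero : shift 0 = var := rfl

@[simp] theorem comp_var_left (σ : ℕ → Exp) : comp var σ = σ := rfl

@[simp] theorem comp_var_right (σ : ℕ → Exp) : comp σ var = σ := by
  funext n; simp

@[simp] theorem comp_assoc (σ τ ρ : ℕ → Exp) : comp (comp σ τ) ρ = comp σ (comp τ ρ) := by
  funext n; simp

@[simp] theorem comp_shift_shift (j k : ℕ) : comp (shift j) (shift k) = shift (j + k) := by
  funext n; simp [Nat.add_assoc]

@[simp] theorem scons_var_shift (k : ℕ) : scons (var k) (shift (k + 1)) = shift k := by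
  funext n; cases n <;> simp [Nat.add_assoc, Nat.add_comm 1]

end Exp

end CC

attribute [simp] MTT.Exp.subst CC.Exp.subst

/-! ### Stability of the impredicative encodings under substitution -/

namespace CC.Exp

attribute [simp] botBody orBody andBody exBody identAt

@[simp] theorem subst_arr (σ : ℕ → Exp) (φ ψ : Exp) :
    (arr φ ψ).subst σ = arr (φ.subst σ) (ψ.subst σ) := by
  simp [arr]

@[simp] theorem subst_arrI (σ : ℕ → Exp) (φ ψ b : Exp) :
    (arrI φ ψ b).subst σ = arrI (φ.subst σ) (ψ.subst σ) (b.subst (up σ)) := by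
  simp [arrI]

@[simp] theorem subst_arrE (σ : ℕ → Exp) (φ ψ f a : Exp) :
    (arrE φ ψ f a).subst σ = arrE (φ.subst σ) (ψ.subst σ) (f.subst σ) (a.subst σ) := by
  simp [arrE]

@[simp] theorem subst_bot (σ : ℕ → Exp) : bot.subst σ = bot := by
  simp [bot]

@[simp] theorem subst_elBot (σ : ℕ → Exp) (ξ a : Exp) :
    (elBot ξ a).subst σ = elBot (ξ.subst σ) (a.subst σ) := by
  simp [elBot]

@[simp] theorem subst_or (σ : ℕ → Exp) (φ ψ : Exp) :
    (or φ ψ).subst σ = or (φ.subst σ) (ψ.subst σ) := by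
  simp [or]

@[simp] theorem subst_orInl (σ : ℕ → Exp) (φ ψ a : Exp) :
    (orInl φ ψ a).subst σ = orInl (φ.subst σ) (ψ.subst σ) (a.subst σ) := by
  simp [orInl]

@[simp] theorem subst_orInr (σ : ℕ → Exp) (φ ψ a : Exp) :
    (orInr φ ψ a).subst σ = orInr (φ.subst σ) (ψ.subst σ) (a.subst σ) := by
  simp [orInr]

@[simp] theorem subst_elOr (σ : ℕ → Exp) (φ ψ ξ w l r : Exp) :
    (elOr φ ψ ξ w l r).subst σ = elOr (φ.subst σ) (ψ.subst σ) (ξ.subst σ) (w.subst σ)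
      (l.subst (up σ)) (r.subst (up σ)) := by
  simp [elOr]

@[simp] theorem subst_and (σ : ℕ → Exp) (φ ψ : Exp) :
    (and φ ψ).subst σ = and (φ.subst σ) (ψ.subst σ) := by
  simp [and]

@[simp] theorem subst_andI (σ : ℕ → Exp) (φ ψ a b : Exp) :
    (andI φ ψ a b).subst σ = andI (φ.subst σ) (ψ.subst σ) (a.subst σ) (b.subst σ) := by
  simp [andI]

@[simp] theorem subst_andL (σ : ℕ → Exp) (φ ψ p : Exp) :
    (andL φ ψ p).subst σ = andL (φ.subst σ) (ψ.subst σ) (p.subst σ) := by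
  simp [andL]

@[simp] theorem subst_andR (σ : ℕ → Exp) (φ ψ p : Exp) :
    (andR φ ψ p).subst σ = andR (φ.subst σ) (ψ.subst σ) (p.subst σ) := by
  simp [andR]

@[simp] theorem subst_ex (σ : ℕ → Exp) (A φ : Exp) :
    (ex A φ).subst σ = ex (A.subst σ) (φ.subst (up σ)) := by
  simp [ex]

@[simp] theorem subst_exI (σ : ℕ → Exp) (A φ a b : Exp) :
    (exI A φ a b).subst σ = exI (A.subst σ) (φ.subst (up σ)) (a.subst σ) (b.subst σ) := by
  simp [exI]

@[simp] theorem subst_elEx (σ : ℕ → Exp) (A φ ξ d m : Exp) :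
    (elEx A φ ξ d m).subst σ = elEx (A.subst σ) (φ.subst (up σ)) (ξ.subst σ) (d.subst σ)
      (m.subst (up (up σ))) := by
  simp [elEx]

@[simp] theorem subst_ident (σ : ℕ → Exp) (A a b : Exp) :
    (ident A a b).subst σ = ident (A.subst σ) (a.subst σ) (b.subst σ) := by
  simp [ident]

@[simp] theorem subst_refl (σ : ℕ → Exp) (A a : Exp) :
    (refl A a).subst σ = refl (A.subst σ) (a.subst σ) := by
  simp [refl]

@[simp] theorem subst_identPred (σ : ℕ → Exp) (A ξ a : Exp) :
    (identPred A ξ a).subst σ =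
      identPred (A.subst σ) (ξ.subst (up (up σ))) (a.subst σ) := by
  simp [identPred]

@[simp] theorem subst_elIdent (σ : ℕ → Exp) (A ξ a b p c : Exp) :
    (elIdent A ξ a b p c).subst σ = elIdent (A.subst σ) (ξ.subst (up (up σ))) (a.subst σ)
      (b.subst σ) (p.subst σ) (c.subst (up σ)) := by
  simp [elIdent]

end CC.Exp

/-! ### The translation into `CC` commutes with substitution -/

namespace MTT.Exp

attribute [simp] enc

/-- The right-hand side is a substitution and not a renaming because the encodings come with lemmas
for `subst` only. -/
theorem enc_ren (f : ℕ → ℕ) (e : Exp) :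
    (e.ren f).enc = e.enc.subst (fun n => CC.Exp.var (f n)) := by
  induction e generalizing f <;>
    simp [ren, *, ← CC.Exp.up_var_comp, -CC.Exp.up_eq]

theorem enc_up (σ : ℕ → Exp) : (fun n => (up σ n).enc) = CC.Exp.up (fun n => (σ n).enc) := by
  funext n
  cases n with
  | zero => rfl
  | succ n => simp only [up, scons_succ, wk, enc_ren, CC.Exp.up, CC.Exp.wk, CC.Exp.ren_eq_subst]

theorem enc_subst_fun (σ : ℕ → Exp) (e : Exp) :
    (e.subst σ).enc = e.enc.subst (fun n => (σ n).enc) := by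
  induction e generalizing σ <;>
    simp [*, enc_up, -CC.Exp.up_eq, -up_eq]

/-- The translation of a substitution. -/
def encSub (σ : ℕ → Exp) (n : ℕ) : CC.Exp := (σ n).enc

@[simp] theorem encSub_apply (σ : ℕ → Exp) (n : ℕ) : encSub σ n = (σ n).enc := rfl

@[simp] theorem enc_subst (σ : ℕ → Exp) (e : Exp) :
    (e.subst σ).enc = e.enc.subst (encSub σ) :=
  enc_subst_fun σ e

@[simp] theorem encSub_scons (a : Exp) (σ : ℕ → Exp) :
    encSub (scons a σ) = scons a.enc (encSub σ) := by
  funext n; cases n <;> rfl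

@[simp] theorem encSub_var : encSub var = CC.Exp.var := rfl

@[simp] theorem encSub_shift (k : ℕ) : encSub (shift k) = CC.Exp.shift k := rfl

@[simp] theorem encSub_comp (σ τ : ℕ → Exp) :
    encSub (comp σ τ) = CC.Exp.comp (encSub σ) (encSub τ) := by
  funext n; simp

end MTT.Exp

/-! ## Structural properties of `CC` -/

namespace CC

open Exp

/-- The rules of `Der`, where the congruence rule for application has the additional premise that
the codomain is a type. This presupposition is admissible. -/
inductive Deriv : Ctx → Jdg → Prop
  | ctxNil : Deriv [] .ctx
  | ctxCons {Γ A} : Deriv Γ (.ty A) → Deriv (A :: Γ) .ctx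
  | var {Γ A} {n : ℕ} : Deriv Γ .ctx → Γ[n]? = some A → Deriv Γ (.tm (var n) (A.wk (n + 1)))
  | sub {Γ Δ J} {σ : ℕ → Exp} : Deriv Γ J → Deriv Δ .ctx →
      (∀ n A, Γ[n]? = some A → Deriv Δ (.tm (σ n) ((A.wk (n + 1)).subst σ))) →
      (∀ n, Γ.length ≤ n → ∃ m, σ n = Exp.var m) →
      Deriv Δ (J.subst σ)
  | subTy {Γ Δ A} {σ τ : ℕ → Exp} : Deriv Γ (.ty A) → Deriv Δ .ctx →
      (∀ n B, Γ[n]? = some B → Deriv Δ (.tm (σ n) ((B.wk (n + 1)).subst σ))) →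
      (∀ n B, Γ[n]? = some B → Deriv Δ (.tm (τ n) ((B.wk (n + 1)).subst τ))) →
      (∀ n B, Γ[n]? = some B → Deriv Δ (.tmEq (σ n) (τ n) ((B.wk (n + 1)).subst σ))) →
      (∀ n, Γ.length ≤ n → ∃ m, σ n = Exp.var m ∧ τ n = Exp.var m) →
      Deriv Δ (.tyEq (A.subst σ) (A.subst τ))
  | subTm {Γ Δ a A} {σ τ : ℕ → Exp} : Deriv Γ (.tm a A) → Deriv Δ .ctx →
      (∀ n B, Γ[n]? = some B → Deriv Δ (.tm (σ n) ((B.wk (n + 1)).subst σ))) →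
      (∀ n B, Γ[n]? = some B → Deriv Δ (.tm (τ n) ((B.wk (n + 1)).subst τ))) →
      (∀ n B, Γ[n]? = some B → Deriv Δ (.tmEq (σ n) (τ n) ((B.wk (n + 1)).subst σ))) →
      (∀ n, Γ.length ≤ n → ∃ m, σ n = Exp.var m ∧ τ n = Exp.var m) →
      Deriv Δ (.tmEq (a.subst σ) (a.subst τ) (A.subst σ))
  | tyRefl {Γ A} : Deriv Γ (.ty A) → Deriv Γ (.tyEq A A)
  | tySymm {Γ A B} : Deriv Γ (.tyEq A B) → Deriv Γ (.tyEq B A)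
  | tyTrans {Γ A B C} : Deriv Γ (.tyEq A B) → Deriv Γ (.tyEq B C) → Deriv Γ (.tyEq A C)
  | tmRefl {Γ a A} : Deriv Γ (.tm a A) → Deriv Γ (.tmEq a a A)
  | tmSymm {Γ a b A} : Deriv Γ (.tmEq a b A) → Deriv Γ (.tmEq b a A)
  | tmTrans {Γ a b c A} : Deriv Γ (.tmEq a b A) → Deriv Γ (.tmEq b c A) → Deriv Γ (.tmEq a c A)
  | conv {Γ a A B} : Deriv Γ (.tm a A) → Deriv Γ (.tyEq A B) → Deriv Γ (.tm a B)
  | convEq {Γ a b A B} : Deriv Γ (.tmEq a b A) → Deriv Γ (.tyEq A B) → Deriv Γ (.tmEq a b B)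
  | propF {Γ} : Deriv Γ .ctx → Deriv Γ (.ty prop)
  | propE {Γ φ} : Deriv Γ (.tm φ prop) → Deriv Γ (.ty φ)
  | propEEq {Γ φ ψ} : Deriv Γ (.tmEq φ ψ prop) → Deriv Γ (.tyEq φ ψ)
  | piF {Γ A B} : Deriv Γ (.ty A) → Deriv (A :: Γ) (.ty B) → Deriv Γ (.ty (pi A B))
  | piCong {Γ A A₁ B B₁} : Deriv Γ (.ty A) → Deriv Γ (.tyEq A A₁) → Deriv (A :: Γ) (.tyEq B B₁) →
      Deriv Γ (.tyEq (pi A B) (pi A₁ B₁))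
  | piProp {Γ A φ} : Deriv Γ (.ty A) → Deriv (A :: Γ) (.tm φ prop) → Deriv Γ (.tm (pi A φ) prop)
  | piPropCong {Γ A A₁ φ φ₁} : Deriv Γ (.ty A) → Deriv Γ (.tyEq A A₁) →
      Deriv (A :: Γ) (.tmEq φ φ₁ prop) → Deriv Γ (.tmEq (pi A φ) (pi A₁ φ₁) prop)
  | piI {Γ A B b} : Deriv Γ (.ty A) → Deriv (A :: Γ) (.ty B) → Deriv (A :: Γ) (.tm b B) →
      Deriv Γ (.tm (lam A B b) (pi A B))
  | lamCong {Γ A A₁ B B₁ b b₁} : Deriv Γ (.ty A) → Deriv (A :: Γ) (.ty B) →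
      Deriv Γ (.tyEq A A₁) → Deriv (A :: Γ) (.tyEq B B₁) → Deriv (A :: Γ) (.tmEq b b₁ B) →
      Deriv Γ (.tmEq (lam A B b) (lam A₁ B₁ b₁) (pi A B))
  | piE {Γ A B f a} : Deriv Γ (.ty A) → Deriv (A :: Γ) (.ty B) → Deriv Γ (.tm f (pi A B)) →
      Deriv Γ (.tm a A) → Deriv Γ (.tm (app A B f a) (B.inst a))
  | appCong {Γ A A₁ B B₁ f f₁ a a₁} : Deriv Γ (.ty A) → Deriv (A :: Γ) (.ty B) →
      Deriv Γ (.tyEq A A₁) → Deriv (A :: Γ) (.tyEq B B₁) → Deriv Γ (.tmEq f f₁ (pi A B)) →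
      Deriv Γ (.tmEq a a₁ A) →
      Deriv Γ (.tmEq (app A B f a) (app A₁ B₁ f₁ a₁) (B.inst a))
  | piC {Γ A B b a} : Deriv Γ (.ty A) → Deriv (A :: Γ) (.ty B) → Deriv (A :: Γ) (.tm b B) →
      Deriv Γ (.tm a A) → Deriv Γ (.tmEq (app A B (lam A B b) a) (b.inst a) (B.inst a))
  | emptyF {Γ} : Deriv Γ .ctx → Deriv Γ (.ty empty)
  | emptyE {Γ C a} : Deriv (empty :: Γ) (.ty C) → Deriv Γ (.tm a empty) →
      Deriv Γ (.tm (elEmpty C a) (C.inst a))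
  | elEmptyCong {Γ C C₁ a a₁} : Deriv (empty :: Γ) (.tyEq C C₁) →
      Deriv Γ (.tmEq a a₁ empty) → Deriv Γ (.tmEq (elEmpty C a) (elEmpty C₁ a₁) (C.inst a))
  | unitF {Γ} : Deriv Γ .ctx → Deriv Γ (.ty unit)
  | unitI {Γ} : Deriv Γ .ctx → Deriv Γ (.tm star unit)
  | unitE {Γ C t c} : Deriv (unit :: Γ) (.ty C) → Deriv Γ (.tm t unit) →
      Deriv Γ (.tm c (C.inst star)) → Deriv Γ (.tm (elUnit C t c) (C.inst t))
  | unitC {Γ C c} : Deriv (unit :: Γ) (.ty C) → Deriv Γ (.tm c (C.inst star)) →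
      Deriv Γ (.tmEq (elUnit C star c) c (C.inst star))
  | elUnitCong {Γ C C₁ t t₁ c c₁} : Deriv (unit :: Γ) (.tyEq C C₁) →
      Deriv Γ (.tmEq t t₁ unit) → Deriv Γ (.tmEq c c₁ (C.inst star)) →
      Deriv Γ (.tmEq (elUnit C t c) (elUnit C₁ t₁ c₁) (C.inst t))
  | sigF {Γ A B} : Deriv Γ (.ty A) → Deriv (A :: Γ) (.ty B) → Deriv Γ (.ty (sig A B))
  | sigCong {Γ A A₁ B B₁} : Deriv Γ (.ty A) → Deriv Γ (.tyEq A A₁) → Deriv (A :: Γ) (.tyEq B B₁) →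
      Deriv Γ (.tyEq (sig A B) (sig A₁ B₁))
  | sigI {Γ A B a b} : Deriv Γ (.ty A) → Deriv (A :: Γ) (.ty B) → Deriv Γ (.tm a A) →
      Deriv Γ (.tm b (B.inst a)) → Deriv Γ (.tm (pair A B a b) (sig A B))
  | pairCong {Γ A A₁ B B₁ a a₁ b b₁} : Deriv Γ (.ty A) → Deriv Γ (.tyEq A A₁) →
      Deriv (A :: Γ) (.tyEq B B₁) → Deriv Γ (.tmEq a a₁ A) → Deriv Γ (.tmEq b b₁ (B.inst a)) →
      Deriv Γ (.tmEq (pair A B a b) (pair A₁ B₁ a₁ b₁) (sig A B))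
  | sigE {Γ A B C d m} : Deriv Γ (.ty A) → Deriv (A :: Γ) (.ty B) →
      Deriv (sig A B :: Γ) (.ty C) → Deriv Γ (.tm d (sig A B)) →
      Deriv (B :: A :: Γ)
        (.tm m (C.instWk 2 (pair (A.wk 2) (B.wkUnder 2) (Exp.var 1) (Exp.var 0)))) →
      Deriv Γ (.tm (elSig A B C d m) (C.inst d))
  | elSigCong {Γ A A₁ B B₁ C C₁ d d₁ m m₁} : Deriv Γ (.ty A) → Deriv (A :: Γ) (.ty B) →
      Deriv Γ (.tyEq A A₁) → Deriv (A :: Γ) (.tyEq B B₁) →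
      Deriv (sig A B :: Γ) (.tyEq C C₁) → Deriv Γ (.tmEq d d₁ (sig A B)) →
      Deriv (B :: A :: Γ)
        (.tmEq m m₁ (C.instWk 2 (pair (A.wk 2) (B.wkUnder 2) (Exp.var 1) (Exp.var 0)))) →
      Deriv Γ (.tmEq (elSig A B C d m) (elSig A₁ B₁ C₁ d₁ m₁) (C.inst d))
  | sigC {Γ A B C a b m} : Deriv Γ (.ty A) → Deriv (A :: Γ) (.ty B) →
      Deriv (sig A B :: Γ) (.ty C) → Deriv Γ (.tm a A) → Deriv Γ (.tm b (B.inst a)) →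
      Deriv (B :: A :: Γ)
        (.tm m (C.instWk 2 (pair (A.wk 2) (B.wkUnder 2) (Exp.var 1) (Exp.var 0)))) →
      Deriv Γ (.tmEq (elSig A B C (pair A B a b) m) (m.inst₂ a b) (C.inst (pair A B a b)))
  | listF {Γ A} : Deriv Γ (.ty A) → Deriv Γ (.ty (list A))
  | listCong {Γ A A₁} : Deriv Γ (.tyEq A A₁) → Deriv Γ (.tyEq (list A) (list A₁))
  | listNil {Γ A} : Deriv Γ (.ty A) → Deriv Γ (.tm (nil A) (list A))
  | nilCong {Γ A A₁} : Deriv Γ (.tyEq A A₁) → Deriv Γ (.tmEq (nil A) (nil A₁) (list A))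
  | listCons {Γ A s c} : Deriv Γ (.ty A) → Deriv Γ (.tm s (list A)) → Deriv Γ (.tm c A) →
      Deriv Γ (.tm (cons A s c) (list A))
  | consCong {Γ A A₁ s s₁ c c₁} : Deriv Γ (.tyEq A A₁) → Deriv Γ (.tmEq s s₁ (list A)) →
      Deriv Γ (.tmEq c c₁ A) → Deriv Γ (.tmEq (cons A s c) (cons A₁ s₁ c₁) (list A))
  | listE {Γ A C s a l} : Deriv Γ (.ty A) → Deriv (list A :: Γ) (.ty C) →
      Deriv Γ (.tm s (list A)) → Deriv Γ (.tm a (C.inst (nil A))) →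
      Deriv (C.instWk 2 (Exp.var 1) :: A.wk 1 :: list A :: Γ)
        (.tm l (C.instWk 3 (cons (A.wk 3) (Exp.var 2) (Exp.var 1)))) →
      Deriv Γ (.tm (elList A C s a l) (C.inst s))
  | elListCong {Γ A A₁ C C₁ s s₁ a a₁ l l₁} : Deriv Γ (.ty A) →
      Deriv (list A :: Γ) (.ty C) → Deriv Γ (.tyEq A A₁) →
      Deriv (list A :: Γ) (.tyEq C C₁) → Deriv Γ (.tmEq s s₁ (list A)) →
      Deriv Γ (.tmEq a a₁ (C.inst (nil A))) →
      Deriv (C.instWk 2 (Exp.var 1) :: A.wk 1 :: list A :: Γ)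
        (.tmEq l l₁ (C.instWk 3 (cons (A.wk 3) (Exp.var 2) (Exp.var 1)))) →
      Deriv Γ (.tmEq (elList A C s a l) (elList A₁ C₁ s₁ a₁ l₁) (C.inst s))
  | listCNil {Γ A C a l} : Deriv Γ (.ty A) → Deriv (list A :: Γ) (.ty C) →
      Deriv Γ (.tm a (C.inst (nil A))) →
      Deriv (C.instWk 2 (Exp.var 1) :: A.wk 1 :: list A :: Γ)
        (.tm l (C.instWk 3 (cons (A.wk 3) (Exp.var 2) (Exp.var 1)))) →
      Deriv Γ (.tmEq (elList A C (nil A) a l) a (C.inst (nil A)))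
  | listCCons {Γ A C s c a l} : Deriv Γ (.ty A) → Deriv (list A :: Γ) (.ty C) →
      Deriv Γ (.tm s (list A)) → Deriv Γ (.tm c A) → Deriv Γ (.tm a (C.inst (nil A))) →
      Deriv (C.instWk 2 (Exp.var 1) :: A.wk 1 :: list A :: Γ)
        (.tm l (C.instWk 3 (cons (A.wk 3) (Exp.var 2) (Exp.var 1)))) →
      Deriv Γ (.tmEq (elList A C (cons A s c) a l)
        (l.subst (scons (elList A C s a l) (scons c (scons s Exp.var))))
        (C.inst (cons A s c)))
  | sumF {Γ A B} : Deriv Γ (.ty A) → Deriv Γ (.ty B) → Deriv Γ (.ty (sum A B))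
  | sumCong {Γ A A₁ B B₁} : Deriv Γ (.tyEq A A₁) → Deriv Γ (.tyEq B B₁) →
      Deriv Γ (.tyEq (sum A B) (sum A₁ B₁))
  | sumInl {Γ A B a} : Deriv Γ (.ty A) → Deriv Γ (.ty B) → Deriv Γ (.tm a A) →
      Deriv Γ (.tm (inl A B a) (sum A B))
  | inlCong {Γ A A₁ B B₁ a a₁} : Deriv Γ (.tyEq A A₁) → Deriv Γ (.tyEq B B₁) →
      Deriv Γ (.tmEq a a₁ A) → Deriv Γ (.tmEq (inl A B a) (inl A₁ B₁ a₁) (sum A B))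
  | sumInr {Γ A B b} : Deriv Γ (.ty A) → Deriv Γ (.ty B) → Deriv Γ (.tm b B) →
      Deriv Γ (.tm (inr A B b) (sum A B))
  | inrCong {Γ A A₁ B B₁ b b₁} : Deriv Γ (.tyEq A A₁) → Deriv Γ (.tyEq B B₁) →
      Deriv Γ (.tmEq b b₁ B) → Deriv Γ (.tmEq (inr A B b) (inr A₁ B₁ b₁) (sum A B))
  | sumE {Γ A B C w l r} : Deriv Γ (.ty A) → Deriv Γ (.ty B) →
      Deriv (sum A B :: Γ) (.ty C) → Deriv Γ (.tm w (sum A B)) →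
      Deriv (A :: Γ) (.tm l (C.instWk 1 (inl (A.wk 1) (B.wk 1) (Exp.var 0)))) →
      Deriv (B :: Γ) (.tm r (C.instWk 1 (inr (A.wk 1) (B.wk 1) (Exp.var 0)))) →
      Deriv Γ (.tm (elSum A B C w l r) (C.inst w))
  | elSumCong {Γ A A₁ B B₁ C C₁ w w₁ l l₁ r r₁} : Deriv Γ (.ty A) → Deriv Γ (.ty B) →
      Deriv Γ (.tyEq A A₁) → Deriv Γ (.tyEq B B₁) →
      Deriv (sum A B :: Γ) (.tyEq C C₁) → Deriv Γ (.tmEq w w₁ (sum A B)) →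
      Deriv (A :: Γ) (.tmEq l l₁ (C.instWk 1 (inl (A.wk 1) (B.wk 1) (Exp.var 0)))) →
      Deriv (B :: Γ) (.tmEq r r₁ (C.instWk 1 (inr (A.wk 1) (B.wk 1) (Exp.var 0)))) →
      Deriv Γ (.tmEq (elSum A B C w l r) (elSum A₁ B₁ C₁ w₁ l₁ r₁) (C.inst w))
  | sumCInl {Γ A B C a l r} : Deriv Γ (.ty A) → Deriv Γ (.ty B) →
      Deriv (sum A B :: Γ) (.ty C) → Deriv Γ (.tm a A) →
      Deriv (A :: Γ) (.tm l (C.instWk 1 (inl (A.wk 1) (B.wk 1) (Exp.var 0)))) →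
      Deriv (B :: Γ) (.tm r (C.instWk 1 (inr (A.wk 1) (B.wk 1) (Exp.var 0)))) →
      Deriv Γ (.tmEq (elSum A B C (inl A B a) l r) (l.inst a) (C.inst (inl A B a)))
  | sumCInr {Γ A B C b l r} : Deriv Γ (.ty A) → Deriv Γ (.ty B) →
      Deriv (sum A B :: Γ) (.ty C) → Deriv Γ (.tm b B) →
      Deriv (A :: Γ) (.tm l (C.instWk 1 (inl (A.wk 1) (B.wk 1) (Exp.var 0)))) →
      Deriv (B :: Γ) (.tm r (C.instWk 1 (inr (A.wk 1) (B.wk 1) (Exp.var 0)))) →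
      Deriv Γ (.tmEq (elSum A B C (inr A B b) l r) (r.inst b) (C.inst (inr A B b)))

attribute [simp] Jdg.subst

theorem Deriv.der {Γ J} (h : Deriv Γ J) : Der Γ J := by
  induction h
  case ctxNil => exact .ctxNil
  case ctxCons => exact .ctxCons ‹_›
  case var => exact .var ‹_› ‹_›
  case sub => exact .sub ‹_› ‹_› ‹_› ‹_›
  case subTy => exact .subTy ‹_› ‹_› ‹_› ‹_› ‹_› ‹_›
  case subTm => exact .subTm ‹_› ‹_› ‹_› ‹_› ‹_› ‹_›
  case tyRefl => exact .tyRefl ‹_›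
  case tySymm => exact .tySymm ‹_›
  case tyTrans => exact .tyTrans ‹_› ‹_›
  case tmRefl => exact .tmRefl ‹_›
  case tmSymm => exact .tmSymm ‹_›
  case tmTrans => exact .tmTrans ‹_› ‹_›
  case conv => exact .conv ‹_› ‹_›
  case convEq => exact .convEq ‹_› ‹_›
  case propF => exact .propF ‹_›
  case propE => exact .propE ‹_›
  case propEEq => exact .propEEq ‹_›
  case piF => exact .piF ‹_› ‹_›
  case piCong => exact .piCong ‹_› ‹_› ‹_›
  case piProp => exact .piProp ‹_› ‹_›
  case piPropCong => exact .piPropCong ‹_› ‹_› ‹_›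
  case piI => exact .piI ‹_› ‹_› ‹_›
  case lamCong => exact .lamCong ‹_› ‹_› ‹_› ‹_› ‹_›
  case piE => exact .piE ‹_› ‹_› ‹_› ‹_›
  case appCong => exact .appCong ‹_› ‹_› ‹_› ‹_› ‹_›
  case piC => exact .piC ‹_› ‹_› ‹_› ‹_›
  case emptyF => exact .emptyF ‹_›
  case emptyE => exact .emptyE ‹_› ‹_›
  case elEmptyCong => exact .elEmptyCong ‹_› ‹_›
  case unitF => exact .unitF ‹_›
  case unitI => exact .unitI ‹_›
  case unitE => exact .unitE ‹_› ‹_› ‹_›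
  case unitC => exact .unitC ‹_› ‹_›
  case elUnitCong => exact .elUnitCong ‹_› ‹_› ‹_›
  case sigF => exact .sigF ‹_› ‹_›
  case sigCong => exact .sigCong ‹_› ‹_› ‹_›
  case sigI => exact .sigI ‹_› ‹_› ‹_› ‹_›
  case pairCong => exact .pairCong ‹_› ‹_› ‹_› ‹_› ‹_›
  case sigE => exact .sigE ‹_› ‹_› ‹_› ‹_› ‹_›
  case elSigCong => exact .elSigCong ‹_› ‹_› ‹_› ‹_› ‹_› ‹_› ‹_›
  case sigC => exact .sigC ‹_› ‹_› ‹_› ‹_› ‹_› ‹_›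
  case listF => exact .listF ‹_›
  case listCong => exact .listCong ‹_›
  case listNil => exact .listNil ‹_›
  case nilCong => exact .nilCong ‹_›
  case listCons => exact .listCons ‹_› ‹_› ‹_›
  case consCong => exact .consCong ‹_› ‹_› ‹_›
  case listE => exact .listE ‹_› ‹_› ‹_› ‹_› ‹_›
  case elListCong => exact .elListCong ‹_› ‹_› ‹_› ‹_› ‹_› ‹_› ‹_›
  case listCNil => exact .listCNil ‹_› ‹_› ‹_› ‹_›
  case listCCons => exact .listCCons ‹_› ‹_› ‹_› ‹_› ‹_› ‹_›
  case sumF => exact .sumF ‹_› ‹_›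
  case sumCong => exact .sumCong ‹_› ‹_›
  case sumInl => exact .sumInl ‹_› ‹_› ‹_›
  case inlCong => exact .inlCong ‹_› ‹_› ‹_›
  case sumInr => exact .sumInr ‹_› ‹_› ‹_›
  case inrCong => exact .inrCong ‹_› ‹_› ‹_›
  case sumE => exact .sumE ‹_› ‹_› ‹_› ‹_› ‹_› ‹_›
  case elSumCong => exact .elSumCong ‹_› ‹_› ‹_› ‹_› ‹_› ‹_› ‹_› ‹_›
  case sumCInl => exact .sumCInl ‹_› ‹_› ‹_› ‹_› ‹_› ‹_›
  case sumCInr => exact .sumCInr ‹_› ‹_› ‹_› ‹_› ‹_› ‹_›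

/-- Typed substitutions. -/
structure Mor (Δ : Ctx) (σ : ℕ → Exp) (Γ : Ctx) : Prop where
  ctx : Deriv Δ .ctx
  typed : ∀ n A, Γ[n]? = some A → Deriv Δ (.tm (σ n) (A.subst (comp (shift (n + 1)) σ)))
  tail : ∀ n, Γ.length ≤ n → ∃ m, σ n = Exp.var m

theorem Deriv.mor {Γ Δ J σ} (h : Deriv Γ J) (m : Mor Δ σ Γ) : Deriv Δ (J.subst σ) :=
  .sub h m.ctx (fun n A hn => by simpa using m.typed n A hn) m.tail

namespace Mor

theorem id {Γ} (h : Deriv Γ .ctx) : Mor Γ Exp.var Γ :=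
  ⟨h, fun n A hn => by simpa using Deriv.var h hn, fun n _ => ⟨n, rfl⟩⟩

theorem shift {Γ A} (h : Deriv (A :: Γ) .ctx) : Mor (A :: Γ) (shift 1) Γ :=
  ⟨h, fun n B hn => by simpa using Deriv.var (n := n + 1) (A := B) h (by simpa using hn),
    fun n _ => ⟨n + 1, rfl⟩⟩

theorem scons {Γ Δ A a σ} (m : Mor Δ σ Γ) (h : Deriv Δ (.tm a (A.subst σ))) :
    Mor Δ (scons a σ) (A :: Γ) where
  ctx := m.ctx
  typed n B hn := by
    cases n with
    | zero => obtain rfl : A = B := by simpa using hn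
              simpa using h
    | succ n => simpa using m.typed n B (by simpa using hn)
  tail n hn := by
    cases n with
    | zero => simp at hn
    | succ n => simpa using m.tail n (by simpa using hn)

theorem comp_shift {Γ Δ B σ} (m : Mor Δ σ Γ) (h : Deriv (B :: Δ) .ctx) :
    Mor (B :: Δ) (comp σ (Exp.shift 1)) Γ where
  ctx := h
  typed n A hn := by simpa using (m.typed n A hn).mor (shift h)
  tail n hn := by obtain ⟨k, hk⟩ := m.tail n hn; exact ⟨k + 1, by simp [hk]⟩

theorem shift_succ {Γ Δ B k} (m : Mor Δ (Exp.shift k) Γ) (h : Deriv (B :: Δ) .ctx) :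
    Mor (B :: Δ) (Exp.shift (k + 1)) Γ := by
  simpa using m.comp_shift h

/-- The new declaration `B` need only be judgementally equal to the substituted type. With the
identity substitution this yields conversion of contexts. -/
theorem up {Γ Δ A B σ} (m : Mor Δ σ Γ) (hB : Deriv Δ (.ty B))
    (e : Deriv Δ (.tyEq B (A.subst σ))) :
    Mor (B :: Δ) (_root_.scons (Exp.var 0) (comp σ (Exp.shift 1))) (A :: Γ) := by
  have h := Deriv.ctxCons hB
  refine (m.comp_shift h).scons (.conv (.var (n := 0) h rfl) ?_)
  simpa using e.mor (shift h)

theorem up_var {Γ Δ A B} (m : Mor Δ Exp.var Γ) (hB : Deriv Δ (.ty B)) (e : Deriv Δ (.tyEq B A)) :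
    Mor (B :: Δ) Exp.var (A :: Γ) := by
  simpa using m.up hB (A := A) (by simpa using e)

theorem inst {Γ A a} (hΓ : Deriv Γ .ctx) (h : Deriv Γ (.tm a A)) :
    Mor Γ (_root_.scons a Exp.var) (A :: Γ) :=
  (id hΓ).scons (by simpa using h)

theorem inst₂ {Γ A B a b} (hΓ : Deriv Γ .ctx) (ha : Deriv Γ (.tm a A))
    (hb : Deriv Γ (.tm b (B.inst a))) :
    Mor Γ (_root_.scons b (_root_.scons a Exp.var)) (B :: A :: Γ) :=
  (inst hΓ ha).scons hb

end Mor

/-- Equal typed substitutions. -/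
structure MorEq (Δ : Ctx) (σ τ : ℕ → Exp) (Γ : Ctx) : Prop where
  left : Mor Δ σ Γ
  right : Mor Δ τ Γ
  eq : ∀ n A, Γ[n]? = some A → Deriv Δ (.tmEq (σ n) (τ n) (A.subst (comp (shift (n + 1)) σ)))
  tail : ∀ n, Γ.length ≤ n → σ n = τ n

namespace MorEq

theorem refl {Γ Δ σ} (m : Mor Δ σ Γ) : MorEq Δ σ σ Γ :=
  ⟨m, m, fun n A hn => .tmRefl (m.typed n A hn), fun _ _ => rfl⟩

theorem scons {Γ Δ A a b σ τ} (m : MorEq Δ σ τ Γ) (ha : Deriv Δ (.tm a (A.subst σ)))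
    (hb : Deriv Δ (.tm b (A.subst τ))) (e : Deriv Δ (.tmEq a b (A.subst σ))) :
    MorEq Δ (scons a σ) (scons b τ) (A :: Γ) where
  left := m.left.scons ha
  right := m.right.scons hb
  eq n B hn := by
    cases n with
    | zero => obtain rfl : A = B := by simpa using hn
              simpa using e
    | succ n => simpa using m.eq n B (by simpa using hn)
  tail n hn := by
    cases n with
    | zero => simp at hn
    | succ n => simpa using m.tail n (by simpa using hn)

theorem tail_var {Γ Δ σ τ} (m : MorEq Δ σ τ Γ) (n : ℕ) (hn : Γ.length ≤ n) :
    ∃ k, σ n = Exp.var k ∧ τ n = Exp.var k := by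
  obtain ⟨k, hk⟩ := m.left.tail n hn
  exact ⟨k, hk, m.tail n hn ▸ hk⟩

theorem ty {Γ Δ A σ τ} (m : MorEq Δ σ τ Γ) (h : Deriv Γ (.ty A)) :
    Deriv Δ (.tyEq (A.subst σ) (A.subst τ)) :=
  .subTy h m.left.ctx (fun n B hn => by simpa using m.left.typed n B hn)
    (fun n B hn => by simpa using m.right.typed n B hn)
    (fun n B hn => by simpa using m.eq n B hn) m.tail_var

theorem tm {Γ Δ a A σ τ} (m : MorEq Δ σ τ Γ) (h : Deriv Γ (.tm a A)) :
    Deriv Δ (.tmEq (a.subst σ) (a.subst τ) (A.subst σ)) :=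
  .subTm h m.left.ctx (fun n B hn => by simpa using m.left.typed n B hn)
    (fun n B hn => by simpa using m.right.typed n B hn)
    (fun n B hn => by simpa using m.eq n B hn) m.tail_var

end MorEq

/-- Two changes in succession: first the equality of families is instantiated at `t`, then `t` is
replaced by `t₁` inside `C₁`. -/
theorem Deriv.tyEq_scons {Γ Δ X C C₁ t t₁ σ} (e : Deriv (X :: Γ) (.tyEq C C₁))
    (hC₁ : Deriv (X :: Γ) (.ty C₁)) (m : Mor Δ σ Γ) (ht : Deriv Δ (.tm t (X.subst σ)))
    (ht₁ : Deriv Δ (.tm t₁ (X.subst σ))) (et : Deriv Δ (.tmEq t t₁ (X.subst σ))) :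
    Deriv Δ (.tyEq (C.subst (scons t σ)) (C₁.subst (scons t₁ σ))) :=
  .tyTrans (e.mor (m.scons ht)) (((MorEq.refl m).scons ht ht₁ et).ty hC₁)

/-- Apart from the rules forming contexts, every rule has a premise over the context of its
conclusion. -/
theorem Deriv.ctx {Γ J} (h : Deriv Γ J) : Deriv Γ .ctx := by
  induction h <;> first | assumption | exact .ctxNil | exact .ctxCons ‹_›

theorem Deriv.head {Γ J A} (h : Deriv (A :: Γ) J) : Deriv Γ (.ty A) := by
  -- The induction needs the context as a free index, so its shape is given by an equation.
  have key : ∀ {Γ J}, Deriv Γ J → ∀ A Γ', Γ = A :: Γ' → Deriv Γ' (.ty A) := by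
    intro Γ J h
    induction h <;> intro A Γ' e
    case ctxNil => cases e
    case ctxCons h _ => cases e; exact h
    all_goals
      subst e
      exact ‹∀ A₁ Γ₁, A :: Γ' = A₁ :: Γ₁ → Deriv Γ₁ (.ty A₁)› _ _ rfl
  exact key h _ _ rfl

theorem Deriv.weak {Γ J A} (h : Deriv Γ J) (hA : Deriv Γ (.ty A)) :
    Deriv (A :: Γ) (J.subst (Exp.shift 1)) :=
  h.mor (.shift (.ctxCons hA))

theorem Deriv.lookup {Γ : Ctx} {A : Exp} {n : ℕ} (h : Deriv Γ .ctx) (hn : Γ[n]? = some A) :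
    Deriv Γ (.ty (A.wk (n + 1))) := by
  induction Γ generalizing n with
  | nil => simp at hn
  | cons B Γ ih =>
    have hB := h.head
    cases n with
    | zero => obtain rfl : B = A := by simpa using hn
              simpa using hB.weak hB
    | succ n => simpa using (ih hB.ctx (n := n) (by simpa using hn)).weak hB

/-! ### Terms and propositions -/

namespace Exp

@[simp] theorem isProp_ren (f : ℕ → ℕ) (e : Exp) : (e.ren f).IsProp = e.IsProp := by
  induction e generalizing f <;> simp [ren, IsProp, *]

theorem isProp_up {σ : ℕ → Exp} (h : ∀ n, (σ n).IsProp = true) (n : ℕ) :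
    (up σ n).IsProp = true := by
  cases n with
  | zero => rfl
  | succ n => simpa only [up, scons_succ, wk, isProp_ren] using h n

/-- The test follows codomains of products down to an expression that is not a product; substitution
can affect the answer only if that expression is a variable, where the answer was already positive.
-/
theorem isProp_subst {σ : ℕ → Exp} (h : ∀ n, (σ n).IsProp = true) (e : Exp) :
    (e.subst σ).IsProp = e.IsProp := by
  induction e generalizing σ with
  | var n => exact h n
  | pi A B _ ih => exact ih (isProp_up h)
  | _ => rfl

theorem isProp_scons {a : Exp} {σ : ℕ → Exp} (ha : a.IsProp = true)
    (h : ∀ n, (σ n).IsProp = true) (n : ℕ) : (scons a σ n).IsProp = true := by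
  cases n with
  | zero => exact ha
  | succ n => exact h n

/-- Values at declared indices are typed terms; at the other indices the substitution rule demands
variables, which pass the test as well. Without that demand nothing would be known about the
undeclared values. -/
theorem isProp_of_lookup {Γ : Ctx} {σ : ℕ → Exp}
    (h : ∀ n A, Γ[n]? = some A → (σ n).IsProp = true)
    (t : ∀ n, Γ.length ≤ n → ∃ m, σ n = Exp.var m) (n : ℕ) : (σ n).IsProp = true := by
  rcases lt_or_ge n Γ.length with hn | hn
  · exact h n _ (List.getElem?_eq_getElem hn)
  · obtain ⟨m, hm⟩ := t n hn
    rw [hm]; rfl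

end Exp

/-- The terms of a judgement are propositions when they are read as types, and equal types are
either both propositions or both not. -/
def Jdg.PropOk : Jdg → Prop
  | tm a _ => a.IsProp = true
  | tmEq a b _ => a.IsProp = true ∧ b.IsProp = true
  | tyEq A B => A.IsProp = B.IsProp
  | _ => True

/-- A product can be a term only when its codomain is one, so it passes the test by induction; the
universe and the inductive types are never terms. Types that are equal as terms of `prop` then both
pass, and the congruence rules for types respect the test. -/
theorem Deriv.propOk {Γ J} (h : Deriv Γ J) : J.PropOk := by
  induction h
  case sub J σ _ _ _ t ih _ ih' =>
    have hσ := isProp_of_lookup ih' t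
    cases J <;> first | trivial | simpa only [Jdg.PropOk, Jdg.subst, isProp_subst hσ] using ih
  case subTy t _ _ ihσ ihτ _ =>
    exact (isProp_subst (isProp_of_lookup ihσ fun n hn => (t n hn).imp fun _ h => h.1) _).trans
      (isProp_subst (isProp_of_lookup ihτ fun n hn => (t n hn).imp fun _ h => h.2) _).symm
  case subTm t ih _ ihσ ihτ _ =>
    exact ⟨(isProp_subst (isProp_of_lookup ihσ fun n hn => (t n hn).imp fun _ h => h.1) _).trans
        ih,
      (isProp_subst (isProp_of_lookup ihτ fun n hn => (t n hn).imp fun _ h => h.2) _).trans ih⟩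
  all_goals simp only [Jdg.PropOk, IsProp, and_self, true_and] at *
  all_goals try trivial
  all_goals try simp_all
  -- What is left comes from the computation rules, whose right-hand sides are instances of a branch
  -- or of a body at terms that pass the test.
  all_goals
    rw [isProp_subst]
    · assumption
    · repeat' apply isProp_scons
      all_goals first | assumption | rfl | (intro; rfl)

theorem Deriv.isProp_tm {Γ a A} (h : Deriv Γ (.tm a A)) : a.IsProp = true := h.propOk

theorem Deriv.isProp_left {Γ a b A} (h : Deriv Γ (.tmEq a b A)) : a.IsProp = true := h.propOk.1

theorem Deriv.isProp_right {Γ a b A} (h : Deriv Γ (.tmEq a b A)) : b.IsProp = true := h.propOk.2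

theorem Deriv.isProp_tyEq {Γ A B} (h : Deriv Γ (.tyEq A B)) : A.IsProp = B.IsProp := h.propOk

end CC

/-! ## Presuppositions of the judgements of `CC` -/

namespace CC

open Exp

@[simp] theorem Jdg.subst_var (J : Jdg) : J.subst Exp.var = J := by
  cases J <;> simp

/-- Equality of types together with its presuppositions. -/
structure TyEq (Γ : Ctx) (A B : Exp) : Prop where
  left : Deriv Γ (.ty A)
  right : Deriv Γ (.ty B)
  eq : Deriv Γ (.tyEq A B)

/-- Equality of terms together with its presuppositions. -/
structure TmEq (Γ : Ctx) (a b A : Exp) : Prop where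
  ty : Deriv Γ (.ty A)
  left : Deriv Γ (.tm a A)
  right : Deriv Γ (.tm b A)
  eq : Deriv Γ (.tmEq a b A)

theorem Mor.up_var' {Γ Δ A B} (m : Mor Δ Exp.var Γ) (e : TyEq Γ A B) :
    Mor (B :: Δ) Exp.var (A :: Γ) :=
  m.up_var (by simpa using e.right.mor m) (by simpa using e.eq.tySymm.mor m)

theorem Mor.up' {Γ Δ A J σ} (m : Mor Δ σ Γ) (h : Deriv (A :: Γ) J) :
    Mor (A.subst σ :: Δ) (Exp.up σ) (A :: Γ) := by
  rw [up_eq]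
  exact m.up (h.head.mor m) (.tyRefl (h.head.mor m))

theorem Deriv.inst {Γ A a J} (h : Deriv (A :: Γ) J) (ha : Deriv Γ (.tm a A)) :
    Deriv Γ (J.subst (scons a Exp.var)) :=
  h.mor (.inst ha.ctx ha)

namespace TyEq

variable {Γ : Ctx} {A A₁ B B₁ : Exp}

theorem refl (h : Deriv Γ (.ty A)) : TyEq Γ A A := ⟨h, h, .tyRefl h⟩

theorem symm (e : TyEq Γ A B) : TyEq Γ B A := ⟨e.right, e.left, e.eq.tySymm⟩

theorem trans {C} (e : TyEq Γ A B) (e' : TyEq Γ B C) : TyEq Γ A C :=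
  ⟨e.left, e'.right, e.eq.tyTrans e'.eq⟩

theorem mor {Δ σ} (e : TyEq Γ A B) (m : Mor Δ σ Γ) : TyEq Δ (A.subst σ) (B.subst σ) :=
  ⟨e.left.mor m, e.right.mor m, e.eq.mor m⟩

/-- The identity substitution is typed between two contexts whose last declarations are equal types.
-/
theorem ctxConv {J} (e : TyEq Γ A B) (h : Deriv (A :: Γ) J) : Deriv (B :: Γ) J := by
  simpa only [Jdg.subst_var] using h.mor ((Mor.id e.left.ctx).up_var' e)

theorem scons {Δ X C C₁ t t₁ σ} (e : TyEq (X :: Γ) C C₁) (m : Mor Δ σ Γ)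
    (et : TmEq Δ t t₁ (X.subst σ)) :
    TyEq Δ (C.subst (scons t σ)) (C₁.subst (_root_.scons t₁ σ)) :=
  ⟨e.left.mor (m.scons et.left), e.right.mor (m.scons et.right),
    e.eq.tyEq_scons e.right m et.left et.right et.eq⟩

theorem inst {X C C₁ t t₁} (e : TyEq (X :: Γ) C C₁) (et : TmEq Γ t t₁ X) :
    TyEq Γ (C.inst t) (C₁.inst t₁) :=
  e.scons (.id et.ty.ctx) (by simpa using et)

theorem pi (eA : TyEq Γ A A₁) (eB : TyEq (A :: Γ) B B₁) : TyEq Γ (pi A B) (pi A₁ B₁) :=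
  ⟨.piF eA.left eB.left, .piF eA.right (eA.ctxConv eB.right), .piCong eA.left eA.eq eB.eq⟩

theorem sig (eA : TyEq Γ A A₁) (eB : TyEq (A :: Γ) B B₁) : TyEq Γ (sig A B) (sig A₁ B₁) :=
  ⟨.sigF eA.left eB.left, .sigF eA.right (eA.ctxConv eB.right), .sigCong eA.left eA.eq eB.eq⟩

theorem list (eA : TyEq Γ A A₁) : TyEq Γ (list A) (list A₁) :=
  ⟨.listF eA.left, .listF eA.right, .listCong eA.eq⟩

theorem sum (eA : TyEq Γ A A₁) (eB : TyEq Γ B B₁) : TyEq Γ (sum A B) (sum A₁ B₁) :=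
  ⟨.sumF eA.left eB.left, .sumF eA.right eB.right, .sumCong eA.eq eB.eq⟩

end TyEq

namespace TmEq

variable {Γ : Ctx} {A A₁ B B₁ C C₁ a a₁ b b₁ : Exp}

theorem refl (hA : Deriv Γ (.ty A)) (h : Deriv Γ (.tm a A)) : TmEq Γ a a A :=
  ⟨hA, h, h, .tmRefl h⟩

theorem symm (e : TmEq Γ a b A) : TmEq Γ b a A := ⟨e.ty, e.right, e.left, e.eq.tmSymm⟩

theorem trans {c} (e : TmEq Γ a b A) (e' : TmEq Γ b c A) : TmEq Γ a c A :=
  ⟨e.ty, e.left, e'.right, e.eq.tmTrans e'.eq⟩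

theorem conv (e : TmEq Γ a b A) (e' : TyEq Γ A B) : TmEq Γ a b B :=
  ⟨e'.right, e.left.conv e'.eq, e.right.conv e'.eq, e.eq.convEq e'.eq⟩

theorem mor {Δ σ} (e : TmEq Γ a b A) (m : Mor Δ σ Γ) :
    TmEq Δ (a.subst σ) (b.subst σ) (A.subst σ) :=
  ⟨e.ty.mor m, e.left.mor m, e.right.mor m, e.eq.mor m⟩

theorem var {n : ℕ} (h : Deriv Γ .ctx) (hn : Γ[n]? = some A) :
    TmEq Γ (.var n) (.var n) (A.wk (n + 1)) :=
  .refl (h.lookup hn) (.var h hn)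

theorem tyEq (e : TmEq Γ a b .prop) : TyEq Γ a b := ⟨e.left.propE, e.right.propE, e.eq.propEEq⟩

theorem pi (eA : TyEq Γ A A₁) (eB : TmEq (A :: Γ) B B₁ .prop) :
    TmEq Γ (pi A B) (pi A₁ B₁) .prop :=
  ⟨.propF eA.left.ctx, .piProp eA.left eB.left, .piProp eA.right (eA.ctxConv eB.right),
    .piPropCong eA.left eA.eq eB.eq⟩

/-- The pattern of the congruence lemmas below: the right-hand expression is typed from its own
annotations, after moving its components to the converted context, and is then brought back to the
left-hand type along the symmetric type equality. -/
theorem lam (eA : TyEq Γ A A₁) (eB : TyEq (A :: Γ) B B₁) (eb : TmEq (A :: Γ) b b₁ B) :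
    TmEq Γ (lam A B b) (lam A₁ B₁ b₁) (.pi A B) :=
  ⟨.piF eA.left eB.left, .piI eA.left eB.left eb.left,
    .conv (.piI eA.right (eA.ctxConv eB.right) (eA.ctxConv (eb.conv eB).right))
      (eA.pi eB).symm.eq,
    .lamCong eA.left eB.left eA.eq eB.eq eb.eq⟩

theorem app {f f₁} (eA : TyEq Γ A A₁) (eB : TyEq (A :: Γ) B B₁) (ef : TmEq Γ f f₁ (.pi A B))
    (ea : TmEq Γ a a₁ A) : TmEq Γ (app A B f a) (app A₁ B₁ f₁ a₁) (B.inst a) :=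
  ⟨(eB.inst ea).left, .piE eA.left eB.left ef.left ea.left,
    .conv (.piE eA.right (eA.ctxConv eB.right) (ef.conv (eA.pi eB)).right (ea.conv eA).right)
      (eB.inst ea).symm.eq,
    .appCong eA.left eB.left eA.eq eB.eq ef.eq ea.eq⟩

theorem elEmpty (eC : TyEq (empty :: Γ) C C₁) (ea : TmEq Γ a a₁ empty) :
    TmEq Γ (elEmpty C a) (elEmpty C₁ a₁) (C.inst a) :=
  ⟨(eC.inst ea).left, .emptyE eC.left ea.left,
    .conv (.emptyE eC.right ea.right) (eC.inst ea).symm.eq, .elEmptyCong eC.eq ea.eq⟩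

theorem elUnit {t t₁ c c₁} (eC : TyEq (unit :: Γ) C C₁) (et : TmEq Γ t t₁ unit)
    (ec : TmEq Γ c c₁ (C.inst star)) :
    TmEq Γ (elUnit C t c) (elUnit C₁ t₁ c₁) (C.inst t) :=
  ⟨(eC.inst et).left, .unitE eC.left et.left ec.left,
    .conv (.unitE eC.right et.right (ec.conv (eC.inst (.refl et.ty (.unitI et.ty.ctx)))).right)
      (eC.inst et).symm.eq,
    .elUnitCong eC.eq et.eq ec.eq⟩

theorem pair (eA : TyEq Γ A A₁) (eB : TyEq (A :: Γ) B B₁) (ea : TmEq Γ a a₁ A)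
    (eb : TmEq Γ b b₁ (B.inst a)) : TmEq Γ (pair A B a b) (pair A₁ B₁ a₁ b₁) (sig A B) :=
  ⟨.sigF eA.left eB.left, .sigI eA.left eB.left ea.left eb.left,
    .conv (.sigI eA.right (eA.ctxConv eB.right) (ea.conv eA).right
      (eb.conv (eB.inst ea)).right) (eA.sig eB).symm.eq,
    .pairCong eA.left eA.eq eB.eq ea.eq eb.eq⟩

theorem nil (eA : TyEq Γ A A₁) : TmEq Γ (nil A) (nil A₁) (list A) :=
  ⟨.listF eA.left, .listNil eA.left, .conv (.listNil eA.right) eA.list.symm.eq, .nilCong eA.eq⟩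

theorem cons {s s₁ c c₁} (eA : TyEq Γ A A₁) (es : TmEq Γ s s₁ (list A))
    (ec : TmEq Γ c c₁ A) : TmEq Γ (cons A s c) (cons A₁ s₁ c₁) (list A) :=
  ⟨es.ty, .listCons eA.left es.left ec.left,
    .conv (.listCons eA.right (es.conv eA.list).right (ec.conv eA).right) eA.list.symm.eq,
    .consCong eA.eq es.eq ec.eq⟩

theorem inl (eA : TyEq Γ A A₁) (eB : TyEq Γ B B₁) (ea : TmEq Γ a a₁ A) :
    TmEq Γ (inl A B a) (inl A₁ B₁ a₁) (sum A B) :=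
  ⟨.sumF eA.left eB.left, .sumInl eA.left eB.left ea.left,
    .conv (.sumInl eA.right eB.right (ea.conv eA).right) (eA.sum eB).symm.eq,
    .inlCong eA.eq eB.eq ea.eq⟩

theorem inr (eA : TyEq Γ A A₁) (eB : TyEq Γ B B₁) (eb : TmEq Γ b b₁ B) :
    TmEq Γ (inr A B b) (inr A₁ B₁ b₁) (sum A B) :=
  ⟨.sumF eA.left eB.left, .sumInr eA.left eB.left eb.left,
    .conv (.sumInr eA.right eB.right (eb.conv eB).right) (eA.sum eB).symm.eq,
    .inrCong eA.eq eB.eq eb.eq⟩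

theorem elSum {w w₁ l l₁ r r₁} (eA : TyEq Γ A A₁) (eB : TyEq Γ B B₁)
    (eC : TyEq (sum A B :: Γ) C C₁) (ew : TmEq Γ w w₁ (sum A B))
    (el : TmEq (A :: Γ) l l₁ (C.instWk 1 (.inl (A.wk 1) (B.wk 1) (.var 0))))
    (er : TmEq (B :: Γ) r r₁ (C.instWk 1 (.inr (A.wk 1) (B.wk 1) (.var 0)))) :
    TmEq Γ (elSum A B C w l r) (elSum A₁ B₁ C₁ w₁ l₁ r₁) (C.inst w) := by
  refine ⟨(eC.inst ew).left, .sumE eA.left eB.left eC.left ew.left el.left er.left,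
    .conv (.sumE eA.right eB.right ((eA.sum eB).ctxConv eC.right) (ew.conv (eA.sum eB)).right
      (eA.ctxConv (el.conv ?_).right) (eB.ctxConv (er.conv ?_).right)) (eC.inst ew).symm.eq,
    .elSumCong eA.left eB.left eA.eq eB.eq eC.eq ew.eq el.eq er.eq⟩
  · have m := Mor.shift (.ctxCons eA.left)
    have := eC.scons m (inl (eA.mor m) (eB.mor m) (by simpa using var m.ctx (n := 0) rfl))
    simpa using this
  · have m := Mor.shift (.ctxCons eB.left)
    have := eC.scons m (inr (eA.mor m) (eB.mor m) (by simpa using var m.ctx (n := 0) rfl))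
    simpa using this

theorem elSig {d d₁ m m₁} (eA : TyEq Γ A A₁) (eB : TyEq (A :: Γ) B B₁)
    (eC : TyEq (sig A B :: Γ) C C₁) (ed : TmEq Γ d d₁ (sig A B))
    (em : TmEq (B :: A :: Γ) m m₁
      (C.instWk 2 (.pair (A.wk 2) (B.wkUnder 2) (.var 1) (.var 0)))) :
    TmEq Γ (elSig A B C d m) (elSig A₁ B₁ C₁ d₁ m₁) (C.inst d) := by
  have m2 := (Mor.shift (.ctxCons eA.left)).shift_succ (.ctxCons eB.left)
  -- The generic pairs built with the two annotations are equal over `B :: A :: Γ`, so the two types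
  -- expected of the branch agree.
  have e := eC.scons m2 (pair (eA.mor m2) (eB.mor (m2.up' eB.left))
    (by simpa using var m2.ctx (n := 1) rfl) (by simpa using var m2.ctx (n := 0) rfl))
  simp only [← wk_eq, ← wkUnder_eq, ← instWk_eq] at e
  refine ⟨(eC.inst ed).left, .sigE eA.left eB.left eC.left ed.left em.left,
    .conv (.sigE eA.right (eA.ctxConv eB.right) ((eA.sig eB).ctxConv eC.right)
      (ed.conv (eA.sig eB)).right ?_) (eC.inst ed).symm.eq,
    .elSigCong eA.left eB.left eA.eq eB.eq eC.eq ed.eq em.eq⟩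
  -- Both declarations of the branch are converted at once, by an identity substitution from `B₁ ::
  -- A₁ :: Γ`.
  simpa using (em.conv e).right.mor (((Mor.id eA.left.ctx).up_var' eA).up_var' eB)

theorem elList {s s₁ l l₁} (eA : TyEq Γ A A₁)
    (eC : TyEq (list A :: Γ) C C₁) (es : TmEq Γ s s₁ (list A))
    (ea : TmEq Γ a a₁ (C.inst (.nil A)))
    (el : TmEq (C.instWk 2 (.var 1) :: A.wk 1 :: list A :: Γ) l l₁
      (C.instWk 3 (.cons (A.wk 3) (.var 2) (.var 1)))) :
    TmEq Γ (elList A C s a l) (elList A₁ C₁ s₁ a₁ l₁) (C.inst s) := by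
  have m1 := Mor.shift (.ctxCons eA.list.left)
  have m2 := m1.shift_succ (.ctxCons (eA.mor m1).left)
  have e2 := eC.scons m2 (t := .var 1) (by simpa using var m2.ctx (n := 1) rfl)
  have m3 := m2.shift_succ (.ctxCons e2.left)
  have e := eC.scons m3 (cons (eA.mor m3) (by simpa using var m3.ctx (n := 2) rfl)
    (by simpa using var m3.ctx (n := 1) rfl))
  -- The identity substitution across three converted declarations: the list, the element, and the
  -- value at the list, whose type changes by `e2`.
  have mv := (((Mor.id eA.left.ctx).up_var' eA.list).up_var' (eA.mor m1)).up_var' e2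
  refine ⟨(eC.inst es).left, .listE eA.left eC.left es.left ea.left el.left,
    .conv (.listE eA.right (eA.list.ctxConv eC.right) (es.conv eA.list).right
      (ea.conv (eC.inst (.nil eA))).right ?_) (eC.inst es).symm.eq,
    .elListCong eA.left eC.left eA.eq eC.eq es.eq ea.eq el.eq⟩
  simp only [wk_eq, instWk_eq, Nat.reduceAdd] at el e mv ⊢
  simpa using (el.conv e).right.mor mv

end TmEq

/-- The presuppositions of a judgement. -/
def Jdg.Presup (Γ : Ctx) : Jdg → Prop
  | tyEq A B => TyEq Γ A B
  | tm _ A => Deriv Γ (.ty A)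
  | tmEq a b A => TmEq Γ a b A
  | _ => True

/-- The congruence rules are handled by the lemmas on `TyEq` and `TmEq`. For a computation rule the
redex is typed by the eliminator and the reduct by the substitution rule. -/
theorem Deriv.presup {Γ J} (h : Deriv Γ J) : J.Presup Γ := by
  induction h
  case var h hn _ => exact h.lookup hn
  case sub J σ _ hΔ hσ t ih _ _ =>
    have m : Mor _ σ _ := ⟨hΔ, fun n A hn => by simpa using hσ n A hn, t⟩
    cases J with
    | tyEq A B => exact TyEq.mor ih m
    | tm a A => exact Deriv.mor ih m
    | tmEq a b A => exact TmEq.mor ih m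
    | _ => trivial
  case subTy h hΔ hσ hτ e t _ _ _ _ _ =>
    exact ⟨.sub h hΔ hσ fun n hn => (t n hn).imp fun _ h => h.1,
      .sub h hΔ hτ fun n hn => (t n hn).imp fun _ h => h.2, .subTy h hΔ hσ hτ e t⟩
  case subTm h hΔ hσ hτ e t ih _ _ _ _ =>
    exact ⟨.sub ih hΔ hσ fun n hn => (t n hn).imp fun _ h => h.1,
      .sub h hΔ hσ fun n hn => (t n hn).imp fun _ h => h.1,
      .conv (.sub h hΔ hτ fun n hn => (t n hn).imp fun _ h => h.2)
        (.tySymm (.subTy ih hΔ hσ hτ e t)), .subTm h hΔ hσ hτ e t⟩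
  case tyRefl h _ => exact .refl h
  case tySymm ih => exact TyEq.symm ih
  case tyTrans ih ih' => exact TyEq.trans ih ih'
  case tmRefl h ih => exact .refl ih h
  case tmSymm ih => exact TmEq.symm ih
  case tmTrans ih ih' => exact TmEq.trans ih ih'
  case conv ih => exact TyEq.right ih
  case convEq ih ih' => exact TmEq.conv ih ih'
  case propEEq ih => exact TmEq.tyEq ih
  case piCong ih ih' => exact TyEq.pi ih ih'
  case piProp h _ _ _ => exact .propF h.ctx
  case piPropCong ih ih' => exact TmEq.pi ih ih'
  case piI hA hB _ _ _ _ => exact .piF hA hB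
  case lamCong ih ih' ih'' => exact TmEq.lam ih ih' ih''
  case piE hB _ ha _ _ _ _ => exact hB.inst ha
  case appCong ih ih' ih₂ ih₃ => exact TmEq.app ih ih' ih₂ ih₃
  case piC hA hB hb ha _ _ _ _ =>
    exact ⟨hB.inst ha, .piE hA hB (.piI hA hB hb) ha, hb.inst ha, .piC hA hB hb ha⟩
  case emptyE hC ha _ _ => exact hC.inst ha
  case elEmptyCong ih ih' => exact TmEq.elEmpty ih ih'
  case unitI h _ => exact .unitF h
  case unitE hC ht _ _ _ _ => exact hC.inst ht
  case unitC hC hc _ ih => exact ⟨ih, .unitE hC (.unitI hc.ctx) hc, hc, .unitC hC hc⟩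
  case elUnitCong ih ih' ih₂ => exact TmEq.elUnit ih ih' ih₂
  case sigCong ih ih' => exact TyEq.sig ih ih'
  case sigI hA hB _ _ _ _ _ _ => exact .sigF hA hB
  case pairCong ih ih' ih₂ ih₃ => exact TmEq.pair ih ih' ih₂ ih₃
  case sigE hC hd _ _ _ _ _ _ => exact hC.inst hd
  case elSigCong ih₁ ih₂ ih₃ ih₄ ih₅ => exact TmEq.elSig ih₁ ih₂ ih₃ ih₄ ih₅
  case sigC hA hB hC ha hb hm _ _ _ _ _ _ =>
    have hp := Deriv.sigI hA hB ha hb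
    exact ⟨hC.inst hp, .sigE hA hB hC hp hm, by simpa using hm.mor (.inst₂ ha.ctx ha hb),
      .sigC hA hB hC ha hb hm⟩
  case listCong ih => exact TyEq.list ih
  case listNil h _ => exact .listF h
  case nilCong ih => exact TmEq.nil ih
  case listCons h _ _ _ _ _ => exact .listF h
  case consCong ih ih' ih'' => exact TmEq.cons ih ih' ih''
  case listE hC hs _ _ _ _ _ _ _ => exact hC.inst hs
  case elListCong ih₁ ih₂ ih₃ ih₄ ih₅ => exact TmEq.elList ih₁ ih₂ ih₃ ih₄ ih₅
  case listCNil hA hC ha hl _ _ ih _ =>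
    exact ⟨ih, .listE hA hC (.listNil hA) ha hl, ha, .listCNil hA hC ha hl⟩
  case listCCons A C s c a l hA hC hs hc ha hl _ _ _ _ _ _ =>
    have h := Deriv.listCons hA hs hc
    -- The step branch is instantiated at the list, the element and the recursive value; the last is
    -- typed by the eliminator at the shorter list.
    have m := ((Mor.inst hs.ctx hs).scons (A := A.wk 1) (by simpa using hc)).scons
      (A := C.instWk 2 (.var 1)) (by simpa using Deriv.listE hA hC hs ha hl)
    exact ⟨hC.inst h, .listE hA hC h ha hl, by simpa using hl.mor m,
      .listCCons hA hC hs hc ha hl⟩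
  case sumCong ih ih' => exact TyEq.sum ih ih'
  case sumInl hA hB _ _ _ _ => exact .sumF hA hB
  case inlCong ih ih' ih'' => exact TmEq.inl ih ih' ih''
  case sumInr hA hB _ _ _ _ => exact .sumF hA hB
  case inrCong ih ih' ih'' => exact TmEq.inr ih ih' ih''
  case sumE hC hw _ _ _ _ _ _ _ _ => exact hC.inst hw
  case elSumCong ih₁ ih₂ ih₃ ih₄ ih₅ ih₆ => exact TmEq.elSum ih₁ ih₂ ih₃ ih₄ ih₅ ih₆
  case sumCInl hA hB hC ha hl hr _ _ _ _ _ _ =>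
    have h := Deriv.sumInl hA hB ha
    exact ⟨hC.inst h, .sumE hA hB hC h hl hr, by simpa using hl.inst ha,
      .sumCInl hA hB hC ha hl hr⟩
  case sumCInr hA hB hC ha hl hr _ _ _ _ _ _ =>
    have h := Deriv.sumInr hA hB ha
    exact ⟨hC.inst h, .sumE hA hB hC h hl hr, by simpa using hr.inst ha,
      .sumCInr hA hB hC ha hl hr⟩
  all_goals trivial

theorem Deriv.tyEq' {Γ A B} (h : Deriv Γ (.tyEq A B)) : TyEq Γ A B := h.presup

theorem Deriv.tmEq' {Γ a b A} (h : Deriv Γ (.tmEq a b A)) : TmEq Γ a b A := h.presup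

theorem Deriv.ty_of_tm {Γ a A} (h : Deriv Γ (.tm a A)) : Deriv Γ (.ty A) := h.presup

/-- Only the congruence rule for application asks for more in `Deriv`, and its premise is the left
presupposition of the equality of codomains. Having it as a premise gives an induction hypothesis
for it, which the translation into `MTT` needs. -/
theorem Der.deriv {Γ J} (h : Der Γ J) : Deriv Γ J := by
  induction h
  case ctxNil => exact .ctxNil
  case ctxCons => exact .ctxCons ‹_›
  case var => exact .var ‹_› ‹_›
  case tyRefl => exact .tyRefl ‹_›
  case tySymm => exact .tySymm ‹_›
  case tyTrans => exact .tyTrans ‹_› ‹_›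
  case tmRefl => exact .tmRefl ‹_›
  case tmSymm => exact .tmSymm ‹_›
  case tmTrans => exact .tmTrans ‹_› ‹_›
  case conv => exact .conv ‹_› ‹_›
  case convEq => exact .convEq ‹_› ‹_›
  case propF => exact .propF ‹_›
  case propE => exact .propE ‹_›
  case propEEq => exact .propEEq ‹_›
  case piF => exact .piF ‹_› ‹_›
  case piCong => exact .piCong ‹_› ‹_› ‹_›
  case piProp => exact .piProp ‹_› ‹_›
  case piPropCong => exact .piPropCong ‹_› ‹_› ‹_›
  case piI => exact .piI ‹_› ‹_› ‹_›
  case lamCong => exact .lamCong ‹_› ‹_› ‹_› ‹_› ‹_›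
  case piE => exact .piE ‹_› ‹_› ‹_› ‹_›
  case piC => exact .piC ‹_› ‹_› ‹_› ‹_›
  case emptyF => exact .emptyF ‹_›
  case emptyE => exact .emptyE ‹_› ‹_›
  case elEmptyCong => exact .elEmptyCong ‹_› ‹_›
  case unitF => exact .unitF ‹_›
  case unitI => exact .unitI ‹_›
  case unitE => exact .unitE ‹_› ‹_› ‹_›
  case unitC => exact .unitC ‹_› ‹_›
  case elUnitCong => exact .elUnitCong ‹_› ‹_› ‹_›
  case sigF => exact .sigF ‹_› ‹_›
  case sigCong => exact .sigCong ‹_› ‹_› ‹_›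
  case sigI => exact .sigI ‹_› ‹_› ‹_› ‹_›
  case pairCong => exact .pairCong ‹_› ‹_› ‹_› ‹_› ‹_›
  case sigE => exact .sigE ‹_› ‹_› ‹_› ‹_› ‹_›
  case elSigCong => exact .elSigCong ‹_› ‹_› ‹_› ‹_› ‹_› ‹_› ‹_›
  case sigC => exact .sigC ‹_› ‹_› ‹_› ‹_› ‹_› ‹_›
  case listF => exact .listF ‹_›
  case listCong => exact .listCong ‹_›
  case listNil => exact .listNil ‹_›
  case nilCong => exact .nilCong ‹_›
  case listCons => exact .listCons ‹_› ‹_› ‹_›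
  case consCong => exact .consCong ‹_› ‹_› ‹_›
  case listE => exact .listE ‹_› ‹_› ‹_› ‹_› ‹_›
  case elListCong => exact .elListCong ‹_› ‹_› ‹_› ‹_› ‹_› ‹_› ‹_›
  case listCNil => exact .listCNil ‹_› ‹_› ‹_› ‹_›
  case listCCons => exact .listCCons ‹_› ‹_› ‹_› ‹_› ‹_› ‹_›
  case sumF => exact .sumF ‹_› ‹_›
  case sumCong => exact .sumCong ‹_› ‹_›
  case sumInl => exact .sumInl ‹_› ‹_› ‹_›
  case inlCong => exact .inlCong ‹_› ‹_› ‹_›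
  case sumInr => exact .sumInr ‹_› ‹_› ‹_›
  case inrCong => exact .inrCong ‹_› ‹_› ‹_›
  case sumE => exact .sumE ‹_› ‹_› ‹_› ‹_› ‹_› ‹_›
  case elSumCong => exact .elSumCong ‹_› ‹_› ‹_› ‹_› ‹_› ‹_› ‹_› ‹_›
  case sumCInl => exact .sumCInl ‹_› ‹_› ‹_› ‹_› ‹_› ‹_›
  case sumCInr => exact .sumCInr ‹_› ‹_› ‹_› ‹_› ‹_› ‹_›
  case sub => exact .sub ‹_› ‹_› ‹_› ‹_›
  case subTy => exact .subTy ‹_› ‹_› ‹_› ‹_› ‹_› ‹_›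
  case subTm => exact .subTm ‹_› ‹_› ‹_› ‹_› ‹_› ‹_›
  -- The typing of the left codomain is extracted from the equality of codomains.
  case appCong => exact .appCong ‹_› (Deriv.tyEq' ‹_›).left ‹_› ‹_› ‹_› ‹_›

end CC

/-! ## The impredicative encodings in `CC` -/

namespace CC

open Exp

theorem TyEq.prop {Γ} (h : Deriv Γ .ctx) : TyEq Γ .prop .prop := .refl (.propF h)

theorem TyEq.weak {Γ A B C} (e : TyEq Γ A B) (h : Deriv Γ (.ty C)) :
    TyEq (C :: Γ) (A.subst (shift 1)) (B.subst (shift 1)) :=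
  e.mor (.shift (.ctxCons h))

theorem TyEq.arr {Γ A A₁ B B₁} (eA : TyEq Γ A A₁) (eB : TyEq Γ B B₁) :
    TyEq Γ (.arr A B) (.arr A₁ B₁) := by
  simpa [Exp.arr] using eA.pi (eB.weak eA.left)

namespace TmEq

variable {Γ : Ctx} {A A₁ B B₁ φ φ₁ ψ ψ₁ ξ ξ₁ a a₁ b b₁ : Exp}

theorem ctx (e : TmEq Γ a b A) : Deriv Γ .ctx := e.ty.ctx

theorem weak (e : TmEq Γ a b A) (h : Deriv Γ (.ty B)) :
    TmEq (B :: Γ) (a.subst (shift 1)) (b.subst (shift 1)) (A.subst (shift 1)) :=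
  e.mor (.shift (.ctxCons h))

/-- The equality is transported along `σ`, and then `σ` is replaced by `τ` in the right-hand term;
the latter is typed over `τ` and must be converted back. -/
theorem morEq {Δ σ τ} (e : TmEq Γ a b A) (m : MorEq Δ σ τ Γ) :
    TmEq Δ (a.subst σ) (b.subst τ) (A.subst σ) :=
  ⟨e.ty.mor m.left, e.left.mor m.left, .conv (e.right.mor m.right) (m.ty e.ty).tySymm,
    (e.eq.mor m.left).tmTrans (m.tm e.right)⟩

theorem var_zero (h : Deriv Γ (.ty A)) : TmEq (A :: Γ) (.var 0) (.var 0) (A.subst (shift 1)) := by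
  simpa using TmEq.var (.ctxCons h) (n := 0) rfl

theorem var_one (hB : Deriv (A :: Γ) (.ty B)) :
    TmEq (B :: A :: Γ) (.var 1) (.var 1) (A.subst (shift 2)) := by
  simpa using TmEq.var (.ctxCons hB) (n := 1) rfl

theorem prop_zero (h : Deriv Γ .ctx) : TmEq (.prop :: Γ) (.var 0) (.var 0) .prop :=
  var_zero (.propF h)

/-- As for all the encodings below, two equal families of arguments are allowed: the diagonal is the
typing rule and the general case is the congruence rule. -/
theorem arr (eA : TyEq Γ A A₁) (eψ : TmEq Γ ψ ψ₁ .prop) :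
    TmEq Γ (.arr A ψ) (.arr A₁ ψ₁) .prop := by
  simpa [Exp.arr] using TmEq.pi eA (eψ.weak eA.left)

theorem arrI (eA : TyEq Γ A A₁) (eB : TyEq Γ B B₁)
    (eb : TmEq (A :: Γ) b b₁ (B.subst (shift 1))) :
    TmEq Γ (.arrI A B b) (.arrI A₁ B₁ b₁) (.arr A B) := by
  simpa [Exp.arr, Exp.arrI] using TmEq.lam eA (eB.weak eA.left) eb

theorem arrE {f f₁} (eA : TyEq Γ A A₁) (eB : TyEq Γ B B₁) (ef : TmEq Γ f f₁ (.arr A B))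
    (ea : TmEq Γ a a₁ A) : TmEq Γ (.arrE A B f a) (.arrE A₁ B₁ f₁ a₁) B := by
  simpa [Exp.arrE] using TmEq.app eA (eB.weak eA.left) (by simpa [Exp.arr] using ef) ea

theorem pi_beta (hA : Deriv Γ (.ty A)) (hb : Deriv (A :: Γ) (.tm b B)) (ha : Deriv Γ (.tm a A)) :
    TmEq Γ (.app A B (.lam A B b) a) (b.inst a) (B.inst a) :=
  (Deriv.piC hA hb.ty_of_tm hb ha).tmEq'

theorem arr_beta (hA : Deriv Γ (.ty A)) (hb : Deriv (A :: Γ) (.tm b (B.subst (shift 1))))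
    (ha : Deriv Γ (.tm a A)) : TmEq Γ (.arrE A B (.arrI A B b) a) (b.subst (scons a .var)) B := by
  simpa [Exp.arrE, Exp.arrI] using pi_beta hA hb ha

/-! ### Falsum -/

theorem bot (h : Deriv Γ .ctx) : TmEq Γ .bot .bot .prop :=
  .pi (.prop h) (prop_zero h)

theorem elBot (eξ : TmEq Γ ξ ξ₁ .prop) (ea : TmEq Γ a a₁ .bot) :
    TmEq Γ (.elBot ξ a) (.elBot ξ₁ a₁) ξ :=
  .app (.prop eξ.ctx) (prop_zero eξ.ctx).tyEq ea eξ

/-! ### Disjunction -/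

theorem orBody (eφ : TmEq Γ φ φ₁ .prop) (eψ : TmEq Γ ψ ψ₁ .prop) :
    TmEq (.prop :: Γ) (.orBody φ ψ) (.orBody φ₁ ψ₁) .prop := by
  have h := eφ.ty
  have v := prop_zero eφ.ctx
  simpa using TmEq.arr (.arr (eφ.weak h).tyEq v.tyEq) (.arr (.arr (eψ.weak h).tyEq v.tyEq) v)

theorem or (eφ : TmEq Γ φ φ₁ .prop) (eψ : TmEq Γ ψ ψ₁ .prop) :
    TmEq Γ (.or φ ψ) (.or φ₁ ψ₁) .prop :=
  .pi (.prop eφ.ctx) (orBody eφ eψ)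

theorem orInlBody (eφ : TmEq Γ φ φ₁ .prop) (eψ : TmEq Γ ψ ψ₁ .prop) (eξ : TmEq Γ ξ ξ₁ .prop)
    (ea : TmEq Γ a a₁ φ) :
    TmEq (.arr (ψ.subst (shift 1)) (ξ.subst (shift 1)) :: .arr φ ξ :: Γ)
      (.arrE (φ.subst (shift 2)) (ξ.subst (shift 2)) (.var 1) (a.subst (shift 2)))
      (.arrE (φ₁.subst (shift 2)) (ξ₁.subst (shift 2)) (.var 1) (a₁.subst (shift 2)))
      (ξ.subst (shift 2)) := by
  have f := (TyEq.arr eφ.tyEq eξ.tyEq).left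
  have g := (TyEq.arr (eψ.tyEq.weak f) (eξ.tyEq.weak f)).left
  have m := (Mor.shift (.ctxCons f)).shift_succ (.ctxCons g)
  exact .arrE (eφ.tyEq.mor m) (eξ.tyEq.mor m) (by simpa using var_one g) (ea.mor m)

theorem orInrBody (eφ : TmEq Γ φ φ₁ .prop) (eψ : TmEq Γ ψ ψ₁ .prop) (eξ : TmEq Γ ξ ξ₁ .prop)
    (eb : TmEq Γ b b₁ ψ) :
    TmEq (.arr (ψ.subst (shift 1)) (ξ.subst (shift 1)) :: .arr φ ξ :: Γ)
      (.arrE (ψ.subst (shift 2)) (ξ.subst (shift 2)) (.var 0) (b.subst (shift 2)))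
      (.arrE (ψ₁.subst (shift 2)) (ξ₁.subst (shift 2)) (.var 0) (b₁.subst (shift 2)))
      (ξ.subst (shift 2)) := by
  have f := (TyEq.arr eφ.tyEq eξ.tyEq).left
  have g := (TyEq.arr (eψ.tyEq.weak f) (eξ.tyEq.weak f)).left
  have m := (Mor.shift (.ctxCons f)).shift_succ (.ctxCons g)
  exact .arrE (eψ.tyEq.mor m) (eξ.tyEq.mor m) (by simpa using var_zero g) (eb.mor m)

/-- The target `ξ` is arbitrary because the lemma serves twice: under the binder of `p`, with `ξ`
the variable, and after `p` has been instantiated, in the computation rule. -/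
theorem orFun {t t₁} (eφ : TmEq Γ φ φ₁ .prop) (eψ : TmEq Γ ψ ψ₁ .prop)
    (eξ : TmEq Γ ξ ξ₁ .prop)
    (et : TmEq (.arr (ψ.subst (shift 1)) (ξ.subst (shift 1)) :: .arr φ ξ :: Γ) t t₁
      (ξ.subst (shift 2))) :
    TmEq (.arr φ ξ :: Γ)
      (.arrI (.arr (ψ.subst (shift 1)) (ξ.subst (shift 1))) (ξ.subst (shift 1)) t)
      (.arrI (.arr (ψ₁.subst (shift 1)) (ξ₁.subst (shift 1))) (ξ₁.subst (shift 1)) t₁)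
      (.arr (.arr (ψ.subst (shift 1)) (ξ.subst (shift 1))) (ξ.subst (shift 1))) := by
  have f := (TyEq.arr eφ.tyEq eξ.tyEq).left
  simpa using TmEq.arrI (.arr (eψ.tyEq.weak f) (eξ.tyEq.weak f)) (eξ.tyEq.weak f)
    (by simpa using et)

/-- The innermost body `t` is left open, so that both injections share these abstractions. Its
context lists, from the last variable, the two continuations and then `p`. -/
theorem orAbs {t t₁} (eφ : TmEq Γ φ φ₁ .prop) (eψ : TmEq Γ ψ ψ₁ .prop)
    (et : TmEq (.arr (ψ.subst (shift 2)) (.var 1) :: .arr (φ.subst (shift 1)) (.var 0) ::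
      .prop :: Γ) t t₁ (.var 2)) :
    TmEq (.prop :: Γ)
      (.arrI (.arr (φ.wk 1) (.var 0)) (.arr (.arr (ψ.wk 1) (.var 0)) (.var 0))
        (.arrI (.arr (ψ.wk 2) (.var 1)) (.var 1) t))
      (.arrI (.arr (φ₁.wk 1) (.var 0)) (.arr (.arr (ψ₁.wk 1) (.var 0)) (.var 0))
        (.arrI (.arr (ψ₁.wk 2) (.var 1)) (.var 1) t₁)) (.orBody φ ψ) := by
  have h := eφ.ty
  have v := prop_zero eφ.ctx
  have eφ' := eφ.weak h
  have eψ' := eψ.weak h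
  have e := orFun eφ' eψ' v (by simpa using et)
  simpa using TmEq.arrI (.arr eφ'.tyEq v.tyEq) (.arr (.arr eψ'.tyEq v.tyEq) v.tyEq) e

theorem orInlAbs (eφ : TmEq Γ φ φ₁ .prop) (eψ : TmEq Γ ψ ψ₁ .prop) (ea : TmEq Γ a a₁ φ) :
    TmEq (.arr (ψ.subst (shift 2)) (.var 1) :: .arr (φ.subst (shift 1)) (.var 0) ::
      .prop :: Γ) (.arrE (φ.wk 3) (.var 2) (.var 1) (a.wk 3))
      (.arrE (φ₁.wk 3) (.var 2) (.var 1) (a₁.wk 3)) (.var 2) := by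
  have h := eφ.ty
  simpa using orInlBody (eφ.weak h) (eψ.weak h) (prop_zero eφ.ctx) (ea.weak h)

theorem orInrAbs (eφ : TmEq Γ φ φ₁ .prop) (eψ : TmEq Γ ψ ψ₁ .prop) (eb : TmEq Γ b b₁ ψ) :
    TmEq (.arr (ψ.subst (shift 2)) (.var 1) :: .arr (φ.subst (shift 1)) (.var 0) ::
      .prop :: Γ) (.arrE (ψ.wk 3) (.var 2) (.var 0) (b.wk 3))
      (.arrE (ψ₁.wk 3) (.var 2) (.var 0) (b₁.wk 3)) (.var 2) := by
  have h := eφ.ty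
  simpa using orInrBody (eφ.weak h) (eψ.weak h) (prop_zero eφ.ctx) (eb.weak h)

theorem orInl (eφ : TmEq Γ φ φ₁ .prop) (eψ : TmEq Γ ψ ψ₁ .prop) (ea : TmEq Γ a a₁ φ) :
    TmEq Γ (.orInl φ ψ a) (.orInl φ₁ ψ₁ a₁) (.or φ ψ) :=
  .lam (.prop eφ.ctx) (orBody eφ eψ).tyEq (orAbs eφ eψ (orInlAbs eφ eψ ea))

theorem orInr (eφ : TmEq Γ φ φ₁ .prop) (eψ : TmEq Γ ψ ψ₁ .prop) (eb : TmEq Γ b b₁ ψ) :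
    TmEq Γ (.orInr φ ψ b) (.orInr φ₁ ψ₁ b₁) (.or φ ψ) :=
  .lam (.prop eφ.ctx) (orBody eφ eψ).tyEq (orAbs eφ eψ (orInrAbs eφ eψ eb))

theorem elOr {w w₁ l l₁ r r₁} (eφ : TmEq Γ φ φ₁ .prop) (eψ : TmEq Γ ψ ψ₁ .prop)
    (eξ : TmEq Γ ξ ξ₁ .prop) (ew : TmEq Γ w w₁ (.or φ ψ)) (el : TmEq (φ :: Γ) l l₁ (ξ.wk 1))
    (er : TmEq (ψ :: Γ) r r₁ (ξ.wk 1)) :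
    TmEq Γ (.elOr φ ψ ξ w l r) (.elOr φ₁ ψ₁ ξ₁ w₁ l₁ r₁) ξ := by
  have tl := TyEq.arr eφ.tyEq eξ.tyEq
  have tr := TyEq.arr eψ.tyEq eξ.tyEq
  refine .arrE tr eξ.tyEq (.arrE tl (.arr tr eξ.tyEq) ?_
    (.arrI eφ.tyEq eξ.tyEq (by simpa using el)))
    (.arrI eψ.tyEq eξ.tyEq (by simpa using er))
  simpa using TmEq.app (.prop eφ.ctx) (orBody eφ eψ).tyEq ew eξ

/-- Three β-steps: `p` becomes `ξ`, then the two continuations become the abstracted branches. For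
each injection one further β-step applies the selected branch. -/
theorem elOr_beta {l r t} (eφ : TmEq Γ φ φ .prop) (eψ : TmEq Γ ψ ψ .prop)
    (eξ : TmEq Γ ξ ξ .prop) (hl : Deriv (φ :: Γ) (.tm l (ξ.wk 1)))
    (hr : Deriv (ψ :: Γ) (.tm r (ξ.wk 1)))
    (et : TmEq (.arr (ψ.subst (shift 2)) (.var 1) :: .arr (φ.subst (shift 1)) (.var 0) ::
      .prop :: Γ) t t (.var 2)) :
    TmEq Γ (.elOr φ ψ ξ (.lam .prop (.orBody φ ψ)
        (.arrI (.arr (φ.wk 1) (.var 0)) (.arr (.arr (ψ.wk 1) (.var 0)) (.var 0))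
          (.arrI (.arr (ψ.wk 2) (.var 1)) (.var 1) t))) l r)
      (t.subst (scons (.arrI ψ ξ r) (scons (.arrI φ ξ l) (scons ξ .var)))) ξ := by
  have tl := TyEq.arr eφ.tyEq eξ.tyEq
  have tr := TyEq.arr eψ.tyEq eξ.tyEq
  have fl := TmEq.arrI eφ.tyEq eξ.tyEq (by simpa using refl hl.ty_of_tm hl)
  have fr := TmEq.arrI eψ.tyEq eξ.tyEq (by simpa using refl hr.ty_of_tm hr)
  -- The body after the first β-step, still open in the two continuations.
  have et' : TmEq (.arr (ψ.subst (shift 1)) (ξ.subst (shift 1)) :: .arr φ ξ :: Γ)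
      (t.subst (up (up (scons ξ .var)))) (t.subst (up (up (scons ξ .var))))
      (ξ.subst (shift 2)) := by
    simpa using et.mor (((Mor.inst eφ.ctx eξ.left).up' et.ctx.head).up' et.ty)
  have e₀ := TmEq.pi_beta (.propF eφ.ctx) (orAbs eφ eψ et).left eξ.left
  have e₁ := TmEq.arrE tl (.arr tr eξ.tyEq) (by simpa using e₀) fl
  have e₂ := TmEq.arr_beta tl.left (B := .arr (.arr ψ ξ) ξ)
    (by simpa using (orFun eφ eψ eξ et').left) fl.left
  have e₃ := TmEq.arr_beta tr.left (B := ξ)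
    (by simpa using et'.left.mor ((Mor.inst eφ.ctx fl.left).up' et'.ty)) fr.left
  have e₄ := (TmEq.arrE tr eξ.tyEq (e₁.trans e₂) fr).trans (by simpa using e₃)
  simpa [Exp.elOr] using e₄

theorem orInl_beta {l r} (eφ : TmEq Γ φ φ .prop) (eψ : TmEq Γ ψ ψ .prop)
    (eξ : TmEq Γ ξ ξ .prop) (ha : Deriv Γ (.tm a φ)) (hl : Deriv (φ :: Γ) (.tm l (ξ.wk 1)))
    (hr : Deriv (ψ :: Γ) (.tm r (ξ.wk 1))) :
    TmEq Γ (.elOr φ ψ ξ (.orInl φ ψ a) l r) (l.inst a) ξ := by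
  have e := elOr_beta eφ eψ eξ hl hr (orInlAbs eφ eψ (.refl ha.ty_of_tm ha))
  exact e.trans (by simpa using arr_beta eφ.tyEq.left (by simpa using hl) ha)

theorem orInr_beta {l r} (eφ : TmEq Γ φ φ .prop) (eψ : TmEq Γ ψ ψ .prop)
    (eξ : TmEq Γ ξ ξ .prop) (hb : Deriv Γ (.tm b ψ)) (hl : Deriv (φ :: Γ) (.tm l (ξ.wk 1)))
    (hr : Deriv (ψ :: Γ) (.tm r (ξ.wk 1))) :
    TmEq Γ (.elOr φ ψ ξ (.orInr φ ψ b) l r) (r.inst b) ξ := by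
  have e := elOr_beta eφ eψ eξ hl hr (orInrAbs eφ eψ (.refl hb.ty_of_tm hb))
  exact e.trans (by simpa using arr_beta eψ.tyEq.left (by simpa using hr) hb)

/-! ### Conjunction -/

theorem andBody (eφ : TmEq Γ φ φ₁ .prop) (eψ : TmEq Γ ψ ψ₁ .prop) :
    TmEq (.prop :: Γ) (.andBody φ ψ) (.andBody φ₁ ψ₁) .prop := by
  have h := eφ.ty
  have v := prop_zero eφ.ctx
  simpa using TmEq.arr (.arr (eφ.weak h).tyEq (.arr (eψ.weak h).tyEq v.tyEq)) v

theorem and (eφ : TmEq Γ φ φ₁ .prop) (eψ : TmEq Γ ψ ψ₁ .prop) :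
    TmEq Γ (.and φ ψ) (.and φ₁ ψ₁) .prop :=
  .pi (.prop eφ.ctx) (andBody eφ eψ)

theorem andIBody (eφ : TmEq Γ φ φ₁ .prop) (eψ : TmEq Γ ψ ψ₁ .prop) (ea : TmEq Γ a a₁ φ)
    (eb : TmEq Γ b b₁ ψ) :
    TmEq (.arr (φ.wk 1) (.arr (ψ.wk 1) (.var 0)) :: .prop :: Γ)
      (.arrE (ψ.wk 2) (.var 1) (.arrE (φ.wk 2) (.arr (ψ.wk 2) (.var 1)) (.var 0) (a.wk 2))
        (b.wk 2))
      (.arrE (ψ₁.wk 2) (.var 1)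
        (.arrE (φ₁.wk 2) (.arr (ψ₁.wk 2) (.var 1)) (.var 0) (a₁.wk 2)) (b₁.wk 2)) (.var 1) := by
  have h := eφ.ty
  have v := prop_zero eφ.ctx
  have f := (TyEq.arr (eφ.weak h).tyEq (.arr (eψ.weak h).tyEq v.tyEq)).left
  have m := (Mor.shift (.ctxCons h)).shift_succ (.ctxCons f)
  have ep : TyEq _ (.var 1) (.var 1) := (v.tyEq.weak f)
  have eψ' := eψ.tyEq.mor m
  simpa using TmEq.arrE eψ' ep (.arrE (eφ.tyEq.mor m) (.arr eψ' ep)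
    (by simpa using var_zero f) (ea.mor m)) (eb.mor m)

theorem andI (eφ : TmEq Γ φ φ₁ .prop) (eψ : TmEq Γ ψ ψ₁ .prop) (ea : TmEq Γ a a₁ φ)
    (eb : TmEq Γ b b₁ ψ) : TmEq Γ (.andI φ ψ a b) (.andI φ₁ ψ₁ a₁ b₁) (.and φ ψ) := by
  have h := eφ.ty
  have v := (prop_zero eφ.ctx).tyEq
  refine .lam (.prop eφ.ctx) (andBody eφ eψ).tyEq ?_
  simpa using TmEq.arrI (.arr (eφ.weak h).tyEq (.arr (eψ.weak h).tyEq v)) v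
    (by simpa using andIBody eφ eψ ea eb)

/-- The second-order eliminator of the conjunction. -/
theorem andElim {p p₁ g g₁} (eφ : TmEq Γ φ φ₁ .prop) (eψ : TmEq Γ ψ ψ₁ .prop)
    (eξ : TmEq Γ ξ ξ₁ .prop) (ep : TmEq Γ p p₁ (.and φ ψ))
    (eg : TmEq Γ g g₁ (.arr φ (.arr ψ ξ))) :
    TmEq Γ (.arrE (.arr φ (.arr ψ ξ)) ξ (.app .prop (.andBody φ ψ) p ξ) g)
      (.arrE (.arr φ₁ (.arr ψ₁ ξ₁)) ξ₁ (.app .prop (.andBody φ₁ ψ₁) p₁ ξ₁) g₁) ξ :=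
  .arrE (.arr eφ.tyEq (.arr eψ.tyEq eξ.tyEq)) eξ.tyEq
    (by simpa using TmEq.app (.prop eφ.ctx) (andBody eφ eψ).tyEq ep eξ) eg

theorem arrI₂ {t t₁} (eφ : TyEq Γ φ φ₁) (eψ : TyEq Γ ψ ψ₁) (eξ : TyEq Γ ξ ξ₁)
    (et : TmEq (ψ.wk 1 :: φ :: Γ) t t₁ (ξ.wk 2)) :
    TmEq Γ (.arrI φ (.arr ψ ξ) (.arrI (ψ.wk 1) (ξ.wk 1) t))
      (.arrI φ₁ (.arr ψ₁ ξ₁) (.arrI (ψ₁.wk 1) (ξ₁.wk 1) t₁)) (.arr φ (.arr ψ ξ)) := by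
  have h := eφ.left
  exact .arrI eφ (.arr eψ eξ) (by
    simpa using TmEq.arrI (eψ.weak h) (eξ.weak h) (by simpa using et))

theorem andL_arg (eφ : TyEq Γ φ φ₁) (eψ : TyEq Γ ψ ψ₁) :
    TmEq (ψ.wk 1 :: φ :: Γ) (.var 1) (.var 1) (φ.wk 2) := by
  simpa using var_one (eψ.weak eφ.left).left

theorem andR_arg (eφ : TyEq Γ φ φ₁) (eψ : TyEq Γ ψ ψ₁) :
    TmEq (ψ.wk 1 :: φ :: Γ) (.var 0) (.var 0) (ψ.wk 2) := by
  simpa using var_zero (eψ.weak eφ.left).left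

theorem andL {p p₁} (eφ : TmEq Γ φ φ₁ .prop) (eψ : TmEq Γ ψ ψ₁ .prop)
    (ep : TmEq Γ p p₁ (.and φ ψ)) : TmEq Γ (.andL φ ψ p) (.andL φ₁ ψ₁ p₁) φ :=
  andElim eφ eψ eφ ep (arrI₂ eφ.tyEq eψ.tyEq eφ.tyEq (andL_arg eφ.tyEq eψ.tyEq))

theorem andR {p p₁} (eφ : TmEq Γ φ φ₁ .prop) (eψ : TmEq Γ ψ ψ₁ .prop)
    (ep : TmEq Γ p p₁ (.and φ ψ)) : TmEq Γ (.andR φ ψ p) (.andR φ₁ ψ₁ p₁) ψ :=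
  andElim eφ eψ eψ ep (arrI₂ eφ.tyEq eψ.tyEq eψ.tyEq (andR_arg eφ.tyEq eψ.tyEq))

/-- Four β-steps: `p` becomes `ξ`, the continuation is plugged into the pair, and it then consumes
`a` and `b`. The two projections are the cases where `ξ` is `φ` or `ψ`. -/
theorem andElim_beta {t} (eφ : TmEq Γ φ φ .prop) (eψ : TmEq Γ ψ ψ .prop)
    (eξ : TmEq Γ ξ ξ .prop) (ea : TmEq Γ a a φ) (eb : TmEq Γ b b ψ)
    (et : TmEq (ψ.wk 1 :: φ :: Γ) t t (ξ.wk 2)) :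
    TmEq Γ (.arrE (.arr φ (.arr ψ ξ)) ξ (.app .prop (.andBody φ ψ) (.andI φ ψ a b) ξ)
      (.arrI φ (.arr ψ ξ) (.arrI (ψ.wk 1) (ξ.wk 1) t))) (t.inst₂ a b) ξ := by
  have v := (prop_zero eφ.ctx).tyEq
  have tψξ := TyEq.arr eψ.tyEq eξ.tyEq
  have tg := TyEq.arr eφ.tyEq tψξ
  have eg := arrI₂ eφ.tyEq eψ.tyEq eξ.tyEq et
  have hbody := (andIBody eφ eψ ea eb).left
  have habs := TmEq.arrI (.arr (eφ.weak eφ.ty).tyEq (.arr (eψ.weak eφ.ty).tyEq v)) v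
    (by simpa using andIBody eφ eψ ea eb)
  have e₀ := TmEq.pi_beta (B := .andBody φ ψ) (.propF eφ.ctx) (by simpa using habs.left) eξ.left
  have e₁ := TmEq.arrE tg eξ.tyEq (by simpa [Exp.andI] using e₀) eg
  have e₂ := TmEq.arr_beta tg.left (B := ξ) (by
    simpa using hbody.mor ((Mor.inst eφ.ctx eξ.left).up' hbody)) eg.left
  have e₃ := TmEq.arr_beta eφ.tyEq.left (B := .arr ψ ξ) (by
    simpa using (TmEq.arrI (eψ.tyEq.weak eφ.tyEq.left) (eξ.tyEq.weak eφ.tyEq.left)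
      (by simpa using et)).left) ea.left
  have e₄ := TmEq.arr_beta (b := t.subst (up (scons a .var))) eψ.tyEq.left (B := ξ) (by
    simpa using et.left.mor ((Mor.inst eφ.ctx ea.left).up' et.ty)) eb.left
  have e₅ := TmEq.arrE eψ.tyEq eξ.tyEq e₃ eb
  have e₆ := (e₁.trans e₂).trans (by simpa using e₅.trans (by simpa using e₄))
  simpa [Exp.andI] using e₆

theorem andL_beta (eφ : TmEq Γ φ φ .prop) (eψ : TmEq Γ ψ ψ .prop) (ha : Deriv Γ (.tm a φ))
    (hb : Deriv Γ (.tm b ψ)) : TmEq Γ (.andL φ ψ (.andI φ ψ a b)) a φ :=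
  andElim_beta eφ eψ eφ (.refl ha.ty_of_tm ha) (.refl hb.ty_of_tm hb)
    (andL_arg eφ.tyEq eψ.tyEq)

theorem andR_beta (eφ : TmEq Γ φ φ .prop) (eψ : TmEq Γ ψ ψ .prop) (ha : Deriv Γ (.tm a φ))
    (hb : Deriv Γ (.tm b ψ)) : TmEq Γ (.andR φ ψ (.andI φ ψ a b)) b ψ :=
  andElim_beta eφ eψ eψ (.refl ha.ty_of_tm ha) (.refl hb.ty_of_tm hb)
    (andR_arg eφ.tyEq eψ.tyEq)

/-! ### Existential quantification -/

theorem exPremise (eA : TyEq Γ A A₁) (eφ : TmEq (A :: Γ) φ φ₁ .prop) :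
    TyEq (.prop :: Γ) (.pi (A.wk 1) (.arr (φ.wkUnder 1) (.var 1)))
      (.pi (A₁.wk 1) (.arr (φ₁.wkUnder 1) (.var 1))) := by
  have h := eA.left.ctx
  have m := Mor.shift (.ctxCons (.propF h))
  have eA' := eA.mor m
  simpa using TyEq.pi eA' (.arr (eφ.mor (m.up' eφ.ty)).tyEq ((prop_zero h).tyEq.weak eA'.left))

theorem exBody (eA : TyEq Γ A A₁) (eφ : TmEq (A :: Γ) φ φ₁ .prop) :
    TmEq (.prop :: Γ) (.exBody A φ) (.exBody A₁ φ₁) .prop :=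
  .arr (exPremise eA eφ) (prop_zero eA.left.ctx)

theorem ex (eA : TyEq Γ A A₁) (eφ : TmEq (A :: Γ) φ φ₁ .prop) :
    TmEq Γ (.ex A φ) (.ex A₁ φ₁) .prop :=
  .pi (.prop eA.left.ctx) (exBody eA eφ)

theorem exIBody (eA : TyEq Γ A A₁) (eφ : TmEq (A :: Γ) φ φ₁ .prop) (ea : TmEq Γ a a₁ A)
    (eb : TmEq Γ b b₁ (φ.inst a)) :
    TmEq (.pi (A.wk 1) (.arr (φ.wkUnder 1) (.var 1)) :: .prop :: Γ)
      (.arrE ((φ.inst a).wk 2) (.var 1)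
        (.app (A.wk 2) (.arr (φ.wkUnder 2) (.var 2)) (.var 0) (a.wk 2)) (b.wk 2))
      (.arrE ((φ₁.inst a₁).wk 2) (.var 1)
        (.app (A₁.wk 2) (.arr (φ₁.wkUnder 2) (.var 2)) (.var 0) (a₁.wk 2)) (b₁.wk 2))
      (.var 1) := by
  have h := eA.left.ctx
  have f := (exPremise eA eφ).left
  have m := (Mor.shift (.ctxCons (.propF h))).shift_succ (.ctxCons f)
  have ep : TyEq _ (.var 1) (.var 1) := ((prop_zero h).tyEq.weak f)
  have eA' := eA.mor m
  have ev := TyEq.arr (eφ.mor (m.up' eφ.ty)).tyEq (ep.weak eA'.left)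
  simpa using TmEq.arrE ((eφ.tyEq.inst ea).mor m) ep
    (by simpa using TmEq.app eA' ev (by simpa using var_zero f) (ea.mor m)) (eb.mor m)

theorem exI (eA : TyEq Γ A A₁) (eφ : TmEq (A :: Γ) φ φ₁ .prop) (ea : TmEq Γ a a₁ A)
    (eb : TmEq Γ b b₁ (φ.inst a)) :
    TmEq Γ (.exI A φ a b) (.exI A₁ φ₁ a₁ b₁) (.ex A φ) :=
  .lam (.prop ea.ctx) (exBody eA eφ).tyEq
    (.arrI (exPremise eA eφ) (prop_zero ea.ctx).tyEq (by simpa using exIBody eA eφ ea eb))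

theorem elExArg {m m₁} (eA : TyEq Γ A A₁) (eφ : TmEq (A :: Γ) φ φ₁ .prop)
    (eξ : TmEq Γ ξ ξ₁ .prop) (em : TmEq (φ :: A :: Γ) m m₁ (ξ.wk 2)) :
    TmEq Γ (.lam A (.arr φ (ξ.wk 1)) (.arrI φ (ξ.wk 1) m))
      (.lam A₁ (.arr φ₁ (ξ₁.wk 1)) (.arrI φ₁ (ξ₁.wk 1) m₁)) (.pi A (.arr φ (ξ.wk 1))) := by
  have eξ' := eξ.tyEq.weak eA.left
  simpa using TmEq.lam eA (.arr eφ.tyEq eξ') (.arrI eφ.tyEq eξ' (by simpa using em))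

theorem elEx {d d₁ m m₁} (eA : TyEq Γ A A₁) (eφ : TmEq (A :: Γ) φ φ₁ .prop)
    (eξ : TmEq Γ ξ ξ₁ .prop) (ed : TmEq Γ d d₁ (.ex A φ))
    (em : TmEq (φ :: A :: Γ) m m₁ (ξ.wk 2)) :
    TmEq Γ (.elEx A φ ξ d m) (.elEx A₁ φ₁ ξ₁ d₁ m₁) ξ := by
  have eξ' := eξ.tyEq.weak eA.left
  refine .arrE (by simpa using TyEq.pi eA (.arr eφ.tyEq eξ')) eξ.tyEq ?_ (elExArg eA eφ eξ em)
  simpa using TmEq.app (.prop ed.ctx) (exBody eA eφ).tyEq ed eξ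

/-- The β-steps are those of the conjunction, except that the continuation is dependent: after it
has consumed `a`, its next argument has type `φ(a)`. -/
theorem elEx_beta {m} (eA : TyEq Γ A A) (eφ : TmEq (A :: Γ) φ φ .prop)
    (eξ : TmEq Γ ξ ξ .prop) (ha : Deriv Γ (.tm a A)) (hb : Deriv Γ (.tm b (φ.inst a)))
    (hm : Deriv (φ :: A :: Γ) (.tm m (ξ.wk 2))) :
    TmEq Γ (.elEx A φ ξ (.exI A φ a b) m) (m.inst₂ a b) ξ := by
  have ea := TmEq.refl eA.left ha
  have eb := TmEq.refl hb.ty_of_tm hb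
  have em := TmEq.refl hm.ty_of_tm hm
  have eξ' := eξ.tyEq.weak eA.left
  have tφ := TyEq.arr eφ.tyEq eξ'
  have tg := TyEq.pi eA tφ
  have eg := elExArg eA eφ eξ em
  have hbody := (exIBody eA eφ ea eb).left
  have habs := TmEq.arrI (exPremise eA eφ) (prop_zero ea.ctx).tyEq
    (by simpa using exIBody eA eφ ea eb)
  have e₀ := TmEq.pi_beta (B := .exBody A φ) (.propF ea.ctx) habs.left eξ.left
  have e₁ := TmEq.arrE tg eξ.tyEq (by simpa [Exp.exI] using e₀) (by simpa using eg)
  have e₂ := TmEq.arr_beta tg.left (B := ξ) (by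
    simpa using hbody.mor ((Mor.inst ea.ctx eξ.left).up' hbody)) (by simpa using eg.left)
  have e₃ := TmEq.pi_beta (B := .arr φ (ξ.subst (shift 1))) eA.left
    (TmEq.arrI eφ.tyEq eξ' (by simpa using em)).left ha
  have e₄ := TmEq.arr_beta (b := m.subst (up (scons a .var))) (eφ.tyEq.inst ea).left (B := ξ) (by
    simpa using hm.mor ((Mor.inst ea.ctx ha).up' hm)) hb
  have e₅ := TmEq.arrE (eφ.tyEq.inst ea) eξ.tyEq (by simpa using e₃) eb
  have e₆ := (e₁.trans e₂).trans (by simpa using e₅.trans (by simpa using e₄))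
  simpa [Exp.elEx, Exp.exI] using e₆

/-! ### Propositional equality -/

theorem pred (eA : TyEq Γ A A₁) : TyEq Γ (.pi A .prop) (.pi A₁ .prop) :=
  .pi eA (.prop (.ctxCons eA.left))

theorem identAt (eA : TyEq Γ A A₁) (ea : TmEq Γ a a₁ A) :
    TmEq (.pi A .prop :: Γ) (.identAt A a) (.identAt A₁ a₁) .prop := by
  have h := (pred eA).left
  have eA' := eA.weak h
  simpa using TmEq.app eA' (.prop (.ctxCons eA'.left)) (by simpa using var_zero h) (ea.weak h)

theorem identBody (eA : TyEq Γ A A₁) (ea : TmEq Γ a a₁ A) (eb : TmEq Γ b b₁ A) :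
    TmEq (.pi A .prop :: Γ) (.arr (.identAt A a) (.identAt A b))
      (.arr (.identAt A₁ a₁) (.identAt A₁ b₁)) .prop :=
  .arr (identAt eA ea).tyEq (identAt eA eb)

theorem ident (eA : TyEq Γ A A₁) (ea : TmEq Γ a a₁ A) (eb : TmEq Γ b b₁ A) :
    TmEq Γ (.ident A a b) (.ident A₁ a₁ b₁) .prop :=
  .pi (pred eA) (identBody eA ea eb)

theorem reflBody (eA : TyEq Γ A A₁) (ea : TmEq Γ a a₁ A) :
    TmEq (.pi A .prop :: Γ) (.arrI (.identAt A a) (.identAt A a) (.var 0))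
      (.arrI (.identAt A₁ a₁) (.identAt A₁ a₁) (.var 0)) (.arr (.identAt A a) (.identAt A a)) :=
  .arrI (identAt eA ea).tyEq (identAt eA ea).tyEq (var_zero (identAt eA ea).tyEq.left)

theorem refl' (eA : TyEq Γ A A₁) (ea : TmEq Γ a a₁ A) :
    TmEq Γ (.refl A a) (.refl A₁ a₁) (.ident A a a) :=
  .lam (pred eA) (identBody eA ea ea).tyEq (reflBody eA ea)

/-- Equal relations are instantiated along equal substitutions, which fix the last variable and
differ by `a` and `a₁`. -/
theorem identPredBody (eA : TyEq Γ A A₁) (eξ : TmEq (A.wk 1 :: A :: Γ) ξ ξ₁ .prop)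
    (ea : TmEq Γ a a₁ A) :
    TmEq (A :: Γ) (ξ.subst (scons (.var 0) (scons (a.wk 1) (shift 1))))
      (ξ₁.subst (scons (.var 0) (scons (a₁.wk 1) (shift 1)))) .prop := by
  have ew := ea.weak eA.left
  have v := var_zero eA.left
  have m := (MorEq.refl (.shift (.ctxCons eA.left))).scons ew.left
    ew.right ew.eq
  simpa using eξ.morEq (m.scons (a := .var 0) (b := .var 0) (by simpa using v.left)
    (by simpa using v.left) (by simpa using v.eq))

theorem identPred (eA : TyEq Γ A A₁) (eξ : TmEq (A.wk 1 :: A :: Γ) ξ ξ₁ .prop)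
    (ea : TmEq Γ a a₁ A) :
    TmEq Γ (.identPred A ξ a) (.identPred A₁ ξ₁ a₁) (.pi A .prop) :=
  .lam eA (.prop (.ctxCons eA.left)) (identPredBody eA eξ ea)

theorem identPred_app (eA : TyEq Γ A A₁) (eξ : TmEq (A.wk 1 :: A :: Γ) ξ ξ₁ .prop)
    (ea : TmEq Γ a a₁ A) (eb : TmEq Γ b b₁ A) :
    TmEq Γ (.app A .prop (.identPred A ξ a) b) (.app A₁ .prop (.identPred A₁ ξ₁ a₁) b₁)
      .prop :=
  .app eA (.prop (.ctxCons eA.left)) (identPred eA eξ ea) eb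

/-- The encoded eliminator produces a proof of the predicate `λ y. ξ(a, y)` applied to `b`, which is
the expected `ξ(a, b)` only up to β. The elimination and computation rules are therefore concluded
by this conversion. -/
theorem identPred_beta (eA : TyEq Γ A A₁) (eξ : TmEq (A.wk 1 :: A :: Γ) ξ ξ₁ .prop)
    (ea : TmEq Γ a a₁ A) (eb : TmEq Γ b b₁ A) :
    TyEq Γ (.app A .prop (.identPred A ξ a) b) (ξ.inst₂ a b) := by
  simpa [Exp.identPred] using (pi_beta eA.left (identPredBody eA eξ ea).left eb.left).tyEq

theorem elIdent {p p₁ c c₁} (eA : TyEq Γ A A₁) (eξ : TmEq (A.wk 1 :: A :: Γ) ξ ξ₁ .prop)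
    (ea : TmEq Γ a a₁ A) (eb : TmEq Γ b b₁ A) (ep : TmEq Γ p p₁ (.ident A a b))
    (ec : TmEq (A :: Γ) c c₁ (ξ.inst (.var 0))) :
    TmEq Γ (.elIdent A ξ a b p c) (.elIdent A₁ ξ₁ a₁ b₁ p₁ c₁) (ξ.inst₂ a b) := by
  refine conv ?_ (identPred_beta eA eξ ea eb)
  refine .arrE (identPred_app eA eξ ea ea).tyEq (identPred_app eA eξ ea eb).tyEq ?_ ?_
  · simpa using TmEq.app (pred eA) (identBody eA ea eb).tyEq ep (identPred eA eξ ea)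
  · have m := (MorEq.refl (.id ea.ctx)).scons (A := A) (by simpa using ea.left)
      (by simpa using ea.right) (by simpa using ea.eq)
    exact conv (by simpa using ec.morEq m) (identPred_beta eA eξ ea ea).symm

/-- Reflexivity is the polymorphic identity function: one β-step instantiates its predicate, a
second returns the argument `c(a)`. -/
theorem elIdent_beta {c} (eA : TyEq Γ A A) (eξ : TmEq (A.wk 1 :: A :: Γ) ξ ξ .prop)
    (ea : TmEq Γ a a A) (hc : Deriv (A :: Γ) (.tm c (ξ.inst (.var 0)))) :
    TmEq Γ (.elIdent A ξ a a (.refl A a) c) (c.inst a) (ξ.inst₂ a a) := by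
  have eP := identPred_beta eA eξ ea ea
  have eP' := (identPred_app eA eξ ea ea).tyEq
  have hca : Deriv Γ (.tm (c.inst a) (.app A .prop (.identPred A ξ a) a)) :=
    .conv (by simpa using hc.inst ea.left) eP.symm.eq
  have e₀ := pi_beta (pred eA).left (reflBody eA ea).left (identPred eA eξ ea).left
  have e₁ := TmEq.arrE eP' eP' (by simpa using e₀) (.refl eP.left hca)
  have e₂ := arr_beta (b := .var 0) eP.left (var_zero eP.left).left hca
  exact conv (by simpa [Exp.elIdent, Exp.refl] using e₁.trans (by simpa using e₂)) eP

end TmEq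

end CC

/-! ## Soundness of the translation of `MTT` into `CC` -/

namespace MTT

attribute [simp] Jdg.enc Jdg.subst

open CC (TyEq TmEq)

theorem Jdg.enc_subst (σ : ℕ → Exp) (J : Jdg) :
    (J.subst σ).enc = J.enc.subst (Exp.encSub σ) := by
  rcases J with _ | ⟨_ | _, _⟩ | ⟨_ | _, _, _⟩ | _ | _ <;> simp

/-- A translated telescopic substitution is typed. -/
theorem encMor {Γ Δ : Ctx} {σ : ℕ → Exp} (hΔ : CC.Deriv (Δ.map Exp.enc) .ctx)
    (h : ∀ n A, Γ[n]? = some A →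
      CC.Deriv (Δ.map Exp.enc) (Jdg.enc (.tm (σ n) ((A.wk (n + 1)).subst σ))))
    (t : ∀ n, Γ.length ≤ n → ∃ m, σ n = Exp.var m) :
    CC.Mor (Δ.map Exp.enc) (Exp.encSub σ) (Γ.map Exp.enc) where
  ctx := hΔ
  typed n A hn := by
    obtain ⟨B, hB, rfl⟩ : ∃ B, Γ[n]? = some B ∧ B.enc = A := by simpa using hn
    simpa using h n B hB
  tail n hn := by
    obtain ⟨m, hm⟩ := t n (by simpa using hn)
    exact ⟨m, by simp [hm]⟩

theorem encMorEq {Γ Δ : Ctx} {σ τ : ℕ → Exp} (hΔ : CC.Deriv (Δ.map Exp.enc) .ctx)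
    (hσ : ∀ n A, Γ[n]? = some A →
      CC.Deriv (Δ.map Exp.enc) (Jdg.enc (.tm (σ n) ((A.wk (n + 1)).subst σ))))
    (hτ : ∀ n A, Γ[n]? = some A →
      CC.Deriv (Δ.map Exp.enc) (Jdg.enc (.tm (τ n) ((A.wk (n + 1)).subst τ))))
    (e : ∀ n A, Γ[n]? = some A →
      CC.Deriv (Δ.map Exp.enc) (Jdg.enc (.tmEq (σ n) (τ n) ((A.wk (n + 1)).subst σ))))
    (t : ∀ n, Γ.length ≤ n → ∃ m, σ n = Exp.var m ∧ τ n = Exp.var m) :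
    CC.MorEq (Δ.map Exp.enc) (Exp.encSub σ) (Exp.encSub τ) (Γ.map Exp.enc) where
  left := encMor hΔ hσ fun n hn => (t n hn).imp fun _ h => h.1
  right := encMor hΔ hτ fun n hn => (t n hn).imp fun _ h => h.2
  eq n A hn := by
    obtain ⟨B, hB, rfl⟩ : ∃ B, Γ[n]? = some B ∧ B.enc = A := by simpa using hn
    simpa using e n B hB
  tail n hn := by
    obtain ⟨m, hm, hm'⟩ := t n (by simpa using hn)
    simp [hm, hm']

/-- Derivability of the translation of a judgement, with presuppositions. -/
def Jdg.Sound (Γ : CC.Ctx) : Jdg → Prop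
  | ctx => CC.Deriv Γ .ctx
  | ty (.data _) A => TyEq Γ A.enc A.enc
  | ty (.logic _) φ => TmEq Γ φ.enc φ.enc .prop
  | tyEq (.data _) A B => TyEq Γ A.enc B.enc
  | tyEq (.logic _) φ ψ => TmEq Γ φ.enc ψ.enc .prop
  | tm a A => TmEq Γ a.enc a.enc A.enc
  | tmEq a b A => TmEq Γ a.enc b.enc A.enc

theorem Jdg.Sound.deriv {Γ : CC.Ctx} : ∀ {J : Jdg}, J.Sound Γ → CC.Deriv Γ J.enc
  | .ctx, h => h
  | .ty (.data _) _, h => TyEq.left h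
  | .ty (.logic _) _, h => TmEq.left h
  | .tyEq (.data _) _ _, h => TyEq.eq h
  | .tyEq (.logic _) _ _, h => TmEq.eq h
  | .tm _ _, h => TmEq.left h
  | .tmEq _ _ _, h => TmEq.eq h

theorem Jdg.Sound.of_deriv {Γ : CC.Ctx} : ∀ {J : Jdg}, CC.Deriv Γ J.enc → J.Sound Γ
  | .ctx, h => h
  | .ty (.data _) _, h => .refl h
  | .ty (.logic _) _, h => .refl h.ty_of_tm h
  | .tyEq (.data _) _ _, h => h.tyEq'
  | .tyEq (.logic _) _ _, h => h.tmEq'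
  | .tm _ _, h => .refl h.ty_of_tm h
  | .tmEq _ _ _, h => h.tmEq'

namespace Exp

theorem enc_wk (k : ℕ) (e : Exp) : (e.wk k).enc = e.enc.wk k := by simp

theorem enc_wkUnder (k : ℕ) (e : Exp) : (e.wkUnder k).enc = e.enc.wkUnder k := by simp

theorem enc_inst (e a : Exp) : (e.inst a).enc = e.enc.inst a.enc := by simp

theorem enc_inst₂ (e a b : Exp) : (e.inst₂ a b).enc = e.enc.inst₂ a.enc b.enc := by simp

theorem enc_instWk (k : ℕ) (e t : Exp) : (e.instWk k t).enc = e.enc.instWk k t.enc := by simp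

end Exp

/-- Typing being read as reflexive equality, one lemma of `CC` answers each rule and its congruence
rule. Inclusions of sizes and resizing become identities because sizes are not seen by the
translation, and the rules of the universe do so because `dec` and `code` are erased. Including
propositions among sets or collections is the reading of terms of `prop` as types. -/
theorem Der.sound {Γ J} (h : Der Γ J) : J.Sound (Γ.map Exp.enc) := by
  induction h
  case ctxNil => exact .ctxNil
  case ctxCons ih => exact .ctxCons (TyEq.left ih)
  case var hn ih =>
    simpa [Jdg.Sound] using TmEq.var ih (by simpa using ⟨_, hn, rfl⟩)
  case sub h hΔ hσ t ih ihΔ ihσ =>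
    apply Jdg.Sound.of_deriv
    rw [Jdg.enc_subst]
    exact ih.deriv.mor (encMor ihΔ (fun n A hn => (ihσ n A hn).deriv) t)
  case subTy k A σ τ _ _ _ _ _ t ih ihΔ ihσ ihτ ihe =>
    have m := encMorEq ihΔ (fun n A hn => (ihσ n A hn).deriv) (fun n A hn => (ihτ n A hn).deriv)
      (fun n A hn => (ihe n A hn).deriv) t
    apply Jdg.Sound.of_deriv
    -- An equality of propositions is an equality of terms of `prop`, hence the replacement rule for
    -- terms in the second case.
    cases k with
    | data => simpa using m.ty ih.deriv
    | logic => simpa using m.tm ih.deriv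
  case subTm a A σ τ _ _ _ _ _ t ih ihΔ ihσ ihτ ihe =>
    have m := encMorEq ihΔ (fun n A hn => (ihσ n A hn).deriv) (fun n A hn => (ihτ n A hn).deriv)
      (fun n A hn => (ihe n A hn).deriv) t
    apply Jdg.Sound.of_deriv
    simpa using m.tm ih.deriv
  case tyRefl ih =>
    rename_i k A _
    cases k <;> exact ih
  case tySymm k _ _ _ ih => cases k with
    | data => exact TyEq.symm ih
    | logic => exact TmEq.symm ih
  case tyTrans k _ _ _ _ _ ih ih' => cases k with
    | data => exact TyEq.trans ih ih'
    | logic => exact TmEq.trans ih ih'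
  case tmRefl ih => exact ih
  case tmSymm ih => exact TmEq.symm ih
  case tmTrans ih ih' => exact TmEq.trans ih ih'
  case conv ih ih' => exact TmEq.conv ih ih'
  case convEq ih ih' => exact TmEq.conv ih ih'
  all_goals
    simp only [Jdg.Sound, Exp.enc, List.map_cons, Exp.enc_wk, Exp.enc_wkUnder, Exp.enc_inst,
      Exp.enc_inst₂, Exp.enc_instWk] at *
  case smallTy => exact TmEq.tyEq ‹_›
  case smallTyEq => exact TmEq.tyEq ‹_›
  case largeTy => exact TmEq.tyEq ‹_›
  case largeTyEq => exact TmEq.tyEq ‹_›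
  case propsProp => exact ‹_›
  case propsPropEq => exact ‹_›
  case setCol => exact ‹_›
  case setColEq => exact ‹_›
  case colSet => exact ‹_›
  case colSetEq => exact ‹_›
  case propProps => exact ‹_›
  case propPropsEq => exact ‹_›
  case univI => exact ‹_›
  case univE => exact ‹_›
  case univC => exact ‹_›
  case univEta => exact ‹_›
  case univIEq => exact ‹_›
  case univEEq => exact ‹_›
  case emptyF => exact .refl (.emptyF ‹_›)
  case emptyE => exact TmEq.elEmpty ‹_› ‹_›
  case elEmptyCong => exact TmEq.elEmpty ‹_› ‹_›
  case unitF => exact .refl (.unitF ‹_›)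
  case unitI => exact .refl (.unitF ‹_›) (.unitI ‹_›)
  case unitE => exact TmEq.elUnit ‹_› ‹_› ‹_›
  case elUnitCong => exact TmEq.elUnit ‹_› ‹_› ‹_›
  case unitC => exact CC.Deriv.tmEq' (CC.Deriv.unitC (TyEq.left ‹_›) (TmEq.left ‹_›))
  case sigF => exact TyEq.sig ‹_› ‹_›
  case sigCong => exact TyEq.sig ‹_› ‹_›
  case sigI => exact TmEq.pair ‹_› ‹_› ‹_› ‹_›
  case pairCong => exact TmEq.pair ‹_› ‹_› ‹_› ‹_›
  case sigE => exact TmEq.elSig ‹_› ‹_› ‹_› ‹_› ‹_›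
  case elSigCong => exact TmEq.elSig ‹_› ‹_› ‹_› ‹_› ‹_›
  case sigC =>
    exact CC.Deriv.tmEq' (CC.Deriv.sigC (TyEq.left ‹_›) (TyEq.left ‹_›) (TyEq.left ‹_›)
      (TmEq.left ‹_›) (TmEq.left ‹_›) (TmEq.left ‹_›))
  case listF => exact TyEq.list ‹_›
  case listCong => exact TyEq.list ‹_›
  case listNil => exact TmEq.nil ‹_›
  case nilCong => exact TmEq.nil ‹_›
  case listCons => exact TmEq.cons ‹_› ‹_› ‹_›
  case consCong => exact TmEq.cons ‹_› ‹_› ‹_›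
  case listE => exact TmEq.elList ‹_› ‹_› ‹_› ‹_› ‹_›
  case elListCong => exact TmEq.elList ‹_› ‹_› ‹_› ‹_› ‹_›
  case listCNil =>
    exact CC.Deriv.tmEq' (CC.Deriv.listCNil (TyEq.left ‹_›) (TyEq.left ‹_›) (TmEq.left ‹_›)
      (TmEq.left ‹_›))
  case listCCons A C s c a l _ _ _ _ _ _ _ _ _ _ _ _ =>
    have h : TmEq _ (CC.Exp.elList A.enc C.enc (.cons A.enc s.enc c.enc) a.enc l.enc) _ _ :=
      CC.Deriv.tmEq' (CC.Deriv.listCCons (TyEq.left ‹_›) (TyEq.left ‹_›) (TmEq.left ‹_›)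
        (TmEq.left ‹_›) (TmEq.left ‹_›) (TmEq.left ‹_›))
    simpa using h
  case sumF => exact TyEq.sum ‹_› ‹_›
  case sumCong => exact TyEq.sum ‹_› ‹_›
  case sumInl => exact TmEq.inl ‹_› ‹_› ‹_›
  case inlCong => exact TmEq.inl ‹_› ‹_› ‹_›
  case sumInr => exact TmEq.inr ‹_› ‹_› ‹_›
  case inrCong => exact TmEq.inr ‹_› ‹_› ‹_›
  case sumE => exact TmEq.elSum ‹_› ‹_› ‹_› ‹_› ‹_› ‹_›
  case elSumCong => exact TmEq.elSum ‹_› ‹_› ‹_› ‹_› ‹_› ‹_›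
  case sumCInl =>
    exact CC.Deriv.tmEq' (CC.Deriv.sumCInl (TyEq.left ‹_›) (TyEq.left ‹_›) (TyEq.left ‹_›)
      (TmEq.left ‹_›) (TmEq.left ‹_›) (TmEq.left ‹_›))
  case sumCInr =>
    exact CC.Deriv.tmEq' (CC.Deriv.sumCInr (TyEq.left ‹_›) (TyEq.left ‹_›) (TyEq.left ‹_›)
      (TmEq.left ‹_›) (TmEq.left ‹_›) (TmEq.left ‹_›))
  case univF => exact .prop ‹_›
  case piF => exact TyEq.pi ‹_› ‹_›
  case piFUniv => exact TmEq.pred ‹_›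
  case piCong => exact TyEq.pi ‹_› ‹_›
  case piUnivCong => exact TmEq.pred ‹_›
  case piI => exact TmEq.lam ‹_› ‹_› ‹_›
  case lamCong => exact TmEq.lam ‹_› ‹_› ‹_›
  case piE => exact TmEq.app ‹_› ‹_› ‹_› ‹_›
  case appCong => exact TmEq.app ‹_› ‹_› ‹_› ‹_›
  case piC => exact TmEq.pi_beta (TyEq.left ‹_›) (TmEq.left ‹_›) (TmEq.left ‹_›)
  case botF => exact TmEq.bot ‹_›
  case botE => exact TmEq.elBot ‹_› ‹_›
  case elBotCong => exact TmEq.elBot ‹_› ‹_›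
  case orF => exact TmEq.or ‹_› ‹_›
  case orCong => exact TmEq.or ‹_› ‹_›
  case andF => exact TmEq.and ‹_› ‹_›
  case andCong => exact TmEq.and ‹_› ‹_›
  case orIL => exact TmEq.orInl ‹_› ‹_› ‹_›
  case orIR => exact TmEq.orInr ‹_› ‹_› ‹_›
  case orInlCong => exact TmEq.orInl ‹_› ‹_› ‹_›
  case orInrCong => exact TmEq.orInr ‹_› ‹_› ‹_›
  case orE => exact TmEq.elOr ‹_› ‹_› ‹_› ‹_› ‹_› ‹_›
  case elOrCong => exact TmEq.elOr ‹_› ‹_› ‹_› ‹_› ‹_› ‹_›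
  case orCL => exact TmEq.orInl_beta ‹_› ‹_› ‹_› (TmEq.left ‹_›) (TmEq.left ‹_›) (TmEq.left ‹_›)
  case orCR => exact TmEq.orInr_beta ‹_› ‹_› ‹_› (TmEq.left ‹_›) (TmEq.left ‹_›) (TmEq.left ‹_›)
  case andIn => exact TmEq.andI ‹_› ‹_› ‹_› ‹_›
  case andICong => exact TmEq.andI ‹_› ‹_› ‹_› ‹_›
  case andEL => exact TmEq.andL ‹_› ‹_› ‹_›
  case andLCong => exact TmEq.andL ‹_› ‹_› ‹_›
  case andCL => exact TmEq.andL_beta ‹_› ‹_› (TmEq.left ‹_›) (TmEq.left ‹_›)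
  case andER => exact TmEq.andR ‹_› ‹_› ‹_›
  case andRCong => exact TmEq.andR ‹_› ‹_› ‹_›
  case andCR => exact TmEq.andR_beta ‹_› ‹_› (TmEq.left ‹_›) (TmEq.left ‹_›)
  case impF => exact TmEq.arr (TmEq.tyEq ‹_›) ‹_›
  case impCong => exact TmEq.arr (TmEq.tyEq ‹_›) ‹_›
  case impIn =>
    exact TmEq.arrI (TmEq.tyEq ‹_›) (TmEq.tyEq ‹_›)
      (by rw [← CC.Exp.wk_eq]; assumption)
  case impICong =>
    exact TmEq.arrI (TmEq.tyEq ‹_›) (TmEq.tyEq ‹_›)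
      (by rw [← CC.Exp.wk_eq]; assumption)
  case impEl => exact TmEq.arrE (TmEq.tyEq ‹_›) (TmEq.tyEq ‹_›) ‹_› ‹_›
  case impECong => exact TmEq.arrE (TmEq.tyEq ‹_›) (TmEq.tyEq ‹_›) ‹_› ‹_›
  case impC =>
    exact TmEq.arr_beta (TmEq.left ‹_›).propE
      (by rw [← CC.Exp.wk_eq]; exact TmEq.left ‹_›) (TmEq.left ‹_›)
  case allF => exact TmEq.pi ‹_› ‹_›
  case allCong => exact TmEq.pi ‹_› ‹_›
  case allIn => exact TmEq.lam ‹_› (TmEq.tyEq ‹_›) ‹_›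
  case allICong => exact TmEq.lam ‹_› (TmEq.tyEq ‹_›) ‹_›
  case allEl => exact TmEq.app ‹_› (TmEq.tyEq ‹_›) ‹_› ‹_›
  case allECong => exact TmEq.app ‹_› (TmEq.tyEq ‹_›) ‹_› ‹_›
  case allC => exact TmEq.pi_beta (TyEq.left ‹_›) (TmEq.left ‹_›) (TmEq.left ‹_›)
  case exF => exact TmEq.ex ‹_› ‹_›
  case exCong => exact TmEq.ex ‹_› ‹_›
  case exIn => exact TmEq.exI ‹_› ‹_› ‹_› ‹_›
  case exICong => exact TmEq.exI ‹_› ‹_› ‹_› ‹_›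
  case exE => exact TmEq.elEx ‹_› ‹_› ‹_› ‹_› ‹_›
  case elExCong => exact TmEq.elEx ‹_› ‹_› ‹_› ‹_› ‹_›
  case exC => exact TmEq.elEx_beta ‹_› ‹_› ‹_› (TmEq.left ‹_›) (TmEq.left ‹_›) (TmEq.left ‹_›)
  case identF => exact TmEq.ident ‹_› ‹_› ‹_›
  case identCong => exact TmEq.ident ‹_› ‹_› ‹_›
  case identI => exact TmEq.refl' ‹_› ‹_›
  case reflCong => exact TmEq.refl' ‹_› ‹_›
  case identE => exact TmEq.elIdent ‹_› ‹_› ‹_› ‹_› ‹_› ‹_›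
  case elIdentCong => exact TmEq.elIdent ‹_› ‹_› ‹_› ‹_› ‹_› ‹_›
  case identC => exact TmEq.elIdent_beta ‹_› ‹_› ‹_› (TmEq.left ‹_›)

theorem Der.enc {Γ J} (h : Der Γ J) : CC.Der (Γ.map Exp.enc) J.enc := h.sound.deriv.der

end MTT

/-! ## The translation of `CC` into `MTT` -/

namespace CC.Exp

@[simp] theorem isProp_var (n : ℕ) : (var n).IsProp = true := rfl

@[simp] theorem forall_isProp_scons (a : Exp) (σ : ℕ → Exp) :
    (∀ n, (scons a σ n).IsProp = true) ↔ a.IsProp = true ∧ ∀ n, (σ n).IsProp = true :=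
  ⟨fun h => ⟨h 0, fun n => h (n + 1)⟩, fun h => isProp_scons h.1 h.2⟩

/-- All that `emb` adds is invisible to `enc`: codes and decodings are erased, and `∀` and `Π` have
the same image. So the identity needs no well-formedness, and the role plays no part. -/
theorem enc_emb (r : Role) (e : Exp) : (e.emb r).enc = e := by
  induction e generalizing r with
  | pi A B ihA ihB =>
    unfold emb
    split <;> cases r <;> simp [Role.ofTm, Role.ofTy, ihA, ihB]
  | lam A B b ihA ihB ihb =>
    unfold emb
    split <;> cases r <;> simp [Role.ofTm, ihA, ihB, ihb]
  | app A B f a ihA ihB ihf iha =>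
    unfold emb
    split <;> cases r <;> simp [Role.ofTm, ihA, ihB, ihf, iha]
  | _ => cases r <;> simp [emb, Role.ofTm, Role.ofTy, *]

theorem ren_ofTm (r : Role) (f : ℕ → ℕ) (c : MTT.Exp) :
    (r.ofTm c).ren f = r.ofTm (c.ren f) := by
  cases r <;> rfl

theorem ren_ofTy (r : Role) (f : ℕ → ℕ) (c : MTT.Exp) :
    (r.ofTy c).ren f = r.ofTy (c.ren f) := by
  cases r <;> rfl

theorem subst_ofTm (r : Role) (σ : ℕ → MTT.Exp) (c : MTT.Exp) :
    (r.ofTm c).subst σ = r.ofTm (c.subst σ) := by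
  cases r <;> rfl

theorem subst_ofTy (r : Role) (σ : ℕ → MTT.Exp) (c : MTT.Exp) :
    (r.ofTy c).subst σ = r.ofTy (c.subst σ) := by
  cases r <;> rfl

theorem emb_ren (r : Role) (f : ℕ → ℕ) (e : Exp) : (e.ren f).emb r = (e.emb r).ren f := by
  induction e generalizing r f <;>
    simp only [ren, emb, ren_ofTm, ren_ofTy, MTT.Exp.ren, isProp_ren, *]
  all_goals split <;> simp only [ren_ofTm, ren_ofTy, MTT.Exp.ren]

/-- Expressions passing the test are translated as names of propositions in either role, and the
reading as a type only adds a decoding in front. -/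
theorem emb_of_isProp {e : Exp} (h : e.IsProp = true) (r : Role) :
    e.emb r = r.ofTm (e.emb .asTm) := by
  cases e
  case pi A B => simp only [emb, if_pos (show B.IsProp = true from h)]; rfl
  all_goals first | rfl | cases h

/-- The translation of a substitution. -/
def embSub (σ : ℕ → Exp) (n : ℕ) : MTT.Exp := (σ n).emb .asTm

theorem embSub_up (σ : ℕ → Exp) : embSub (up σ) = MTT.Exp.up (embSub σ) := by
  funext n
  cases n with
  | zero => rfl
  | succ n => exact emb_ren ..

-- Substituted values are always translated as terms. A variable in type position becomes a decoded
-- variable, so a value placed there must be the decoding of its translation as a term, which is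
-- where the test is needed. The test also keeps the choice between `∀` and `Π` unchanged.
@[simp] theorem emb_subst {σ : ℕ → Exp} (h : ∀ n, (σ n).IsProp = true) (r : Role) (e : Exp) :
    (e.subst σ).emb r = (e.emb r).subst (embSub σ) := by
  induction e generalizing r σ with
  | var n =>
    rw [subst_var_apply, emb_of_isProp (h n), emb, subst_ofTm]
    rfl
  | _ =>
    simp only [subst, emb, subst_ofTm, subst_ofTy, MTT.Exp.subst, isProp_subst (isProp_up h),
      embSub_up, isProp_up h, isProp_up (isProp_up h), isProp_up (isProp_up (isProp_up h)),
      implies_true, *]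
    try (split <;> simp only [subst_ofTm, subst_ofTy, MTT.Exp.subst])

@[simp] theorem embSub_scons (a : Exp) (σ : ℕ → Exp) :
    embSub (scons a σ) = scons (a.emb .asTm) (embSub σ) := by
  funext n; cases n <;> rfl

@[simp] theorem embSub_var : embSub var = MTT.Exp.var := rfl

@[simp] theorem embSub_shift (k : ℕ) : embSub (shift k) = MTT.Exp.shift k := rfl

variable {r : Role}

theorem emb_wk (k : ℕ) (e : Exp) : (e.wk k).emb r = (e.emb r).wk k := emb_ren ..

theorem emb_wkUnder (k : ℕ) (e : Exp) : (e.wkUnder k).emb r = (e.emb r).wkUnder k := emb_ren ..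

theorem emb_inst {e a : Exp} (h : a.IsProp = true) :
    (e.inst a).emb r = (e.emb r).inst (a.emb .asTm) := by
  simp [h]

theorem emb_inst₂ {e a b : Exp} (ha : a.IsProp = true) (hb : b.IsProp = true) :
    (e.inst₂ a b).emb r = (e.emb r).inst₂ (a.emb .asTm) (b.emb .asTm) := by
  simp [ha, hb]

theorem emb_instWk {k : ℕ} {e t : Exp} (h : t.IsProp = true) :
    (e.instWk k t).emb r = (e.emb r).instWk k (t.emb .asTm) := by
  simp [h]

end CC.Exp

/-! ### Products in `MTT`, uniformly for `∀` and `Π` -/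

namespace MTT

open Exp

/-- The kind of small propositions or of sets. -/
def Kind.ofBool : Bool → Kind
  | true => .props
  | false => .set

namespace Exp

/-- A universally quantified proposition, through its code, or a dependent product. -/
def prod (p : Bool) (A B : Exp) : Exp := if p then .dec (.code (.all A B)) else .pi A B

/-- Abstraction for `prod`. -/
def prodLam (p : Bool) (A B b : Exp) : Exp := if p then .allI A B b else .lam A B b

/-- Application for `prod`. -/
def prodApp (p : Bool) (A B f a : Exp) : Exp := if p then .allE A B f a else .app A B f a

end Exp

variable {Γ : Ctx} {p : Bool} {A A₁ B B₁ b b₁ f f₁ a a₁ : Exp}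

theorem Der.set_of (h : Der Γ (.ty (.ofBool p) A)) : Der Γ (.ty .set A) := by
  cases p
  · exact h
  · exact h.smallTy

theorem Der.setEq_of (h : Der Γ (.tyEq (.ofBool p) A B)) : Der Γ (.tyEq .set A B) := by
  cases p
  · exact h
  · exact h.smallTyEq

theorem Der.col_of (h : Der Γ (.ty (.ofBool p) A)) : Der Γ (.ty .col A) := h.set_of.setCol

theorem Der.colEq_of (h : Der Γ (.tyEq (.ofBool p) A B)) : Der Γ (.tyEq .col A B) :=
  h.setEq_of.setColEq

/-- In type position a translated quantification appears as the decoding of its code. Introduction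
and elimination of `∀` reach it through this equality. -/
theorem Der.decAll (hA : Der Γ (.ty .set A)) (hB : Der (A :: Γ) (.ty .props B)) :
    Der Γ (.tyEq .col (.dec (.code (.all A B))) (.all A B)) :=
  (Der.univC (.allF .small hA hB)).smallTyEq.setColEq

theorem Der.prodF (hA : Der Γ (.ty .set A)) (hB : Der (A :: Γ) (.ty (.ofBool p) B)) :
    Der Γ (.ty (.ofBool p) (.prod p A B)) := by
  cases p
  · exact .piF hA hB
  · exact .univE (.univI (.allF .small hA hB))

theorem Der.prodCong (hA : Der Γ (.ty .set A)) (eA : Der Γ (.tyEq .set A A₁))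
    (eB : Der (A :: Γ) (.tyEq (.ofBool p) B B₁)) :
    Der Γ (.tyEq (.ofBool p) (.prod p A B) (.prod p A₁ B₁)) := by
  cases p
  · exact .piCong hA eA eB
  · exact .univEEq (.univIEq (.allCong .small hA eA eB))

theorem Der.prodI (hA : Der Γ (.ty .set A)) (hB : Der (A :: Γ) (.ty (.ofBool p) B))
    (hb : Der (A :: Γ) (.tm b B)) : Der Γ (.tm (.prodLam p A B b) (.prod p A B)) := by
  cases p
  · exact .piI hA.setCol hB.setCol (Der.piF hA hB).setCol hb
  · exact .conv (.allIn hA.setCol hB.propsProp hb) (.tySymm (.decAll hA hB))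

theorem Der.prodLamCong (hA : Der Γ (.ty .set A)) (hB : Der (A :: Γ) (.ty (.ofBool p) B))
    (eA : Der Γ (.tyEq .set A A₁)) (eB : Der (A :: Γ) (.tyEq (.ofBool p) B B₁))
    (eb : Der (A :: Γ) (.tmEq b b₁ B)) :
    Der Γ (.tmEq (.prodLam p A B b) (.prodLam p A₁ B₁ b₁) (.prod p A B)) := by
  cases p
  · exact .lamCong hA.setCol (Der.piF hA hB).setCol eA.setColEq eB.setColEq eb
  · exact .convEq (.allICong hA.setCol eA.setColEq eB.propsPropEq eb) (.tySymm (.decAll hA hB))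

theorem Der.prodE (hA : Der Γ (.ty .set A)) (hB : Der (A :: Γ) (.ty (.ofBool p) B))
    (hf : Der Γ (.tm f (.prod p A B))) (ha : Der Γ (.tm a A)) :
    Der Γ (.tm (.prodApp p A B f a) (B.inst a)) := by
  cases p
  · exact .piE hA.setCol hB.setCol hf ha
  · exact .allEl hA.setCol hB.propsProp (.conv hf (.decAll hA hB)) ha

/-- In the case of `∀` the equality of functions is converted from the decoded code to the
quantification, and this uses that the codomain is a proposition. It is the reason for the
additional premise in `CC.Deriv.appCong`. -/
theorem Der.prodAppCong (hA : Der Γ (.ty .set A)) (hB : Der (A :: Γ) (.ty (.ofBool p) B))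
    (eA : Der Γ (.tyEq .set A A₁)) (eB : Der (A :: Γ) (.tyEq (.ofBool p) B B₁))
    (ef : Der Γ (.tmEq f f₁ (.prod p A B))) (ea : Der Γ (.tmEq a a₁ A)) :
    Der Γ (.tmEq (.prodApp p A B f a) (.prodApp p A₁ B₁ f₁ a₁) (B.inst a)) := by
  cases p
  · exact .appCong hA.setCol eA.setColEq eB.setColEq ef ea
  · exact .allECong hA.setCol eA.setColEq eB.propsPropEq (.convEq ef (.decAll hA hB)) ea

theorem Der.prodC (hA : Der Γ (.ty .set A)) (hB : Der (A :: Γ) (.ty (.ofBool p) B))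
    (hb : Der (A :: Γ) (.tm b B)) (ha : Der Γ (.tm a A)) :
    Der Γ (.tmEq (.prodApp p A B (.prodLam p A B b) a) (b.inst a) (B.inst a)) := by
  cases p
  · exact .piC hA.setCol hB.setCol (Der.piF hA hB).setCol hb ha
  · exact .allC hA.setCol hB.propsProp hb ha

end MTT

/-! ### Derivability is preserved by the translation into `MTT` -/

namespace CC

open Exp

/-- The translation of judgements, keeping track of which types are propositions. -/
def Jdg.embKind : Jdg → MTT.Jdg
  | ctx => .ctx
  | ty A => .ty (.ofBool A.IsProp) (A.emb .asTy)
  | tyEq A B => .tyEq (.ofBool A.IsProp) (A.emb .asTy) (B.emb .asTy)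
  | tm a A => .tm (a.emb .asTm) (A.emb .asTy)
  | tmEq a b A => .tmEq (a.emb .asTm) (b.emb .asTm) (A.emb .asTy)

theorem Jdg.embKind_subst {σ : ℕ → Exp} (h : ∀ n, (σ n).IsProp = true) (J : Jdg) :
    (J.subst σ).embKind = J.embKind.subst (embSub σ) := by
  cases J <;> simp [Jdg.embKind, h, isProp_subst h]

/-- The translation of contexts. -/
abbrev Ctx.emb (Γ : Ctx) : MTT.Ctx := Γ.map (Exp.emb .asTy)

section

variable {Γ Δ : Ctx} {σ τ : ℕ → Exp}

theorem emb_typed (hp : ∀ n, (σ n).IsProp = true)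
    (h : ∀ n A, Γ[n]? = some A →
      MTT.Der Δ.emb (Jdg.embKind (.tm (σ n) ((A.wk (n + 1)).subst σ)))) (n : ℕ) (A : MTT.Exp)
    (hn : Γ.emb[n]? = some A) :
    MTT.Der Δ.emb (.tm (embSub σ n) ((A.wk (n + 1)).subst (embSub σ))) := by
  obtain ⟨B, hB, rfl⟩ : ∃ B, Γ[n]? = some B ∧ B.emb .asTy = A := by simpa using hn
  have := h n B hB
  simp only [Jdg.embKind, emb_subst hp, wk, emb_ren] at this
  exact this

theorem emb_typedEq (hp : ∀ n, (σ n).IsProp = true)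
    (h : ∀ n A, Γ[n]? = some A →
      MTT.Der Δ.emb (Jdg.embKind (.tmEq (σ n) (τ n) ((A.wk (n + 1)).subst σ)))) (n : ℕ)
    (A : MTT.Exp) (hn : Γ.emb[n]? = some A) :
    MTT.Der Δ.emb (.tmEq (embSub σ n) (embSub τ n) ((A.wk (n + 1)).subst (embSub σ))) := by
  obtain ⟨B, hB, rfl⟩ : ∃ B, Γ[n]? = some B ∧ B.emb .asTy = A := by simpa using hn
  have := h n B hB
  simp only [Jdg.embKind, emb_subst hp, wk, emb_ren] at this
  exact this

theorem emb_tail (t : ∀ n, Γ.length ≤ n → ∃ m, σ n = Exp.var m) (n : ℕ)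
    (hn : Γ.emb.length ≤ n) : ∃ m, embSub σ n = MTT.Exp.var m := by
  obtain ⟨m, hm⟩ := t n (by simpa using hn)
  exact ⟨m, by simp [embSub, hm, emb, Role.ofTm]⟩

theorem emb_tailEq (t : ∀ n, Γ.length ≤ n → ∃ m, σ n = Exp.var m ∧ τ n = Exp.var m) (n : ℕ)
    (hn : Γ.emb.length ≤ n) :
    ∃ m, embSub σ n = MTT.Exp.var m ∧ embSub τ n = MTT.Exp.var m := by
  obtain ⟨m, hm, hm'⟩ := t n (by simpa using hn)
  exact ⟨m, by simp [embSub, hm, emb, Role.ofTm], by simp [embSub, hm', emb, Role.ofTm]⟩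

end

section

variable {Γ : MTT.Ctx} {C t : Exp} {x y : MTT.Exp}

theorem emb_tm_inst (h : t.IsProp = true)
    (d : MTT.Der Γ (.tm x ((C.emb .asTy).inst (t.emb .asTm)))) :
    MTT.Der Γ (.tm x ((C.inst t).emb .asTy)) := by
  rwa [emb_inst h]

theorem emb_tmEq_inst (h : t.IsProp = true)
    (d : MTT.Der Γ (.tmEq x y ((C.emb .asTy).inst (t.emb .asTm)))) :
    MTT.Der Γ (.tmEq x y ((C.inst t).emb .asTy)) := by
  rwa [emb_inst h]

theorem emb_tm_inst' (h : t.IsProp = true) (d : MTT.Der Γ (.tm x ((C.inst t).emb .asTy))) :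
    MTT.Der Γ (.tm x ((C.emb .asTy).inst (t.emb .asTm))) := by
  rwa [← emb_inst h]

theorem emb_tmEq_inst' (h : t.IsProp = true)
    (d : MTT.Der Γ (.tmEq x y ((C.inst t).emb .asTy))) :
    MTT.Der Γ (.tmEq x y ((C.emb .asTy).inst (t.emb .asTm))) := by
  rwa [← emb_inst h]

end

/-- The codomain is displayed as a decoded term, the form in which the induction hypothesis for a
term of `prop` provides it. -/
theorem emb_pi_asTm {A φ : Exp} (h : φ.IsProp = true) :
    (pi A φ).emb .asTm = .code (.all (A.emb .asTy) (.dec (φ.emb .asTm))) := by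
  simp only [emb, if_pos h, emb_of_isProp h .asTy]
  rfl

theorem emb_pi_asTy (A B : Exp) :
    (pi A B).emb .asTy = .prod B.IsProp (A.emb .asTy) (B.emb .asTy) := rfl

theorem emb_lam_asTm (A B b : Exp) :
    (lam A B b).emb .asTm = .prodLam B.IsProp (A.emb .asTy) (B.emb .asTy) (b.emb .asTm) := rfl

theorem emb_app_asTm (A B f a : Exp) :
    (app A B f a).emb .asTm =
      .prodApp B.IsProp (A.emb .asTy) (B.emb .asTy) (f.emb .asTm) (a.emb .asTm) := rfl

/-- The type of the branch of an eliminator. -/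
theorem emb_pairType (A B C : Exp) :
    (C.instWk 2 (.pair (A.wk 2) (B.wkUnder 2) (.var 1) (.var 0))).emb .asTy =
      (C.emb .asTy).instWk 2
        (.pair ((A.emb .asTy).wk 2) ((B.emb .asTy).wkUnder 2) (.var 1) (.var 0)) := by
  rw [emb_instWk rfl, ← emb_wk, ← emb_wkUnder]; rfl

theorem emb_consType (A C : Exp) :
    (C.instWk 3 (.cons (A.wk 3) (.var 2) (.var 1))).emb .asTy =
      (C.emb .asTy).instWk 3 (.cons ((A.emb .asTy).wk 3) (.var 2) (.var 1)) := by
  rw [emb_instWk rfl, ← emb_wk]; rfl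

theorem emb_consCtx (A C : Exp) (Γ : Ctx) :
    Ctx.emb (C.instWk 2 (.var 1) :: A.wk 1 :: .list A :: Γ) =
      (C.emb .asTy).instWk 2 (.var 1) :: (A.emb .asTy).wk 1 :: .list (A.emb .asTy) :: Γ.emb := by
  simp only [Ctx.emb, List.map_cons, emb_instWk (isProp_var 1), emb_wk]; rfl

theorem emb_inlType (A B C : Exp) :
    (C.instWk 1 (.inl (A.wk 1) (B.wk 1) (.var 0))).emb .asTy =
      (C.emb .asTy).instWk 1 (.inl ((A.emb .asTy).wk 1) ((B.emb .asTy).wk 1) (.var 0)) := by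
  rw [emb_instWk rfl, ← emb_wk, ← emb_wk]; rfl

theorem emb_inrType (A B C : Exp) :
    (C.instWk 1 (.inr (A.wk 1) (B.wk 1) (.var 0))).emb .asTy =
      (C.emb .asTy).instWk 1 (.inr ((A.emb .asTy).wk 1) ((B.emb .asTy).wk 1) (.var 0)) := by
  rw [emb_instWk rfl, ← emb_wk, ← emb_wk]; rfl

/-- The statement tracks kinds because `∀` requires its codomain to be a small proposition: knowing
only that it is a set would block the induction at products. The rule for each product is chosen by
the test on the codomain, and the side conditions for commuting with substitution come from
`Deriv.propOk`. -/
theorem Deriv.emb {Γ J} (h : Deriv Γ J) : MTT.Der Γ.emb J.embKind := by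
  induction h
  case ctxNil => exact .ctxNil
  case ctxCons a => exact .ctxCons a.col_of
  case var hn a =>
    simp only [Jdg.embKind, emb_wk]
    exact .var a (by simp [hn])
  case sub hσ t a b c =>
    have h := isProp_of_lookup (fun n A hn => (hσ n A hn).isProp_tm) t
    rw [Jdg.embKind_subst h]
    exact .sub a b (emb_typed h c) (emb_tail t)
  case subTy hσ hτ _ t a b c d e =>
    have h := isProp_of_lookup (fun n A hn => (hσ n A hn).isProp_tm)
      fun n hn => (t n hn).imp fun _ h => h.1
    have h' := isProp_of_lookup (fun n A hn => (hτ n A hn).isProp_tm)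
      fun n hn => (t n hn).imp fun _ h => h.2
    simp only [Jdg.embKind, emb_subst h, emb_subst h', isProp_subst h]
    exact .subTy a b (emb_typed h c) (emb_typed h' d) (emb_typedEq h e) (emb_tailEq t)
  case subTm hσ hτ _ t a b c d e =>
    have h := isProp_of_lookup (fun n A hn => (hσ n A hn).isProp_tm)
      fun n hn => (t n hn).imp fun _ h => h.1
    have h' := isProp_of_lookup (fun n A hn => (hτ n A hn).isProp_tm)
      fun n hn => (t n hn).imp fun _ h => h.2
    simp only [Jdg.embKind, emb_subst h, emb_subst h']
    exact .subTm a b (emb_typed h c) (emb_typed h' d) (emb_typedEq h e) (emb_tailEq t)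
  case tyRefl a => exact .tyRefl a
  case tySymm h a =>
    -- The kind is read off the left-hand type, so exchanging the sides requires that they agree on
    -- the test.
    simp only [Jdg.embKind, ← h.isProp_tyEq]
    exact .tySymm a
  case tyTrans h _ a b =>
    simp only [Jdg.embKind, ← h.isProp_tyEq] at b
    exact .tyTrans a b
  case tmRefl a => exact .tmRefl a
  case tmSymm a => exact .tmSymm a
  case tmTrans a b => exact .tmTrans a b
  case conv a b => exact .conv a b.colEq_of
  case convEq a b => exact .convEq a b.colEq_of
  -- Resizing: in `MTT` the universe is given as a collection, but every type of `CC` has to land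
  -- among the sets.
  case propF a => exact .colSet (.univF a)
  case propE h a =>
    -- A term of `prop` passes the test, so as a type it is the decoding of its translation as a
    -- term.
    simp only [Jdg.embKind, h.isProp_tm, emb_of_isProp h.isProp_tm .asTy]
    exact .univE a
  case propEEq h a =>
    simp only [Jdg.embKind, h.isProp_left, emb_of_isProp h.isProp_left .asTy,
      emb_of_isProp h.isProp_right .asTy]
    exact .univEEq a
  case piF a b => exact .prodF a.set_of b
  case piCong h a b c =>
    simp only [Jdg.embKind, emb_pi_asTy, IsProp, ← h.isProp_tyEq]
    exact .prodCong a.set_of b.setEq_of c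
  case piProp h a b =>
    simp only [Jdg.embKind, emb_pi_asTm h.isProp_tm]
    exact .univI (.allF .small a.set_of (.univE b))
  case piPropCong h a b c =>
    simp only [Jdg.embKind, emb_pi_asTm h.isProp_left, emb_pi_asTm h.isProp_right]
    exact .univIEq (.allCong .small a.set_of b.setEq_of (.univEEq c))
  case piI a b c => exact .prodI a.set_of b c
  case lamCong h _ a b c d e =>
    simp only [Jdg.embKind, emb_pi_asTy, emb_lam_asTm, ← h.isProp_tyEq]
    exact .prodLamCong a.set_of b c.setEq_of d e
  case piE ha a b c d => exact emb_tm_inst ha.isProp_tm (.prodE a.set_of b c d)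
  case appCong h _ ha a b c d e f =>
    refine emb_tmEq_inst ha.isProp_left ?_
    simp only [emb_app_asTm, ← h.isProp_tyEq]
    exact .prodAppCong a.set_of b c.setEq_of d e f
  case piC hb ha a b c d =>
    simp only [Jdg.embKind, emb_app_asTm, emb_lam_asTm, emb_inst ha.isProp_tm]
    exact .prodC a.set_of b c d
  case emptyF a => exact .emptyF a
  case emptyE h a b => exact emb_tm_inst h.isProp_tm (.emptyE a.col_of b)
  case elEmptyCong h a b => exact emb_tmEq_inst h.isProp_left (.elEmptyCong a.colEq_of b)
  case unitF a => exact .unitF a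
  case unitI a => exact .unitI a
  case unitE h _ a b c =>
    exact emb_tm_inst h.isProp_tm (.unitE a.col_of b (emb_tm_inst' (t := .star) rfl c))
  case unitC a b =>
    exact emb_tmEq_inst rfl (.unitC a.col_of (emb_tm_inst' (t := .star) rfl b))
  case elUnitCong h _ a b c =>
    exact emb_tmEq_inst h.isProp_left
      (.elUnitCong a.colEq_of b (emb_tmEq_inst' (t := .star) rfl c))
  case sigF a b => exact .sigF .small a.set_of b.set_of
  case sigCong a b c => exact .sigCong .small a.set_of b.setEq_of c.setEq_of
  case sigI h _ a b c d => exact .sigI a.col_of b.col_of c (emb_tm_inst' h.isProp_tm d)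
  case pairCong h _ a b c d e =>
    exact .pairCong a.col_of b.colEq_of c.colEq_of d (emb_tmEq_inst' h.isProp_left e)
  case sigE h _ a b c d e =>
    simp only [Jdg.embKind, emb_pairType] at e
    exact emb_tm_inst h.isProp_tm (.sigE a.col_of b.col_of c.col_of d e)
  case elSigCong h _ a b c d e f g =>
    simp only [Jdg.embKind, emb_pairType] at g
    exact emb_tmEq_inst h.isProp_left
      (.elSigCong a.col_of b.col_of c.colEq_of d.colEq_of e.colEq_of f g)
  case sigC ha hb _ a b c d e f =>
    simp only [Jdg.embKind, emb_pairType] at f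
    have := MTT.Der.sigC a.col_of b.col_of c.col_of d (emb_tm_inst' ha.isProp_tm e) f
    refine emb_tmEq_inst rfl ?_
    rwa [emb_inst₂ ha.isProp_tm hb.isProp_tm]
  case listF a => exact .listF a.set_of
  case listCong a => exact .listCong a.setEq_of
  case listNil a => exact .listNil a.set_of
  case nilCong a => exact .nilCong a.setEq_of
  case listCons a b c => exact .listCons a.set_of b c
  case consCong a b c => exact .consCong a.setEq_of b c
  case listE h _ _ a b c d e =>
    simp only [Jdg.embKind, emb_consType, emb_consCtx] at e
    exact emb_tm_inst h.isProp_tm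
      (.listE a.set_of b.col_of c (emb_tm_inst' (t := .nil _) rfl d) e)
  case elListCong h _ _ a b c d e f g =>
    simp only [Jdg.embKind, emb_consType, emb_consCtx] at g
    exact emb_tmEq_inst h.isProp_left (.elListCong a.set_of b.col_of c.setEq_of d.colEq_of e
      (emb_tmEq_inst' (t := .nil _) rfl f) g)
  case listCNil a b c d =>
    simp only [Jdg.embKind, emb_consType, emb_consCtx] at d
    exact emb_tmEq_inst rfl
      (.listCNil a.set_of b.col_of (emb_tm_inst' (t := .nil _) rfl c) d)
  case listCCons hs hc _ _ a b c d e f =>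
    simp only [Jdg.embKind, emb_consType, emb_consCtx] at f
    have := MTT.Der.listCCons a.set_of b.col_of c d (emb_tm_inst' (t := .nil _) rfl e) f
    refine emb_tmEq_inst rfl ?_
    rwa [emb_subst (by simp [hs.isProp_tm, hc.isProp_tm, IsProp]), embSub_scons, embSub_scons,
      embSub_scons]
  case sumF a b => exact .sumF a.set_of b.set_of
  case sumCong a b => exact .sumCong a.setEq_of b.setEq_of
  case sumInl a b c => exact .sumInl a.set_of b.set_of c
  case inlCong a b c => exact .inlCong a.setEq_of b.setEq_of c
  case sumInr a b c => exact .sumInr a.set_of b.set_of c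
  case inrCong a b c => exact .inrCong a.setEq_of b.setEq_of c
  case sumE h _ _ a b c d e f =>
    simp only [Jdg.embKind, emb_inlType, emb_inrType] at e f
    exact emb_tm_inst h.isProp_tm (.sumE a.set_of b.set_of c.col_of d e f)
  case elSumCong hw _ _ a b c d e f g h =>
    simp only [Jdg.embKind, emb_inlType, emb_inrType] at g h
    exact emb_tmEq_inst hw.isProp_left
      (.elSumCong a.set_of b.set_of c.setEq_of d.setEq_of e.colEq_of f g h)
  case sumCInl h _ _ a b c d e f =>
    simp only [Jdg.embKind, emb_inlType, emb_inrType] at e f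
    refine emb_tmEq_inst rfl ?_
    rw [emb_inst h.isProp_tm]
    exact .sumCInl a.set_of b.set_of c.col_of d e f
  case sumCInr h _ _ a b c d e f =>
    simp only [Jdg.embKind, emb_inlType, emb_inrType] at e f
    refine emb_tmEq_inst rfl ?_
    rw [emb_inst h.isProp_tm]
    exact .sumCInr a.set_of b.set_of c.col_of d e f

/-- The finer kinds of `Jdg.embKind` are forgotten through the inclusion of small propositions in
sets. -/
theorem Der.emb {Γ J} (h : Der Γ J) : MTT.Der Γ.emb J.emb := by
  have d := h.deriv.emb
  cases J with
  | ty A => exact d.set_of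
  | tyEq A B => exact d.setEq_of
  | _ => exact d

theorem enc_emb_ctx (Γ : Ctx) : Γ.emb.map MTT.Exp.enc = Γ := by
  simp [Ctx.emb, Function.comp_def, enc_emb]

theorem Jdg.enc_emb (J : Jdg) : J.emb.enc = J := by
  cases J <;> simp [Jdg.emb, CC.Exp.enc_emb]

/-- Reflection costs nothing more: a derivation in `MTT` is sent to `CC` by soundness, and there the
translated judgement is the original one. -/
theorem der_iff_emb (Γ : Ctx) (J : Jdg) : Der Γ J ↔ MTT.Der Γ.emb J.emb :=
  ⟨Der.emb, fun h => by simpa only [enc_emb_ctx, Jdg.enc_emb] using h.enc⟩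

theorem der_prop_iff_emb (Γ : Ctx) (φ : Exp) :
    Der Γ (.tm φ .prop) ↔ MTT.Der Γ.emb (.ty .prop (φ.emb .asTy)) := by
  refine ⟨fun h => ?_, fun h => ?_⟩
  · rw [emb_of_isProp h.deriv.isProp_tm .asTy]
    exact .propsProp (.univE h.emb)
  · have := h.enc
    rwa [enc_emb_ctx, MTT.Jdg.enc, Exp.enc_emb] at this

end CC

/-! ## Natural deduction in `MTT` -/

namespace MTT

open Exp

variable {Γ : Ctx} {J : Jdg} {k : Kind} {A B a b c φ ψ ξ χ P : Exp}

theorem Der.ctx (h : Der Γ J) : Der Γ .ctx := by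
  induction h <;> first | assumption | exact .ctxNil | exact .ctxCons ‹_›

theorem Der.weak (h : Der Γ J) (hA : Der Γ (.ty .col A)) : Der (A :: Γ) (J.subst (shift 1)) := by
  refine .sub h (.ctxCons hA) (fun n B hn => ?_) fun n _ => ⟨_, rfl⟩
  have : Der (A :: Γ) _ := .var (.ctxCons hA) (n := n + 1) (A := B) hn
  simpa using this

/-- The fresh variable is inserted below the last one, so a family over `B` remains a family over
the weakened `B` after a hypothesis is added. -/
theorem Der.weakUnder (h : Der (B :: Γ) J) (hB : Der Γ (.ty .col B)) (hA : Der Γ (.ty .col A)) :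
    Der (B.subst (shift 1) :: A :: Γ) (J.subst (scons (Exp.var 0) (shift 2))) := by
  have hc := Der.ctxCons (hB.weak hA)
  refine .sub h hc (fun n C hn => ?_) fun n _ => ?_
  · cases n with
    | zero =>
      obtain rfl : B = C := by simpa using hn
      simpa using Der.var hc (n := 0) rfl
    | succ n =>
      have : Der (B.subst (shift 1) :: A :: Γ) _ := .var hc (n := n + 2) (A := C) hn
      simpa using this
  · cases n with
    | zero => exact ⟨0, rfl⟩
    | succ n => exact ⟨n + 2, rfl⟩

theorem Der.head (hA : Der Γ (.ty .col A)) :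
    Der (A :: Γ) (.tm (Exp.var 0) (A.subst (shift 1))) := by
  simpa using Der.var (.ctxCons hA) (n := 0) rfl

theorem Der.tyAll (hA : Der Γ (.ty .col A)) (h : Der (A :: Γ) (.ty .prop φ)) :
    Der Γ (.ty .prop (.all A φ)) :=
  .allF .large hA h

theorem Der.tyAllImp (hφ : Der Γ (.ty .prop φ)) (hψ : Der Γ (.ty .prop ψ)) :
    Der Γ (.ty .prop (.allImp φ ψ)) :=
  .tyAll hφ.largeTy (by simpa using hψ.weak hφ.largeTy)

theorem Der.tyDec (hc : Der Γ (.tm c .univ)) : Der Γ (.ty .prop (.dec c)) :=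
  hc.univE.propsProp

/-- Resizing enters here: even a proposition quantifying over collections has a code, which is what
makes the encodings impredicative. -/
theorem Der.tmCode (h : Der Γ (.ty .prop φ)) : Der Γ (.tm (.code φ) .univ) :=
  h.propProps.univI

theorem Der.decCode (h : Der Γ (.ty .prop φ)) : Der Γ (.tyEq .col (.dec (.code φ)) φ) :=
  h.propProps.univC.smallTyEq.setColEq

section

variable (σ : ℕ → Exp)

@[simp] theorem Exp.subst_allImp :
    (allImp φ ψ).subst σ = allImp (φ.subst σ) (ψ.subst σ) := by
  simp [allImp]

@[simp] theorem Exp.subst_orImpred :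
    (orImpred φ ψ).subst σ = orImpred (φ.subst σ) (ψ.subst σ) := by
  simp [orImpred]

@[simp] theorem Exp.subst_andImpred :
    (andImpred φ ψ).subst σ = andImpred (φ.subst σ) (ψ.subst σ) := by
  simp [andImpred]

@[simp] theorem Exp.subst_exImpred :
    (exImpred A φ).subst σ = exImpred (A.subst σ) (φ.subst (up σ)) := by
  simp [exImpred]

@[simp] theorem Exp.subst_identImpred :
    (identImpred A a b).subst σ = identImpred (A.subst σ) (a.subst σ) (b.subst σ) := by
  simp [identImpred]

end

/-- `φ` has a proof-term. -/
def Prov (Γ : Ctx) (φ : Exp) : Prop := ∃ t, Der Γ (.tm t φ)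

namespace Prov

theorem weak (h : Prov Γ φ) (hA : Der Γ (.ty .col A)) : Prov (A :: Γ) (φ.subst (shift 1)) :=
  let ⟨_, h⟩ := h
  ⟨_, h.weak hA⟩

theorem hyp (h : Der Γ (.ty .prop φ)) : Prov (φ :: Γ) (φ.subst (shift 1)) := ⟨_, .head h.largeTy⟩

theorem conv (h : Prov Γ φ) (e : Der Γ (.tyEq .col φ ψ)) : Prov Γ ψ :=
  let ⟨_, h⟩ := h
  ⟨_, h.conv e⟩

theorem ofDecCode (h : Prov Γ (.dec (.code φ))) (hφ : Der Γ (.ty .prop φ)) : Prov Γ φ :=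
  h.conv hφ.decCode

theorem allI (hA : Der Γ (.ty .col A)) (hφ : Der (A :: Γ) (.ty .prop φ)) (h : Prov (A :: Γ) φ) :
    Prov Γ (.all A φ) :=
  let ⟨_, h⟩ := h
  ⟨_, .allIn hA hφ h⟩

theorem allE (h : Prov Γ (.all A φ)) (hA : Der Γ (.ty .col A)) (hφ : Der (A :: Γ) (.ty .prop φ))
    (ha : Der Γ (.tm a A)) : Prov Γ (φ.subst (scons a var)) :=
  let ⟨_, h⟩ := h
  ⟨_, .allEl hA hφ h ha⟩

theorem allImpI (hφ : Der Γ (.ty .prop φ)) (hψ : Der Γ (.ty .prop ψ))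
    (h : Prov (φ :: Γ) (ψ.subst (shift 1))) : Prov Γ (.allImp φ ψ) := by
  rw [← wk_eq] at h
  exact .allI hφ.largeTy (by simpa using hψ.weak hφ.largeTy) h

theorem allImpE (h : Prov Γ (.allImp φ ψ)) (hφ : Der Γ (.ty .prop φ)) (hψ : Der Γ (.ty .prop ψ))
    (h' : Prov Γ φ) : Prov Γ ψ := by
  obtain ⟨t, ht⟩ := h'
  have := Prov.allE h hφ.largeTy (by simpa using hψ.weak hφ.largeTy) ht
  simpa using this

/-- The quantification is weakened and instantiated at the fresh variable; the two substitutions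
cancel. -/
theorem allHead (h : Prov Γ (.all A φ)) (hA : Der Γ (.ty .col A))
    (hφ : Der (A :: Γ) (.ty .prop φ)) : Prov (A :: Γ) φ := by
  have := Prov.allE (A := A.subst (shift 1)) (φ := φ.subst (scons (var 0) (shift 2)))
    (by simpa using h.weak hA) (hA.weak hA) (hφ.weakUnder hA hA) (.head hA)
  simpa using this

theorem allImpHead (h : Prov Γ (.allImp φ ψ)) (hφ : Der Γ (.ty .prop φ))
    (hψ : Der Γ (.ty .prop ψ)) : Prov (φ :: Γ) (ψ.subst (shift 1)) := by
  simpa using Prov.allHead h hφ.largeTy (by simpa using hψ.weak hφ.largeTy)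

theorem allImpRefl (hφ : Der Γ (.ty .prop φ)) : Prov Γ (.allImp φ φ) := .allImpI hφ hφ (.hyp hφ)

theorem impI (hφ : Der Γ (.ty .prop φ)) (hψ : Der Γ (.ty .prop ψ))
    (h : Prov (φ :: Γ) (ψ.subst (shift 1))) : Prov Γ (.imp φ ψ) := by
  rw [← wk_eq] at h
  obtain ⟨t, h⟩ := h
  exact ⟨_, .impIn hφ hψ h⟩

theorem impE (h : Prov Γ (.imp φ ψ)) (hφ : Der Γ (.ty .prop φ)) (hψ : Der Γ (.ty .prop ψ))
    (h' : Prov Γ φ) : Prov Γ ψ :=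
  let ⟨_, h⟩ := h
  let ⟨_, h'⟩ := h'
  ⟨_, .impEl hφ hψ h h'⟩

theorem iffI (hφ : Der Γ (.ty .prop φ)) (hψ : Der Γ (.ty .prop ψ))
    (h : Prov (φ :: Γ) (ψ.subst (shift 1))) (h' : Prov (ψ :: Γ) (φ.subst (shift 1))) :
    Prov Γ (.iff φ ψ) :=
  let ⟨_, h⟩ := impI hφ hψ h
  let ⟨_, h'⟩ := impI hψ hφ h'
  ⟨_, .andIn (.impF .large hφ hψ) (.impF .large hψ hφ) h h'⟩

theorem botE (h : Prov Γ .bot) (hξ : Der Γ (.ty .prop ξ)) : Prov Γ ξ :=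
  let ⟨_, h⟩ := h
  ⟨_, .botE hξ h⟩

theorem orE (h : Prov Γ (.or φ ψ)) (hφ : Der Γ (.ty .prop φ)) (hψ : Der Γ (.ty .prop ψ))
    (hξ : Der Γ (.ty .prop ξ)) (l : Prov (φ :: Γ) (ξ.subst (shift 1)))
    (r : Prov (ψ :: Γ) (ξ.subst (shift 1))) : Prov Γ ξ := by
  rw [← wk_eq] at l r
  obtain ⟨_, h⟩ := h
  obtain ⟨_, l⟩ := l
  obtain ⟨_, r⟩ := r
  exact ⟨_, .orE hφ hψ hξ h l r⟩

theorem orInl (h : Prov Γ φ) (hφ : Der Γ (.ty .prop φ)) (hψ : Der Γ (.ty .prop ψ)) :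
    Prov Γ (.or φ ψ) :=
  let ⟨_, h⟩ := h
  ⟨_, .orIL hφ hψ h⟩

theorem orInr (h : Prov Γ ψ) (hφ : Der Γ (.ty .prop φ)) (hψ : Der Γ (.ty .prop ψ)) :
    Prov Γ (.or φ ψ) :=
  let ⟨_, h⟩ := h
  ⟨_, .orIR hφ hψ h⟩

theorem andI (h : Prov Γ φ) (h' : Prov Γ ψ) (hφ : Der Γ (.ty .prop φ))
    (hψ : Der Γ (.ty .prop ψ)) : Prov Γ (.and φ ψ) :=
  let ⟨_, h⟩ := h
  let ⟨_, h'⟩ := h'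
  ⟨_, .andIn hφ hψ h h'⟩

theorem andL (h : Prov Γ (.and φ ψ)) (hφ : Der Γ (.ty .prop φ)) (hψ : Der Γ (.ty .prop ψ)) :
    Prov Γ φ :=
  let ⟨_, h⟩ := h
  ⟨_, .andEL hφ hψ h⟩

theorem andR (h : Prov Γ (.and φ ψ)) (hφ : Der Γ (.ty .prop φ)) (hψ : Der Γ (.ty .prop ψ)) :
    Prov Γ ψ :=
  let ⟨_, h⟩ := h
  ⟨_, .andER hφ hψ h⟩

theorem exI (h : Prov Γ (φ.subst (scons a var))) (hA : Der Γ (.ty .col A))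
    (hφ : Der (A :: Γ) (.ty .prop φ)) (ha : Der Γ (.tm a A)) : Prov Γ (.ex A φ) :=
  let ⟨_, h⟩ := h
  ⟨_, .exIn hA hφ ha h⟩

theorem exE (h : Prov Γ (.ex A φ)) (hA : Der Γ (.ty .col A)) (hφ : Der (A :: Γ) (.ty .prop φ))
    (hξ : Der Γ (.ty .prop ξ)) (m : Prov (φ :: A :: Γ) (ξ.subst (shift 2))) : Prov Γ ξ := by
  rw [← wk_eq] at m
  obtain ⟨_, h⟩ := h
  obtain ⟨_, m⟩ := m
  exact ⟨_, .exE hA hφ hξ h m⟩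

theorem identE (h : Prov Γ (.ident A a b)) (hA : Der Γ (.ty .col A))
    (hξ : Der (A.subst (shift 1) :: A :: Γ) (.ty .prop ξ)) (ha : Der Γ (.tm a A))
    (hb : Der Γ (.tm b A)) (c : Prov (A :: Γ) (ξ.subst (scons (var 0) var))) :
    Prov Γ (ξ.subst (scons b (scons a var))) := by
  rw [← wk_eq] at hξ
  obtain ⟨_, h⟩ := h
  obtain ⟨_, c⟩ := c
  exact ⟨_, .identE hA hξ ha hb h c⟩

end Prov

theorem Der.decHead (h : Der Γ .ctx) : Der (.univ :: Γ) (.ty .prop (.dec (Exp.var 0))) :=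
  .tyDec (.head (.univF h))

/-! ### The impredicative encodings -/

theorem Der.tyBotImpred (h : Der Γ .ctx) : Der Γ (.ty .prop .botImpred) :=
  .tyAll (.univF h) (.decHead h)

/-- From right to left, `p` is instantiated at the code of `⊥` itself. -/
theorem Prov.iff_botImpred (h : Der Γ .ctx) : Prov Γ (.iff .bot .botImpred) := by
  have hb := (Der.botF h).propsProp
  have hi := Der.tyBotImpred h
  refine .iffI hb hi (.botE (.hyp hb) (hi.weak hb.largeTy)) ?_
  have hc := Der.ctxCons hi.largeTy
  have hb' := (Der.botF hc).propsProp
  exact .ofDecCode (.allE (.hyp hi) (.univF hc) (.decHead hc) hb'.tmCode) hb'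

/-! ### The matrices of the encodings at an arbitrary proposition `ξ` -/

theorem Der.tyOrMatrix (hφ : Der Γ (.ty .prop φ)) (hψ : Der Γ (.ty .prop ψ))
    (hξ : Der Γ (.ty .prop ξ)) :
    Der Γ (.ty .prop (.allImp (.allImp φ ξ) (.allImp (.allImp ψ ξ) ξ))) :=
  .tyAllImp (.tyAllImp hφ hξ) (.tyAllImp (.tyAllImp hψ hξ) hξ)

theorem Der.tyAndMatrix (hφ : Der Γ (.ty .prop φ)) (hψ : Der Γ (.ty .prop ψ))
    (hξ : Der Γ (.ty .prop ξ)) :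
    Der Γ (.ty .prop (.allImp (.allImp φ (.allImp ψ ξ)) ξ)) :=
  .tyAllImp (.tyAllImp hφ (.tyAllImp hψ hξ)) hξ

theorem Der.tyExMatrix (hA : Der Γ (.ty .col A)) (hφ : Der (A :: Γ) (.ty .prop φ))
    (hξ : Der Γ (.ty .prop ξ)) :
    Der Γ (.ty .prop (.allImp (.all A (.allImp φ (ξ.subst (shift 1)))) ξ)) :=
  .tyAllImp (.tyAll hA (.tyAllImp hφ (hξ.weak hA))) hξ

namespace Prov

theorem orMatrix_left (h : Prov Γ φ) (hφ : Der Γ (.ty .prop φ)) (hψ : Der Γ (.ty .prop ψ))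
    (hξ : Der Γ (.ty .prop ξ)) :
    Prov Γ (.allImp (.allImp φ ξ) (.allImp (.allImp ψ ξ) ξ)) := by
  have h₁ := Der.tyAllImp hφ hξ
  have h₂ := Der.tyAllImp hψ hξ
  have w := h₁.largeTy
  refine .allImpI h₁ (.tyAllImp h₂ hξ) ?_
  have key : Prov (.allImp φ ξ :: Γ) (ξ.subst (shift 1)) :=
    .allImpE (by simpa using Prov.hyp h₁) (hφ.weak w) (hξ.weak w) (h.weak w)
  simpa using Prov.allImpI (h₂.weak w) (hξ.weak w) (key.weak (h₂.weak w).largeTy)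

theorem orMatrix_right (h : Prov Γ ψ) (hφ : Der Γ (.ty .prop φ)) (hψ : Der Γ (.ty .prop ψ))
    (hξ : Der Γ (.ty .prop ξ)) :
    Prov Γ (.allImp (.allImp φ ξ) (.allImp (.allImp ψ ξ) ξ)) := by
  have h₁ := Der.tyAllImp hφ hξ
  have h₂ := Der.tyAllImp hψ hξ
  have key : Prov Γ (.allImp (.allImp ψ ξ) ξ) :=
    .allImpI h₂ hξ (.allImpE (by simpa using Prov.hyp h₂) (hψ.weak h₂.largeTy)
      (hξ.weak h₂.largeTy) (h.weak h₂.largeTy))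
  exact .allImpI h₁ (.tyAllImp h₂ hξ) (key.weak h₁.largeTy)

theorem orMatrix (h : Prov Γ (.or φ ψ)) (hφ : Der Γ (.ty .prop φ)) (hψ : Der Γ (.ty .prop ψ))
    (hξ : Der Γ (.ty .prop ξ)) :
    Prov Γ (.allImp (.allImp φ ξ) (.allImp (.allImp ψ ξ) ξ)) := by
  refine .orE h hφ hψ (.tyOrMatrix hφ hψ hξ) ?_ ?_
  · have w := hφ.largeTy
    simpa using Prov.orMatrix_left (.hyp hφ) (hφ.weak w) (hψ.weak w) (hξ.weak w)
  · have w := hψ.largeTy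
    simpa using Prov.orMatrix_right (.hyp hψ) (hφ.weak w) (hψ.weak w) (hξ.weak w)

/-- The intended `ξ` is the decoded code of the disjunction, equal to the disjunction only
judgementally. The two injections, converted along that equality, serve as the continuations. -/
theorem orMatrix_self (e : Der Γ (.tyEq .col (.or φ ψ) ξ)) (hξ : Der Γ (.ty .prop ξ))
    (h : Prov Γ (.allImp (.allImp φ ξ) (.allImp (.allImp ψ ξ) ξ)))
    (hφ : Der Γ (.ty .prop φ)) (hψ : Der Γ (.ty .prop ψ)) : Prov Γ (.or φ ψ) := by
  have h₁ := Der.tyAllImp hφ hξ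
  have h₂ := Der.tyAllImp hψ hξ
  refine conv (.allImpE (.allImpE h h₁ (.tyAllImp h₂ hξ) (.allImpI hφ hξ ?_)) h₂ hξ
    (.allImpI hψ hξ ?_)) e.tySymm
  · exact .conv (.orInl (.hyp hφ) (hφ.weak hφ.largeTy) (hψ.weak hφ.largeTy)) (e.weak hφ.largeTy)
  · exact .conv (.orInr (.hyp hψ) (hφ.weak hψ.largeTy) (hψ.weak hψ.largeTy)) (e.weak hψ.largeTy)

theorem andMatrix (h : Prov Γ φ) (h' : Prov Γ ψ) (hφ : Der Γ (.ty .prop φ))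
    (hψ : Der Γ (.ty .prop ψ)) (hξ : Der Γ (.ty .prop ξ)) :
    Prov Γ (.allImp (.allImp φ (.allImp ψ ξ)) ξ) := by
  have h₂ := Der.tyAllImp hψ hξ
  have h₁ := Der.tyAllImp hφ h₂
  have w := h₁.largeTy
  have key : Prov (.allImp φ (.allImp ψ ξ) :: Γ)
      (.allImp (ψ.subst (shift 1)) (ξ.subst (shift 1))) :=
    .allImpE (by simpa using Prov.hyp h₁) (hφ.weak w) (.tyAllImp (hψ.weak w) (hξ.weak w))
      (h.weak w)
  exact .allImpI h₁ hξ (.allImpE key (hψ.weak w) (hξ.weak w) (h'.weak w))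

/-- The continuation supplied to the matrix is pairing, with its target converted to `ξ`. -/
theorem andMatrix_self (e : Der Γ (.tyEq .col (.and φ ψ) ξ)) (hξ : Der Γ (.ty .prop ξ))
    (h : Prov Γ (.allImp (.allImp φ (.allImp ψ ξ)) ξ))
    (hφ : Der Γ (.ty .prop φ)) (hψ : Der Γ (.ty .prop ψ)) : Prov Γ (.and φ ψ) := by
  have h₂ := Der.tyAllImp hψ hξ
  have w := hφ.largeTy
  have w' := (hψ.weak w).largeTy
  refine conv (.allImpE h (.tyAllImp hφ h₂) hξ (.allImpI hφ h₂ ?_)) e.tySymm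
  rw [subst_allImp]
  refine .allImpI (hψ.weak w) (hξ.weak w) (.conv (.andI ((Prov.hyp hφ).weak w')
    (.hyp (hψ.weak w)) ((hφ.weak w).weak w') ((hψ.weak w).weak w')) ?_)
  exact (e.weak w).weak w'

theorem exMatrix (h : Prov Γ (.ex A φ)) (hA : Der Γ (.ty .col A))
    (hφ : Der (A :: Γ) (.ty .prop φ)) (hξ : Der Γ (.ty .prop ξ)) :
    Prov Γ (.allImp (.all A (.allImp φ (ξ.subst (shift 1)))) ξ) := by
  have h₁ := Der.tyAll hA (.tyAllImp hφ (hξ.weak hA))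
  have w := h₁.largeTy
  have hA₁ := hA.weak w
  have hφ₁ := hφ.weakUnder hA w
  refine .allImpI h₁ hξ (.exE (by simpa using h.weak w) hA₁ hφ₁ (hξ.weak w) ?_)
  have hξ₂ := (hξ.weak w).weak hA₁
  have k : Prov (.all A (.allImp φ (ξ.subst (shift 1))) :: Γ)
      (.all (A.subst (shift 1)) (.allImp (φ.subst (scons (var 0) (shift 2)))
        ((ξ.subst (shift 1)).subst (shift 1)))) := by simpa using Prov.hyp h₁
  -- The hypothesis applied to the two fresh variables, a witness and its proof, is exactly the
  -- branch of the eliminator.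
  simpa using allImpHead (allHead k hA₁ (.tyAllImp hφ₁ hξ₂)) hφ₁ hξ₂

theorem exMatrix_self (e : Der Γ (.tyEq .col (.ex A φ) ξ)) (hξ : Der Γ (.ty .prop ξ))
    (h : Prov Γ (.allImp (.all A (.allImp φ (ξ.subst (shift 1)))) ξ))
    (hA : Der Γ (.ty .col A)) (hφ : Der (A :: Γ) (.ty .prop φ)) : Prov Γ (.ex A φ) := by
  have h₁ := Der.tyAllImp hφ (hξ.weak hA)
  refine conv (.allImpE h (.tyAll hA h₁) hξ (.allI hA h₁ (.allImpI hφ (hξ.weak hA) ?_))) e.tySymm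
  have w := hφ.largeTy
  have hA₁ := hA.weak hA
  refine .conv ?_ ((e.weak hA).weak w)
  -- The last variable is the proof of `φ`, and `var 1` is the witness. The two weakenings below the
  -- bound variable keep `φ` a family over the weakened `A`.
  have key := Prov.exI (A := (A.subst (shift 1)).subst (shift 1)) (a := var 1)
    (φ := (φ.subst (scons (var 0) (shift 2))).subst (scons (var 0) (shift 2)))
    (by simpa using Prov.hyp hφ) (hA₁.weak w)
    ((hφ.weakUnder hA hA).weakUnder hA₁ w) ((Der.head hA).weak w)
  simpa using key

end Prov

theorem Der.tyOrImpred (hφ : Der Γ (.ty .prop φ)) (hψ : Der Γ (.ty .prop ψ)) :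
    Der Γ (.ty .prop (.orImpred φ ψ)) := by
  have hu := Der.univF hφ.ctx
  exact .tyAll hu (by simpa using Der.tyOrMatrix (hφ.weak hu) (hψ.weak hu) (.decHead hφ.ctx))

theorem Der.tyAndImpred (hφ : Der Γ (.ty .prop φ)) (hψ : Der Γ (.ty .prop ψ)) :
    Der Γ (.ty .prop (.andImpred φ ψ)) := by
  have hu := Der.univF hφ.ctx
  exact .tyAll hu (by simpa using Der.tyAndMatrix (hφ.weak hu) (hψ.weak hu) (.decHead hφ.ctx))

theorem Der.tyExImpred (hA : Der Γ (.ty .col A)) (hφ : Der (A :: Γ) (.ty .prop φ)) :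
    Der Γ (.ty .prop (.exImpred A φ)) := by
  have hu := Der.univF hA.ctx
  exact .tyAll hu (by
    simpa using Der.tyExMatrix (hA.weak hu) (hφ.weakUnder hA hu) (.decHead hA.ctx))

namespace Prov

/-- In one direction `p` is generic; in the other it is instantiated at the code of the disjunction.
-/
theorem iff_orImpred (hφ : Der Γ (.ty .prop φ)) (hψ : Der Γ (.ty .prop ψ)) :
    Prov Γ (.iff (.or φ ψ) (.orImpred φ ψ)) := by
  -- Both directions are stated over an arbitrary context, because they are used after the assumed
  -- side has been added as a hypothesis.
  have intro {Γ φ ψ} (hφ : Der Γ (.ty .prop φ)) (hψ : Der Γ (.ty .prop ψ))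
      (h : Prov Γ (.or φ ψ)) : Prov Γ (.orImpred φ ψ) := by
    have hu := Der.univF hφ.ctx
    have hd := Der.decHead hφ.ctx
    have hm := Der.tyOrMatrix (hφ.weak hu) (hψ.weak hu) hd
    have := Prov.allI hu hm (.orMatrix (h.weak hu) (hφ.weak hu) (hψ.weak hu) hd)
    simpa [Exp.orImpred] using this
  have elim {Γ φ ψ} (hφ : Der Γ (.ty .prop φ)) (hψ : Der Γ (.ty .prop ψ))
      (h : Prov Γ (.orImpred φ ψ)) : Prov Γ (.or φ ψ) := by
    have hu := Der.univF hφ.ctx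
    have hd := Der.decHead hφ.ctx
    have hm := Der.tyOrMatrix (hφ.weak hu) (hψ.weak hu) hd
    have ho := Der.orF .large hφ hψ
    have := Prov.allE (by simpa [Exp.orImpred] using h) hu hm ho.tmCode
    exact .orMatrix_self ho.decCode.tySymm ho.tmCode.tyDec (by simpa using this) hφ hψ
  have ho := Der.orF .large hφ hψ
  have hi := Der.tyOrImpred hφ hψ
  have w := ho.largeTy
  have w' := hi.largeTy
  refine .iffI ho hi ?_ ?_
  · simpa using intro (hφ.weak w) (hψ.weak w) (.hyp ho)
  · simpa using elim (hφ.weak w') (hψ.weak w') (by simpa using Prov.hyp hi)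

theorem iff_andImpred (hφ : Der Γ (.ty .prop φ)) (hψ : Der Γ (.ty .prop ψ)) :
    Prov Γ (.iff (.and φ ψ) (.andImpred φ ψ)) := by
  have intro {Γ φ ψ} (hφ : Der Γ (.ty .prop φ)) (hψ : Der Γ (.ty .prop ψ))
      (h : Prov Γ (.and φ ψ)) : Prov Γ (.andImpred φ ψ) := by
    have hu := Der.univF hφ.ctx
    have hd := Der.decHead hφ.ctx
    have hm := Der.tyAndMatrix (hφ.weak hu) (hψ.weak hu) hd
    have := Prov.allI hu hm (.andMatrix ((h.andL hφ hψ).weak hu) ((h.andR hφ hψ).weak hu)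
      (hφ.weak hu) (hψ.weak hu) hd)
    simpa [Exp.andImpred] using this
  have elim {Γ φ ψ} (hφ : Der Γ (.ty .prop φ)) (hψ : Der Γ (.ty .prop ψ))
      (h : Prov Γ (.andImpred φ ψ)) : Prov Γ (.and φ ψ) := by
    have hu := Der.univF hφ.ctx
    have hd := Der.decHead hφ.ctx
    have hm := Der.tyAndMatrix (hφ.weak hu) (hψ.weak hu) hd
    have ho := Der.andF .large hφ hψ
    have := Prov.allE (by simpa [Exp.andImpred] using h) hu hm ho.tmCode
    exact .andMatrix_self ho.decCode.tySymm ho.tmCode.tyDec (by simpa using this) hφ hψ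
  have ho := Der.andF .large hφ hψ
  have hi := Der.tyAndImpred hφ hψ
  have w := ho.largeTy
  have w' := hi.largeTy
  refine .iffI ho hi ?_ ?_
  · simpa using intro (hφ.weak w) (hψ.weak w) (.hyp ho)
  · simpa using elim (hφ.weak w') (hψ.weak w') (by simpa using Prov.hyp hi)

theorem iff_allImp (hφ : Der Γ (.ty .prop φ)) (hψ : Der Γ (.ty .prop ψ)) :
    Prov Γ (.iff (.imp φ ψ) (.allImp φ ψ)) := by
  have ho := Der.impF .large hφ hψ
  have hi := Der.tyAllImp hφ hψ
  have w := ho.largeTy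
  have w' := hi.largeTy
  refine .iffI ho hi ?_ ?_
  · have hφ₁ := hφ.weak w
    have hψ₁ := hψ.weak w
    have v := hφ₁.largeTy
    rw [subst_allImp]
    exact .allImpI hφ₁ hψ₁ (.impE ((Prov.hyp ho).weak v) (hφ₁.weak v) (hψ₁.weak v) (.hyp hφ₁))
  · have h := Prov.hyp hi
    rw [subst_allImp] at h
    exact .impI (hφ.weak w') (hψ.weak w') (.allImpHead h (hφ.weak w') (hψ.weak w'))

/-- As for the disjunction. Resizing is essential for the code of the existential when `A` is a
genuine collection. -/
theorem iff_exImpred (hA : Der Γ (.ty .col A)) (hφ : Der (A :: Γ) (.ty .prop φ)) :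
    Prov Γ (.iff (.ex A φ) (.exImpred A φ)) := by
  have intro {Γ A φ} (hA : Der Γ (.ty .col A)) (hφ : Der (A :: Γ) (.ty .prop φ))
      (h : Prov Γ (.ex A φ)) : Prov Γ (.exImpred A φ) := by
    have hu := Der.univF hA.ctx
    have hd := Der.decHead hA.ctx
    have hm := Der.tyExMatrix (hA.weak hu) (hφ.weakUnder hA hu) hd
    have := Prov.allI hu hm
      (.exMatrix (by simpa using h.weak hu) (hA.weak hu) (hφ.weakUnder hA hu) hd)
    simpa [Exp.exImpred] using this
  have elim {Γ A φ} (hA : Der Γ (.ty .col A)) (hφ : Der (A :: Γ) (.ty .prop φ))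
      (h : Prov Γ (.exImpred A φ)) : Prov Γ (.ex A φ) := by
    have hu := Der.univF hA.ctx
    have hd := Der.decHead hA.ctx
    have hm := Der.tyExMatrix (hA.weak hu) (hφ.weakUnder hA hu) hd
    have ho := Der.exF .large hA hφ
    have := Prov.allE (by simpa [Exp.exImpred] using h) hu hm ho.tmCode
    exact .exMatrix_self ho.decCode.tySymm ho.tmCode.tyDec (by simpa using this) hA hφ
  have ho := Der.exF .large hA hφ
  have hi := Der.tyExImpred hA hφ
  have w := ho.largeTy
  have w' := hi.largeTy
  refine .iffI ho hi ?_ ?_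
  · simpa using intro (hA.weak w) (hφ.weakUnder hA w) (by simpa using Prov.hyp ho)
  · simpa using elim (hA.weak w') (hφ.weakUnder hA w') (by simpa using Prov.hyp hi)

end Prov

/-! ### Leibniz equality, over arbitrary collections by resizing -/

theorem Der.piUniv (hA : Der Γ (.ty .col A)) : Der Γ (.ty .col (.pi A .univ)) :=
  .piFUniv hA.colSet

theorem Der.appUniv (hA : Der Γ (.ty .col A)) (hP : Der Γ (.tm P (.pi A .univ)))
    (ha : Der Γ (.tm a A)) : Der Γ (.tm (.app A .univ P a) .univ) :=
  .piE hA (.univF (.ctxCons hA)) hP ha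

theorem Der.tyIdentMatrix (hA : Der Γ (.ty .col A)) (hP : Der Γ (.tm P (.pi A .univ)))
    (ha : Der Γ (.tm a A)) (hb : Der Γ (.tm b A)) :
    Der Γ (.ty .prop (.allImp (.dec (.app A .univ P a)) (.dec (.app A .univ P b)))) :=
  .tyAllImp (.tyDec (.appUniv hA hP ha)) (.tyDec (.appUniv hA hP hb))

theorem Der.tyIdentBody (hA : Der Γ (.ty .col A)) (ha : Der Γ (.tm a A)) (hb : Der Γ (.tm b A)) :
    Der (.pi A .univ :: Γ) (.ty .prop
      (.allImp (.dec (.app (A.wk 1) .univ (Exp.var 0) (a.wk 1)))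
        (.dec (.app (A.wk 1) .univ (Exp.var 0) (b.wk 1))))) := by
  have w := hA.piUniv
  simpa using Der.tyIdentMatrix (hA.weak w) (by simpa using Der.head w) (ha.weak w) (hb.weak w)

theorem Der.tyIdentImpred (hA : Der Γ (.ty .col A)) (ha : Der Γ (.tm a A))
    (hb : Der Γ (.tm b A)) : Der Γ (.ty .prop (.identImpred A a b)) :=
  .tyAll hA.piUniv (.tyIdentBody hA ha hb)

namespace Prov

/-- Equality is eliminated towards the relation `P(x) → P(y)`, whose diagonal is proved by the
identity. -/
theorem identMatrix (h : Prov Γ (.ident A a b)) (hA : Der Γ (.ty .col A))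
    (hP : Der Γ (.tm P (.pi A .univ))) (ha : Der Γ (.tm a A)) (hb : Der Γ (.tm b A)) :
    Prov Γ (.allImp (.dec (.app A .univ P a)) (.dec (.app A .univ P b))) := by
  have hA₁ := hA.weak hA
  have hP₁ := hP.weak hA
  have hA₂ := hA₁.weak hA₁
  have hξ := Der.tyIdentMatrix hA₂ (hP₁.weak hA₁) ((Der.head hA).weak hA₁) (.head hA₁)
  have hr := Prov.allImpRefl (.tyDec (.appUniv hA₁ hP₁ (.head hA)))
  simpa using Prov.identE h hA hξ ha hb (by simpa using hr)

/-- The predicate is taken to be `x ↦ Id(A, a, x)`, and the resulting implication is applied to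
reflexivity. -/
theorem identMatrix_self (h : Prov Γ (.identImpred A a b)) (hA : Der Γ (.ty .col A))
    (ha : Der Γ (.tm a A)) (hb : Der Γ (.tm b A)) : Prov Γ (.ident A a b) := by
  have hq : Der (A :: Γ) (.ty .prop (.ident (A.subst (shift 1)) (a.subst (shift 1)) (var 0))) :=
    .identF .large (hA.weak hA) (ha.weak hA) (.head hA)
  have hu := Der.univF (.ctxCons hA)
  have hP := Der.piI hA hu hA.piUniv hq.tmCode
  -- The predicate at `c` is the equality of `a` and `c` only after a β-step inside the decoding
  -- followed by decoding a code.
  have e {c} (hc : Der Γ (.tm c A)) : Der Γ (.tyEq .col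
      (.dec (.app A .univ (.lam A .univ
        (.code (.ident (A.subst (shift 1)) (a.subst (shift 1)) (var 0)))) c)) (.ident A a c)) := by
    have hi : Der Γ (.ty .prop (.ident A a c)) := .identF .large hA ha hc
    have := (Der.piC hA hu hA.piUniv hq.tmCode hc).univEEq.smallTyEq.setColEq
    exact .tyTrans (by simpa using this) hi.decCode
  have k := Prov.allE h hA.piUniv (.tyIdentBody hA ha hb) hP
  obtain ⟨_, hr⟩ : Prov Γ (.ident A a a) := ⟨_, .identI hA ha⟩
  refine conv (.allImpE (by simpa using k) (.tyDec (.appUniv hA hP ha))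
    (.tyDec (.appUniv hA hP hb)) (.conv ⟨_, hr⟩ (e ha).tySymm)) (e hb)

theorem iff_identImpred (hA : Der Γ (.ty .col A)) (ha : Der Γ (.tm a A)) (hb : Der Γ (.tm b A)) :
    Prov Γ (.iff (.ident A a b) (.identImpred A a b)) := by
  have intro {Γ A a b} (hA : Der Γ (.ty .col A)) (ha : Der Γ (.tm a A)) (hb : Der Γ (.tm b A))
      (h : Prov Γ (.ident A a b)) : Prov Γ (.identImpred A a b) := by
    have w := hA.piUniv
    have := Prov.identMatrix (h.weak w) (hA.weak w) (by simpa using Der.head w) (ha.weak w)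
      (hb.weak w)
    exact .allI w (.tyIdentBody hA ha hb) (by simpa using this)
  have ho : Der Γ (.ty .prop (.ident A a b)) := .identF .large hA ha hb
  have hi := Der.tyIdentImpred hA ha hb
  have w := ho.largeTy
  have w' := hi.largeTy
  refine .iffI ho hi ?_ ?_
  · simpa using intro (hA.weak w) (ha.weak w) (hb.weak w) (.hyp ho)
  · simpa using identMatrix_self (by simpa using Prov.hyp hi) (hA.weak w') (ha.weak w')
      (hb.weak w')

end Prov

/-! ### The universal quantifier and the product of propositions -/

section

variable {f : Exp}

theorem Der.appHead (hA : Der Γ (.ty .col A)) (hφ : Der (A :: Γ) (.ty .prop φ))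
    (hf : Der Γ (.tm f (.pi A φ))) :
    Der (A :: Γ) (.tm (.app (A.wk 1) (φ.wkUnder 1) (f.wk 1) (Exp.var 0)) φ) := by
  have := Der.piE (hA.weak hA) (hφ.weakUnder hA hA).largeTy (by simpa using hf.weak hA) (.head hA)
  simpa using this

theorem Der.allEHead (hA : Der Γ (.ty .col A)) (hφ : Der (A :: Γ) (.ty .prop φ))
    (hf : Der Γ (.tm f (.all A φ))) :
    Der (A :: Γ) (.tm (.allE (A.wk 1) (φ.wkUnder 1) (f.wk 1) (Exp.var 0)) φ) := by
  have := Der.allEl (hA.weak hA) (hφ.weakUnder hA hA) (by simpa using hf.weak hA) (.head hA)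
  simpa using this

/-- Products are available for sets only, so both the collection and the proposition are resized. -/
theorem Der.tyPi (hA : Der Γ (.ty .col A)) (hφ : Der (A :: Γ) (.ty .prop φ)) :
    Der Γ (.ty .col (.pi A φ)) :=
  .setCol (.piF hA.colSet hφ.propProps.smallTy)

/-- A function with values in propositions, as a proof of a universal quantification. -/
theorem Der.exists_all_of_pi (hA : Der Γ (.ty .col A)) (hφ : Der (A :: Γ) (.ty .prop φ))
    (hf : Der Γ (.tm f (.pi A φ))) :
    ∃ t, Der Γ (.tm t (.all A φ)) ∧
      Der (A :: Γ) (.tmEq (.allE (A.wk 1) (φ.wkUnder 1) (t.wk 1) (Exp.var 0))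
        (.app (A.wk 1) (φ.wkUnder 1) (f.wk 1) (Exp.var 0)) φ) := by
  -- The witness is the η-expansion of `f`, and the required equation is its β-rule at the fresh
  -- variable.
  refine ⟨_, .allIn hA hφ (.appHead hA hφ hf), ?_⟩
  have := Der.allC (hA.weak hA) (hφ.weakUnder hA hA)
    ((Der.appHead hA hφ hf).weakUnder hA hA) (.head hA)
  simpa using this

/-- A proof of a universal quantification, as a function. -/
theorem Der.exists_pi_of_all (hA : Der Γ (.ty .col A)) (hφ : Der (A :: Γ) (.ty .prop φ))
    (hf : Der Γ (.tm f (.all A φ))) :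
    ∃ t, Der Γ (.tm t (.pi A φ)) ∧
      Der (A :: Γ) (.tmEq (.app (A.wk 1) (φ.wkUnder 1) (t.wk 1) (Exp.var 0))
        (.allE (A.wk 1) (φ.wkUnder 1) (f.wk 1) (Exp.var 0)) φ) := by
  refine ⟨_, .piI hA hφ.largeTy (.tyPi hA hφ) (.allEHead hA hφ hf), ?_⟩
  have hφ₁ := hφ.weakUnder hA hA
  have := Der.piC (hA.weak hA) hφ₁.largeTy (.tyPi (hA.weak hA) hφ₁)
    ((Der.allEHead hA hφ hf).weakUnder hA hA) (.head hA)
  simpa using this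

end

end MTT

theorem propositiona1 :
    -- the derivable judgements of `CC` are exactly the translations of those of `MTT`
    (∀ (Γ : CC.Ctx) (J : CC.Jdg), CC.Der Γ J ↔
      ∃ (Γ' : MTT.Ctx) (J' : MTT.Jdg), MTT.Der Γ' J' ∧ Γ'.map MTT.Exp.enc = Γ ∧ J'.enc = J) ∧
    -- the translation of `CC` into `MTT` is a section of the one of `MTT` into `CC`,
    (∀ (r : CC.Role) (e : CC.Exp), (e.emb r).enc = e) ∧
    -- it preserves and reflects derivability,
    (∀ (Γ : CC.Ctx) (J : CC.Jdg),
      CC.Der Γ J ↔ MTT.Der (Γ.map (CC.Exp.emb .asTy)) J.emb) ∧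
    -- and it identifies the terms of the universe of `CC` with the propositions of `MTT`
    (∀ (Γ : CC.Ctx) (φ : CC.Exp),
      CC.Der Γ (.tm φ .prop) ↔
        MTT.Der (Γ.map (CC.Exp.emb .asTy)) (.ty .prop (φ.emb .asTy))) ∧
    -- in `MTT`, each propositional constructor is equivalent to its impredicative encoding
    (∀ (Γ : MTT.Ctx), MTT.Der Γ .ctx →
      ∃ t, MTT.Der Γ (.tm t (.iff .bot .botImpred))) ∧
    (∀ (Γ : MTT.Ctx) (φ ψ : MTT.Exp), MTT.Der Γ (.ty .prop φ) → MTT.Der Γ (.ty .prop ψ) →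
      (∃ t, MTT.Der Γ (.tm t (.iff (.or φ ψ) (.orImpred φ ψ)))) ∧
      (∃ t, MTT.Der Γ (.tm t (.iff (.and φ ψ) (.andImpred φ ψ)))) ∧
      (∃ t, MTT.Der Γ (.tm t (.iff (.imp φ ψ) (.allImp φ ψ))))) ∧
    (∀ (Γ : MTT.Ctx) (A φ : MTT.Exp), MTT.Der Γ (.ty .col A) →
      MTT.Der (A :: Γ) (.ty .prop φ) →
      ∃ t, MTT.Der Γ (.tm t (.iff (.ex A φ) (.exImpred A φ)))) ∧
    (∀ (Γ : MTT.Ctx) (A a b : MTT.Exp), MTT.Der Γ (.ty .col A) → MTT.Der Γ (.tm a A) →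
      MTT.Der Γ (.tm b A) →
      ∃ t, MTT.Der Γ (.tm t (.iff (.ident A a b) (.identImpred A a b)))) ∧
    -- and `∀` and `Π` over propositions are interchangeable, compatibly with application
    (∀ (Γ : MTT.Ctx) (A φ : MTT.Exp), MTT.Der Γ (.ty .col A) →
      MTT.Der (A :: Γ) (.ty .prop φ) →
      (∃ t, MTT.Der (.pi A φ :: Γ) (.tm t ((MTT.Exp.all A φ).wk 1)) ∧
        MTT.Der (A.wk 1 :: .pi A φ :: Γ)
          (.tmEq (.allE (A.wk 2) (φ.wkUnder 2) (t.wk 1) (.var 0))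
            (.app (A.wk 2) (φ.wkUnder 2) (.var 1) (.var 0)) (φ.wkUnder 1))) ∧
      (∃ t, MTT.Der (.all A φ :: Γ) (.tm t ((MTT.Exp.pi A φ).wk 1)) ∧
        MTT.Der (A.wk 1 :: .all A φ :: Γ)
          (.tmEq (.app (A.wk 2) (φ.wkUnder 2) (t.wk 1) (.var 0))
            (.allE (A.wk 2) (φ.wkUnder 2) (.var 1) (.var 0)) (φ.wkUnder 1)))) := by
  refine ⟨fun Γ J => ⟨fun h => ⟨_, _, h.emb, CC.enc_emb_ctx Γ, CC.Jdg.enc_emb J⟩, ?_⟩,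
    fun r e => e.enc_emb r, CC.der_iff_emb, CC.der_prop_iff_emb,
    fun _ => MTT.Prov.iff_botImpred,
    fun _ _ _ hφ hψ => ⟨MTT.Prov.iff_orImpred hφ hψ, MTT.Prov.iff_andImpred hφ hψ,
      MTT.Prov.iff_allImp hφ hψ⟩,
    fun _ _ _ => MTT.Prov.iff_exImpred, fun _ _ _ _ => MTT.Prov.iff_identImpred,
    fun Γ A φ hA hφ => ⟨?_, ?_⟩⟩
  · rintro ⟨Γ', J', h, rfl, rfl⟩
    exact h.enc
  · have w := MTT.Der.tyPi hA hφ
    -- The function is the variable just declared, so `A` and `φ` are first weakened past it.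
    have := MTT.Der.exists_all_of_pi (hA.weak w) (hφ.weakUnder hA w) (by simpa using .head w)
    simpa using this
  · have w := (MTT.Der.tyAll hA hφ).largeTy
    have := MTT.Der.exists_pi_of_all (hA.weak w) (hφ.weakUnder hA w) (by simpa using .head w)
    simpa using this
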